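/- Let $M$ be a compact, orientable hyperbolic 3-manifold with nonempty tubular boundary. That is, $\partial M$ is a disjoint union of flat tori $T_1,\dots,T_k$ ($k\ge 1$), and each $T_i$ has a tube radius $R_i\in(0,\infty)$: locally, $M$ near $T_i$ is isometric to the closed exterior, near its boundary, of the tube of radius $R_i$ about a geodesic in $\mathbb H^3$. Thus $T_i$ has constant principal curvatures $\coth R_i$ and $\tanh R_i$. The canonical filling $\hat M$ is the (generally incomplete) hyperbolic 3-manifold obtained from $M$ by attaching to each $T_i$ a collar $T_i\times[0,R_i)$ along $T_i\times\{0\}$, extending the hyperbolic structure along the normals, so that $T_i\times\{s\}$ is a tubular torus of tube radius $R_i-s$. The tube radius $\hat R$ of $\hat M$ is the supremum of all $r>0$ such that all ends of $\hat M$ can be truncated simultaneously along disjoint, embedded tubular tori of tube radius $r$. The total visual area of $\partial M$ is $$\mathcal A=\sum_{i=1}^k\frac{\operatorname{area}(T_i)}{\sinh R_i\,\cosh R_i},$$ where $\operatorname{area}(T_i)$ is the area of the flat torus $T_i$. Then the set of all such $r$ is nonempty and bounded above, so that $0<\hat R<\infty$, and $$\mathcal A\;\ge\; h(\hat R),\qquad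 h(r)=3.3957\,\frac{\tanh r}{\cosh(2r)}.$$ -/

import Mathlib

open Real Set Filter Topology

noncomputable section

namespace TubularHyp

/-! Hyperbolic three-space is used in the hyperboloid model inside `ℝ⁴` with the form
`-x₀² + x₁² + x₂² + x₃²`; a hyperbolic structure is an atlas of charts into it whose
transition maps are locally restrictions of orientation-preserving isometries. -/

/-- Hyperbolic space `ℍ³` (upper sheet of the hyperboloid). -/
def H3 : Set (Fin 4 → ℝ) :=
  {x | 0 < x 0 ∧ x 0 ^ 2 - x 1 ^ 2 - x 2 ^ 2 - x 3 ^ 2 = 1}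

/-- Gram matrix of the Lorentz form. -/
def lorentz : Matrix (Fin 4) (Fin 4) ℝ := Matrix.diagonal ![-1, 1, 1, 1]

/-- The matrices of `SO⁺(1,3)`, which act on `H3` as the orientation-preserving isometries. -/
def IsIsom (g : Matrix (Fin 4) (Fin 4) ℝ) : Prop :=
  g.transpose * lorentz * g = lorentz ∧ g.det = 1 ∧ 0 < g 0 0

/-- The point with hyperbolic cylindrical coordinates `(ρ, θ, ζ)`: distance `ρ` from the axis
`{x₂ = x₃ = 0}`, rotation angle `θ` around it, signed length `ζ` along it. -/
def cyl (ρ θ ζ : ℝ) : Fin 4 → ℝ :=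
  ![cosh ρ * cosh ζ, cosh ρ * sinh ζ, sinh ρ * cos θ, sinh ρ * sin θ]

/-- Points of `H3` at distance at least `R` from the axis
(the distance `ρ` from the axis satisfies `sinh² ρ = x₂² + x₃²`). -/
def tubeExterior (R : ℝ) : Set (Fin 4 → ℝ) :=
  {x | x ∈ H3 ∧ sinh R ^ 2 ≤ x 2 ^ 2 + x 3 ^ 2}

/-- The cylinder of radius `R` around the axis. -/
def tubeSurface (R : ℝ) : Set (Fin 4 → ℝ) :=
  {x | x ∈ H3 ∧ x 2 ^ 2 + x 3 ^ 2 = sinh R ^ 2}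

/-- Radial motion: a point with cylindrical coordinates `(R, θ, ζ)` goes to `(ρ, θ, ζ)`.
For `ρ = R` this is the identity of `ℝ⁴`. -/
def radial (R ρ : ℝ) (x : Fin 4 → ℝ) : Fin 4 → ℝ :=
  ![cosh ρ / cosh R * x 0, cosh ρ / cosh R * x 1,
    sinh ρ / sinh R * x 2, sinh ρ / sinh R * x 3]

/-- The Euclidean plane. -/
abbrev Plane := EuclideanSpace ℝ (Fin 2)

/-- For a torus of tube radius `R` with flat coordinates `u = (x₁, x₂)` in the directions of the
principal curvatures `coth R, tanh R`: the point with cylindrical coordinates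
`(ρ, x₁ / sinh R, x₂ / cosh R)`, lying on the normal geodesic through the point `u`.
For `ρ = R` it is the isometric immersion of the plane onto the cylinder of radius `R`. -/
def tubePoint (R ρ : ℝ) (u : Plane) : Fin 4 → ℝ :=
  cyl ρ (u 0 / sinh R) (u 1 / cosh R)

/-- A chart: a homeomorphism from an open set of `M` onto a relatively open subset of the
exterior (boundary included) of the tube of radius `radius`. A chart near an interior point is
of this form as well, its image being placed away from the tube. -/
structure Chart (M : Type*) [TopologicalSpace M] where
  source : Set M
  isOpen_source : IsOpen source
  toFun : M → Fin 4 → ℝ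
  radius : ℝ
  radius_pos : 0 < radius
  isEmbedding : IsEmbedding (source.domRestrict toFun)
  image_eq : ∃ W : Set (Fin 4 → ℝ), IsOpen W ∧ toFun '' source = W ∩ tubeExterior radius

end TubularHyp

open TubularHyp in
/-- An oriented hyperbolic structure with tubular boundary on `M`, the boundary components being
indexed by `ι`. The component `i` is a flat torus `𝔼² / Γᵢ` of tube radius `Rᵢ ∈ (0, ∞)`
(principal curvatures `coth Rᵢ`, `tanh Rᵢ`), with `M` on the outer side of the tube. -/
structure TubularManifold (M : Type*) [TopologicalSpace M] (ι : Type*) where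
  charts : Set (Chart M)
  cover : ∀ x : M, ∃ φ ∈ charts, x ∈ φ.source
  compat : ∀ φ ∈ charts, ∀ ψ ∈ charts, ∀ x ∈ φ.source ∩ ψ.source,
    ∃ g, IsIsom g ∧ ∀ᶠ y in 𝓝 x, ψ.toFun y = g.mulVec (φ.toFun y)
  /-- tube radius of the boundary components -/
  radius : ι → ℝ
  radius_pos : ∀ i, 0 < radius i
  /-- the lattice of translations `Γᵢ` of the plane -/
  lattice : ι → Submodule ℤ Plane
  discrete : ∀ i, DiscreteTopology (lattice i)
  isZLattice : ∀ i, IsZLattice ℝ (lattice i)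
  /-- the universal covering `𝔼² → 𝔼² / Γᵢ = Tᵢ ⊆ M` of the boundary torus `Tᵢ` -/
  torus : ι → Plane → M
  torus_eq_iff : ∀ i j u v, torus i u = torus j v ↔ i = j ∧ u - v ∈ lattice i
  /-- in a suitable chart, `Tᵢ` is locally the cylinder of radius `Rᵢ`, isometrically
  parametrized with coordinate axes in the directions of principal curvature -/
  torus_chart : ∀ i u, ∃ φ ∈ charts, φ.radius = radius i ∧
    ∀ᶠ v in 𝓝 u, torus i v ∈ φ.source ∧
      φ.toFun (torus i v) = tubePoint (radius i) (radius i) v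
  /-- there are no boundary points besides those of the tori -/
  boundary : ∀ φ ∈ charts, ∀ x ∈ φ.source, φ.toFun x ∈ tubeSurface φ.radius →
    ∃ i u, torus i u = x

namespace TubularManifold

open TubularHyp

variable {M : Type*} [TopologicalSpace M] {ι : Type*}

/-- The canonical filling `M̂`: to each boundary torus `Tᵢ` the collar `Tᵢ × [0, Rᵢ)` is attached
along `Tᵢ × {0}`; the second coordinate is the depth below the boundary, so that `Tᵢ × {s}` is a
torus of tube radius `Rᵢ - s`. It carries the subspace topology of `M × ℝ`. -/
abbrev Filling (X : TubularManifold M ι) : Type _ :=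
  {p : M × ℝ // p.2 = 0 ∨ ∃ i u, X.torus i u = p.1 ∧ 0 < p.2 ∧ p.2 < X.radius i}

/-- The charts of the hyperbolic structure of `M̂`: a chart `φ` of `M` is extended normally to the
part of the collars lying over the boundary points in its source. The extension of `φ` is defined
on the points `p` with `p.1.1 ∈ φ.source`. -/
def fillingChart (X : TubularManifold M ι) (φ : Chart M) (p : X.Filling) : Fin 4 → ℝ :=
  radial φ.radius (φ.radius - p.1.2) (φ.toFun p.1.1)

/-- The ends of `M̂` have disjoint embedded tubes of radius `r`. The tube of the end `i` is
`(0, r] × 𝔼² / Γᵢ` with cylindrical coordinates; `F i ρ u` is the point of `M̂` at distance `ρ` from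
the core. `F` starts as the foliation of the end by tubular tori, continues it by local isometries,
and identifies only points that differ by an element of the lattice. -/
structure IsTubeEmbedding (X : TubularManifold M ι) (r : ℝ)
    (F : ι → ℝ → Plane → X.Filling) : Prop where
  start : ∀ i, ∀ ρ ∈ Ioc 0 r, ρ ≤ X.radius i → ∀ u,
    (F i ρ u).1 = (X.torus i u, X.radius i - ρ)
  continuousOn : ∀ i, ContinuousOn (fun p : ℝ × Plane => F i p.1 p.2) (Ioc 0 r ×ˢ univ)
  isometry : ∀ i, ∀ ρ ∈ Ioc 0 r, ∀ u, ∃ φ ∈ X.charts, ∃ g, IsIsom g ∧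
    (F i ρ u).1.1 ∈ φ.source ∧
    ∀ᶠ p : ℝ × Plane in 𝓝[Ioc 0 r ×ˢ univ] (ρ, u),
      X.fillingChart φ (F i p.1 p.2) = g.mulVec (tubePoint (X.radius i) p.1 p.2)
  eq_iff : ∀ i j, ∀ ρ ∈ Ioc 0 r, ∀ σ ∈ Ioc 0 r, ∀ u v,
    F i ρ u = F j σ v ↔ i = j ∧ ρ = σ ∧ u - v ∈ X.lattice i

/-- The radii `r > 0` such that all ends of `M̂` can be truncated along disjoint embedded tubular
tori of tube radius `r`. -/
def tubeRadii (X : TubularManifold M ι) : Set ℝ :=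
  {r | 0 < r ∧ ∃ F : ι → ℝ → Plane → X.Filling, X.IsTubeEmbedding r F}

/-- The tube radius of the canonical filling. -/
def tubeRadius (X : TubularManifold M ι) : ℝ := sSup X.tubeRadii

/-- The area of the flat torus `Tᵢ = 𝔼² / Γᵢ`. -/
def torusArea (X : TubularManifold M ι) (i : ι) : ℝ := ZLattice.covolume (X.lattice i)

/-- The visual area of the boundary torus `Tᵢ`. -/
def visualArea (X : TubularManifold M ι) (i : ι) : ℝ :=
  X.torusArea i / (sinh (X.radius i) * cosh (X.radius i))

/-- The total visual area of `∂M`. -/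
def totalVisualArea [Fintype ι] (X : TubularManifold M ι) : ℝ := ∑ i, X.visualArea i

end TubularManifold

/-- The function `h(r) = 3.3957 tanh r / cosh (2r)`. -/
def packingBound (r : ℝ) : ℝ := 3.3957 * (tanh r / cosh (2 * r))

end

/-!
The tubes about the ends of the canonical filling are expanded until they touch, and the points at
which they touch are counted on the boundary tori.

*Tubes.* The end `i` has a normal exponential map `TubularManifold.tube`, which continues the
collar along the rays normal to the core as a developed map of the hyperbolic structure of the
filling (`TubularManifold.atlas`), as far as possible. Its domain is controlled by
`TubularManifold.EmbTo.mem_tubeDom`: if the tubes of radius `r` are embedded with disjoint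
interiors, then the rays exist up to the distance `2r`, because by compactness of `M` a ray can
only end in a core, and a ray which has left its tube at the distance `r` needs at least the length
`r` to reach a core (`EmbTo.two_mul_le`). So tubes of radius slightly larger than `r` can only fail
to be embedded, and at the supremum of the radii tubes touch (`EmbTo.exists_touching`). The
supremum is finite since an infinite ray would accumulate at some point and could not be embedded
(`bddAbove_tubeRadii`), and the collars themselves are embedded tubes (`tubeRadii_nonempty`).

*Separation.* At a touching point the tubes have opposite normals, since their interiors are
disjoint (`TubularHyp.mulVec_normal_eq_neg`). Hence the ray of the first tube through this point,
prolonged to the distance `2r`, runs towards a point of the core of the second one, and the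
development of the first tube maps the ball of radius `r` about this point into the second tube
(`EmbTo.tube_eq_near`). If two such points have distance less than `2r`, then the midpoint between
them lies in both balls, so that both rays lead to the same core; the core is orthogonal to both
rays, and so the rays coincide. For touching points on one tube whose angles differ by `θ` and
whose lengths along the core differ by `ζ`, this says `cosh 2r ≤ cosh² 2r · cosh ζ - sinh² 2r · cos
θ` (`EmbTo.touching_separated`).

*Packing.* The bounds `cos θ ≥ 1 - θ² / 2` and `cosh ζ - 1 ≤ ζ² / (4 log² 2)`, the latter for `|ζ|
≤ log 2`, turn this inequality into the lower bound `1` for a positive definite quadratic form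
(`one_le_form_of_separated`). In flat coordinates of a boundary torus, touching points are thus
centres of a packing by ellipses which is invariant under the lattice. There are two of them modulo
the lattice on one torus, or one on each of two tori. By reduction theory, such a packing has at
most the density of the hexagonal packing (`sqrt_three_le_covolume`,
`sqrt_three_div_two_le_covolume`). In both cases the total visual area is at least `2 √6 log 2 ·
tanh r / cosh 2r`, where `2 √6 log 2 = 3.39571…`.
-/

noncomputable section

namespace TubularHyp

open scoped Matrix

/-! ### The Lorentz form and its isometries -/

/-- The negative of the Lorentz form; on `H3` it is the hyperbolic cosine of the distance. -/
def mink (x y : Fin 4 → ℝ) : ℝ := x 0 * y 0 - x 1 * y 1 - x 2 * y 2 - x 3 * y 3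

lemma mink_eq_dotProduct (x y : Fin 4 → ℝ) : mink x y = -(x ⬝ᵥ lorentz *ᵥ y) := by
  simp [mink, lorentz, dotProduct, Fin.sum_univ_four, Matrix.mulVec_diagonal]
  ring

lemma mink_comm (x y : Fin 4 → ℝ) : mink x y = mink y x := by
  simp only [mink]; ring

lemma continuous_mink : Continuous fun p : (Fin 4 → ℝ) × (Fin 4 → ℝ) => mink p.1 p.2 := by
  unfold mink; fun_prop

lemma lorentz_mul_self : lorentz * lorentz = 1 := by
  ext i j
  fin_cases i <;> fin_cases j <;> simp [lorentz]

lemma lorentz_transpose : lorentz.transpose = lorentz := by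
  simp [lorentz]

lemma mem_H3_iff {x : Fin 4 → ℝ} : x ∈ H3 ↔ 0 < x 0 ∧ mink x x = 1 := by
  simp only [H3, mink, mem_ofPred_eq]
  constructor <;> rintro ⟨h1, h2⟩ <;> exact ⟨h1, by linarith⟩

lemma one_le_mink {x y : Fin 4 → ℝ} (hx : x ∈ H3) (hy : y ∈ H3) : 1 ≤ mink x y := by
  obtain ⟨hx0, hx⟩ := hx
  obtain ⟨hy0, hy⟩ := hy
  have h1 : (x 1 * y 1 + x 2 * y 2 + x 3 * y 3 + 1) ^ 2 ≤ (x 0 * y 0) ^ 2 := by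
    have : (x 0 * y 0) ^ 2 =
        (1 + x 1 ^ 2 + x 2 ^ 2 + x 3 ^ 2) * (1 + y 1 ^ 2 + y 2 ^ 2 + y 3 ^ 2) := by
      rw [mul_pow]; congr 1 <;> linarith
    rw [this]
    nlinarith [sq_nonneg (x 1 - y 1), sq_nonneg (x 2 - y 2), sq_nonneg (x 3 - y 3),
      sq_nonneg (x 1 * y 2 - x 2 * y 1), sq_nonneg (x 1 * y 3 - x 3 * y 1),
      sq_nonneg (x 2 * y 3 - x 3 * y 2)]
  have := le_of_abs_le (abs_le_of_sq_le_sq h1 (by positivity))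
  simp only [mink]
  linarith

/-- The origin of `H3`. -/
def origin : Fin 4 → ℝ := ![1, 0, 0, 0]

lemma origin_mem : origin ∈ H3 := by simp [origin, H3]

/-- The inverse of a Lorentz matrix. -/
def isomInv (g : Matrix (Fin 4) (Fin 4) ℝ) : Matrix (Fin 4) (Fin 4) ℝ :=
  lorentz * g.transpose * lorentz

namespace IsIsom

variable {g h : Matrix (Fin 4) (Fin 4) ℝ}

lemma inv_mul (hg : IsIsom g) : isomInv g * g = 1 := by
  rw [isomInv, Matrix.mul_assoc, Matrix.mul_assoc, ← Matrix.mul_assoc g.transpose, hg.1,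
    lorentz_mul_self]

lemma mul_inv (hg : IsIsom g) : g * isomInv g = 1 :=
  mul_eq_one_comm.mp hg.inv_mul

lemma inv_mulVec (hg : IsIsom g) (x : Fin 4 → ℝ) : isomInv g *ᵥ (g *ᵥ x) = x := by
  rw [Matrix.mulVec_mulVec, hg.inv_mul, Matrix.one_mulVec]

lemma mulVec_inv (hg : IsIsom g) (x : Fin 4 → ℝ) : g *ᵥ (isomInv g *ᵥ x) = x := by
  rw [Matrix.mulVec_mulVec, hg.mul_inv, Matrix.one_mulVec]

lemma injective (hg : IsIsom g) : Function.Injective (g *ᵥ ·) :=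
  Function.LeftInverse.injective hg.inv_mulVec

lemma mink_mulVec (hg : IsIsom g) (x y : Fin 4 → ℝ) : mink (g *ᵥ x) (g *ᵥ y) = mink x y := by
  rw [mink_eq_dotProduct, mink_eq_dotProduct]
  conv_rhs => rw [← hg.1, ← Matrix.mulVec_mulVec, ← Matrix.mulVec_mulVec,
    Matrix.dotProduct_mulVec x, Matrix.vecMul_transpose]

lemma mul_transpose (hg : IsIsom g) : g * lorentz * g.transpose = lorentz := by
  have h := hg.mul_inv
  rw [isomInv] at h
  have h2 := congrArg (· * lorentz) h
  simp only [Matrix.mul_assoc, lorentz_mul_self, Matrix.mul_one, Matrix.one_mul] at h2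
  rw [Matrix.mul_assoc, h2]

lemma rows (hg : IsIsom g) (i j : Fin 4) :
    -(g i 0 * g j 0) + g i 1 * g j 1 + g i 2 * g j 2 + g i 3 * g j 3 = lorentz i j := by
  have h := congrFun (congrFun hg.mul_transpose i) j
  rw [← h]
  simp [Matrix.mul_apply, Fin.sum_univ_four, lorentz, Matrix.diagonal_apply]

lemma mulVec_mem (hg : IsIsom g) {x : Fin 4 → ℝ} (hx : x ∈ H3) : g *ᵥ x ∈ H3 := by
  rw [mem_H3_iff] at *
  refine ⟨?_, by rw [hg.mink_mulVec]; exact hx.2⟩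
  -- the first row of `g`, with the signs of its last three entries changed, is a point of `H3`
  have hr : ![g 0 0, -g 0 1, -g 0 2, -g 0 3] ∈ H3 := by
    refine ⟨by simpa using hg.2.2, ?_⟩
    have h00 : lorentz 0 0 = -1 := by simp [lorentz]
    have := hg.rows 0 0
    rw [h00] at this
    simp
    linarith
  have h1 := one_le_mink hr (mem_H3_iff.mpr hx)
  have h2 : (g *ᵥ x) 0 = mink ![g 0 0, -g 0 1, -g 0 2, -g 0 3] x := by
    simp [mink, Matrix.mulVec, dotProduct, Fin.sum_univ_four]
  linarith

lemma mul (hg : IsIsom g) (hh : IsIsom h) : IsIsom (g * h) := by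
  refine ⟨?_, by rw [Matrix.det_mul, hg.2.1, hh.2.1, one_mul], ?_⟩
  · have : (g * h).transpose * lorentz * (g * h)
        = h.transpose * (g.transpose * lorentz * g) * h := by
      simp only [Matrix.transpose_mul, Matrix.mul_assoc]
    rw [this, hg.1, hh.1]
  · have h1 := (hg.mulVec_mem (hh.mulVec_mem origin_mem)).1
    have h2 : (g *ᵥ (h *ᵥ origin)) 0 = (g * h) 0 0 := by
      rw [Matrix.mulVec_mulVec]
      simp [origin, Matrix.mulVec, dotProduct, Fin.sum_univ_four]
    rwa [h2] at h1

lemma inv (hg : IsIsom g) : IsIsom (isomInv g) := by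
  refine ⟨?_, ?_, ?_⟩
  · have h := hg.mul_transpose
    calc (isomInv g).transpose * lorentz * isomInv g
        = lorentz * g * (lorentz * lorentz) * lorentz * g.transpose * lorentz := by
          simp only [isomInv, Matrix.transpose_mul, lorentz_transpose, Matrix.transpose_transpose,
            Matrix.mul_assoc]
      _ = lorentz * (g * lorentz * g.transpose) * lorentz := by
          rw [lorentz_mul_self]; simp only [Matrix.mul_assoc, Matrix.one_mul]
      _ = lorentz := by rw [h, lorentz_mul_self, Matrix.one_mul]
  · have h1 := congrArg Matrix.det hg.inv_mul
    rwa [Matrix.det_mul, hg.2.1, mul_one, Matrix.det_one] at h1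
  · have : isomInv g 0 0 = g 0 0 := by
      simp [isomInv, lorentz, Matrix.mul_apply, Matrix.diagonal_apply]
    rw [this]; exact hg.2.2

lemma eq_inv_mulVec (hg : IsIsom g) {x y : Fin 4 → ℝ} (h : g *ᵥ x = y) : x = isomInv g *ᵥ y := by
  rw [← h, hg.inv_mulVec]

lemma mink_inv_mulVec (hg : IsIsom g) (x y : Fin 4 → ℝ) :
    mink (isomInv g *ᵥ x) y = mink x (g *ᵥ y) := by
  rw [← hg.mink_mulVec, hg.mulVec_inv]

end IsIsom

lemma continuous_mulVec (g : Matrix (Fin 4) (Fin 4) ℝ) :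
    Continuous fun x : Fin 4 → ℝ => g *ᵥ x :=
  Continuous.matrix_mulVec continuous_const continuous_id

/-! ### Cylindrical coordinates -/

/-- Cylindrical coordinates `(ρ, θ, ζ)` as a map on `ℝ × (ℝ × ℝ)`. -/
def cylP (z : ℝ × ℝ × ℝ) : Fin 4 → ℝ := cyl z.1 z.2.1 z.2.2

lemma continuous_cylP : Continuous cylP := by
  refine continuous_pi fun i => ?_
  fin_cases i <;> simp only [cylP, cyl, Fin.zero_eta, Fin.mk_one, Fin.reduceFinMk,
    Matrix.cons_val] <;> fun_prop

lemma cylP_mem (z : ℝ × ℝ × ℝ) : cylP z ∈ H3 := by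
  refine ⟨by simp [cylP, cyl]; positivity, ?_⟩
  simp only [cylP, cyl, Matrix.cons_val]
  nlinarith [cosh_sq z.1, cosh_sq z.2.2, sin_sq_add_cos_sq z.2.1]

lemma mink_cylP (z z' : ℝ × ℝ × ℝ) : mink (cylP z) (cylP z') =
    cosh z.1 * cosh z'.1 * cosh (z.2.2 - z'.2.2)
      - sinh z.1 * sinh z'.1 * cos (z.2.1 - z'.2.1) := by
  simp only [mink, cylP, cyl, Matrix.cons_val, cosh_sub, cos_sub]
  ring

/-- The distance to the axis is 1-Lipschitz. -/
lemma cosh_sub_le_mink_cylP {z z' : ℝ × ℝ × ℝ} (hz : 0 ≤ z.1) (hz' : 0 ≤ z'.1) :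
    cosh (z.1 - z'.1) ≤ mink (cylP z) (cylP z') := by
  rw [mink_cylP, cosh_sub]
  have h1 : cosh z.1 * cosh z'.1 * 1 ≤ cosh z.1 * cosh z'.1 * cosh (z.2.2 - z'.2.2) := by
    gcongr; exact one_le_cosh _
  have h2 : sinh z.1 * sinh z'.1 * cos (z.2.1 - z'.2.1) ≤ sinh z.1 * sinh z'.1 * 1 := by
    have := sinh_nonneg_iff.mpr hz
    have := sinh_nonneg_iff.mpr hz'
    gcongr
    exact cos_le_one _
  linarith

/-- The screw motion along the axis of the tube with angle `w.1` and translation length `w.2`. -/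
def screw (w : ℝ × ℝ) : Matrix (Fin 4) (Fin 4) ℝ :=
  !![cosh w.2, sinh w.2, 0, 0; sinh w.2, cosh w.2, 0, 0;
     0, 0, cos w.1, -sin w.1; 0, 0, sin w.1, cos w.1]

lemma screw_mulVec (w : ℝ × ℝ) (x : Fin 4 → ℝ) : screw w *ᵥ x =
    ![cosh w.2 * x 0 + sinh w.2 * x 1, sinh w.2 * x 0 + cosh w.2 * x 1,
      cos w.1 * x 2 - sin w.1 * x 3, sin w.1 * x 2 + cos w.1 * x 3] := by
  ext i
  fin_cases i <;> simp [screw, Matrix.mulVec, dotProduct, Fin.sum_univ_four]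
  ring

lemma screw_isIsom (w : ℝ × ℝ) : IsIsom (screw w) := by
  have h1 := cosh_sq w.2
  have h2 := sin_sq_add_cos_sq w.1
  refine ⟨?_, ?_, by simp [screw]; positivity⟩
  · ext i j
    fin_cases i <;> fin_cases j <;>
      simp [screw, lorentz, Matrix.mul_apply, Fin.sum_univ_four, Matrix.diagonal_apply] <;>
      nlinarith
  · simp [screw, Matrix.det_succ_row_zero, Fin.sum_univ_succ, Fin.succAbove]
    have : cosh w.2 * (cosh w.2 * (cos w.1 * cos w.1 + sin w.1 * sin w.1)) -
      sinh w.2 * (sinh w.2 * (cos w.1 * cos w.1 + sin w.1 * sin w.1)) = 1 := by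
      have : cos w.1 * cos w.1 + sin w.1 * sin w.1 = 1 := by linarith
      rw [this]; linarith
    linarith

lemma screw_cylP (w : ℝ × ℝ) (z : ℝ × ℝ × ℝ) : screw w *ᵥ cylP z = cylP (z.1, w + z.2) := by
  rw [screw_mulVec]
  ext i
  fin_cases i <;> simp [cylP, cyl, cosh_add, sinh_add, cos_add, sin_add] <;> ring

lemma screw_neg_screw (w : ℝ × ℝ) (x : Fin 4 → ℝ) : screw (-w) *ᵥ (screw w *ᵥ x) = x := by
  rw [screw_mulVec, screw_mulVec]
  have h1 := cosh_sq w.2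
  have h2 := sin_sq_add_cos_sq w.1
  ext i
  fin_cases i <;> simp
  · linear_combination x 0 * h1
  · linear_combination x 1 * h1
  · linear_combination x 2 * h2
  · linear_combination x 3 * h2

/-- Cylindrical coordinates on the half-space `x₂ > 0`, with angle in `(-π/2, π/2)`. -/
def sec (x : Fin 4 → ℝ) : ℝ × ℝ × ℝ :=
  (arsinh √(x 2 ^ 2 + x 3 ^ 2), arctan (x 3 / x 2), arsinh (x 1 / √(1 + (x 2 ^ 2 + x 3 ^ 2))))

lemma sec_fst_pos {x : Fin 4 → ℝ} (hx : 0 < x 2) : 0 < (sec x).1 := by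
  simp only [sec, arsinh_pos_iff]; positivity

lemma cosh_sec_fst (x : Fin 4 → ℝ) : cosh (sec x).1 = √(1 + (x 2 ^ 2 + x 3 ^ 2)) := by
  rw [sec, cosh_arsinh, sq_sqrt (by positivity)]

lemma cylP_sec {x : Fin 4 → ℝ} (hx : x ∈ H3) (h2 : 0 < x 2) : cylP (sec x) = x := by
  have hs : 0 < √(x 2 ^ 2 + x 3 ^ 2) := by positivity
  have hc : 0 < √(1 + (x 2 ^ 2 + x 3 ^ 2)) := by positivity
  have hcs := sq_sqrt (show 0 ≤ 1 + (x 2 ^ 2 + x 3 ^ 2) by positivity)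
  have h4 : √(1 + (x 3 / x 2) ^ 2) = √(x 2 ^ 2 + x 3 ^ 2) / x 2 := by
    rw [sqrt_eq_iff_mul_self_eq (by positivity) (by positivity), div_mul_div_comm,
      mul_self_sqrt (by positivity)]
    field_simp
  have h5 : √(1 + (x 1 / √(1 + (x 2 ^ 2 + x 3 ^ 2))) ^ 2) = x 0 / √(1 + (x 2 ^ 2 + x 3 ^ 2)) := by
    have hx0 := hx.1
    rw [sqrt_eq_iff_mul_self_eq (by positivity) (by positivity)]
    field_simp
    nlinarith [hx.2]
  ext i
  fin_cases i
  · simp only [cylP, cyl, Fin.zero_eta, Matrix.cons_val, cosh_sec_fst]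
    simp only [sec, cosh_arsinh, h5]
    field_simp
  · simp only [cylP, cyl, Fin.mk_one, Matrix.cons_val, cosh_sec_fst]
    simp only [sec, sinh_arsinh]
    field_simp
  · simp only [cylP, cyl, Fin.reduceFinMk, Matrix.cons_val, sec, sinh_arsinh, cos_arctan, h4]
    field_simp
  · simp only [cylP, cyl, Fin.reduceFinMk, Matrix.cons_val, sec, sinh_arsinh, sin_arctan, h4]
    field_simp

lemma sec_cylP {z : ℝ × ℝ × ℝ} (hz : 0 < z.1) (h1 : -(π / 2) < z.2.1) (h2 : z.2.1 < π / 2) :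
    sec (cylP z) = z := by
  have hs : 0 < sinh z.1 := sinh_pos_iff.mpr hz
  have h3 : (cylP z 2) ^ 2 + (cylP z 3) ^ 2 = sinh z.1 ^ 2 := by
    simp only [cylP, cyl, Matrix.cons_val]
    linear_combination sinh z.1 ^ 2 * sin_sq_add_cos_sq z.2.1
  have h4 : √(1 + sinh z.1 ^ 2) = cosh z.1 := by
    rw [add_comm, ← cosh_sq, sqrt_sq (cosh_pos _).le]
  have h5 : cylP z 3 / cylP z 2 = tan z.2.1 := by
    simp only [cylP, cyl, Matrix.cons_val, tan_eq_sin_div_cos]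
    field_simp
  have h6 : cylP z 1 / cosh z.1 = sinh z.2.2 := by
    simp only [cylP, cyl, Matrix.cons_val]
    field_simp
  simp only [sec, h3, h4, h5, h6, sqrt_sq hs.le, arsinh_sinh, arctan_tan h1 h2]

lemma sec_snd_mem (x : Fin 4 → ℝ) : (sec x).2.1 ∈ Ioo (-(π / 2)) (π / 2) :=
  arctan_mem_Ioo _

lemma continuousAt_sec {x : Fin 4 → ℝ} (hx : 0 < x 2) : ContinuousAt sec x := by
  unfold sec
  have h1 : √(1 + (x 2 ^ 2 + x 3 ^ 2)) ≠ 0 := by positivity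
  have h2 : x 2 ≠ 0 := hx.ne'
  fun_prop (disch := assumption)

/-- A local inverse of cylindrical coordinates near the point `cylP (ρ, w)`. -/
def secAt (w : ℝ × ℝ) (x : Fin 4 → ℝ) : ℝ × ℝ × ℝ :=
  ((sec (screw (-w) *ᵥ x)).1, w + (sec (screw (-w) *ᵥ x)).2)

lemma screw_neg_cylP_two_pos {z : ℝ × ℝ × ℝ} (hz : 0 < z.1) :
    0 < (screw (-z.2) *ᵥ cylP z) 2 := by
  rw [screw_cylP]
  simp [cylP, cyl, hz]

lemma continuousAt_secAt {z : ℝ × ℝ × ℝ} (hz : 0 < z.1) : ContinuousAt (secAt z.2) (cylP z) := by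
  have h1 : ContinuousAt (fun x => sec (screw (-z.2) *ᵥ x)) (cylP z) :=
    ContinuousAt.comp (g := sec) (continuousAt_sec (screw_neg_cylP_two_pos hz))
      (continuous_mulVec _).continuousAt
  exact h1.fst.prodMk (continuousAt_const.add h1.snd)

lemma cylP_secAt {z : ℝ × ℝ × ℝ} (hz : 0 < z.1) :
    ∀ᶠ x in 𝓝 (cylP z), x ∈ H3 → cylP (secAt z.2 x) = x := by
  have h1 : ∀ᶠ x in 𝓝 (cylP z), 0 < (screw (-z.2) *ᵥ x) 2 := by
    refine ContinuousAt.eventually_lt continuousAt_const ?_ (screw_neg_cylP_two_pos hz)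
    exact ((continuous_apply 2).comp (continuous_mulVec _)).continuousAt
  filter_upwards [h1] with x hx hxH
  have h2 := cylP_sec ((screw_isIsom _).mulVec_mem hxH) hx
  rw [secAt, ← screw_cylP, h2]
  simpa using screw_neg_screw (-z.2) x

lemma secAt_cylP {z : ℝ × ℝ × ℝ} (hz : 0 < z.1) : ∀ᶠ z' in 𝓝 z, secAt z.2 (cylP z') = z' := by
  have h1 : ∀ᶠ z' in 𝓝 z, 0 < z'.1 :=
    ContinuousAt.eventually_lt continuousAt_const continuousAt_fst hz
  have h2 : ∀ᶠ z' : ℝ × ℝ × ℝ in 𝓝 z, -(π / 2) < (-z.2 + z'.2).1 :=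
    ContinuousAt.eventually_lt continuousAt_const (by fun_prop) (by simp [pi_pos])
  have h3 : ∀ᶠ z' : ℝ × ℝ × ℝ in 𝓝 z, (-z.2 + z'.2).1 < π / 2 :=
    ContinuousAt.eventually_lt (by fun_prop) continuousAt_const (by simp [pi_pos])
  filter_upwards [h1, h2, h3] with z' k1 k2 k3
  rw [secAt, screw_cylP, sec_cylP (z := (z'.1, -z.2 + z'.2)) k1 k2 k3]
  simp

lemma secAt_self {z : ℝ × ℝ × ℝ} (hz : 0 < z.1) : secAt z.2 (cylP z) = z :=
  (secAt_cylP hz).self_of_nhds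

/-- A matrix is determined by its values near one point of `H3` off the axis. -/
lemma matrix_eq_of_eventually {g h : Matrix (Fin 4) (Fin 4) ℝ} {z : ℝ × ℝ × ℝ}
    (H : ∀ᶠ z' in 𝓝 z, g *ᵥ cylP z' = h *ᵥ cylP z') : g = h := by
  have an : ∀ (k : Matrix (Fin 4) (Fin 4) ℝ) (i : Fin 4),
      AnalyticOnNhd ℝ (fun z' => (k *ᵥ cylP z') i) univ := by
    intro k i
    simp only [Matrix.mulVec, dotProduct, Fin.sum_univ_four, cylP, cyl, Matrix.cons_val]
    rw [← contDiff_omega_iff_analyticOnNhd]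
    fun_prop
  have key : ∀ i z', (g *ᵥ cylP z') i = (h *ᵥ cylP z') i := by
    intro i z'
    have := (an g i).eq_of_eventuallyEq (an h i) (z₀ := z) (H.mono fun z' h => congrFun h i)
    exact congrFun this z'
  have hs1 : 0 < sinh (1 : ℝ) := sinh_pos_iff.mpr one_pos
  ext i j
  have k0 := key i (0, 0, 0)
  have k1 := key i (0, 0, 1)
  have k2 := key i (1, 0, 0)
  have k3 := key i (1, π / 2, 0)
  simp only [Matrix.mulVec, dotProduct, Fin.sum_univ_four, cylP, cyl, Matrix.cons_val, cosh_zero,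
    sinh_zero, cos_zero, sin_zero, cos_pi_div_two, sin_pi_div_two] at k0 k1 k2 k3
  have e0 : g i 0 = h i 0 := by linarith
  rw [e0] at k1 k2 k3
  have e1 : g i 1 = h i 1 := by
    apply mul_right_cancel₀ hs1.ne'; linarith
  have e2 : g i 2 = h i 2 := by
    apply mul_right_cancel₀ hs1.ne'; linarith
  have e3 : g i 3 = h i 3 := by
    apply mul_right_cancel₀ hs1.ne'; linarith
  fin_cases j <;> assumption

/-- Hyperbolic balls of small radius about points near `x₀` lie in a given neighbourhood
of `x₀`. -/
lemma exists_mink_ball {x₀ : Fin 4 → ℝ} {W : Set (Fin 4 → ℝ)} (hW : W ∈ 𝓝 x₀) :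
    ∃ δ > 0, ∀ᶠ y in 𝓝 x₀, y ∈ H3 → ∀ z ∈ H3, mink y z < 1 + δ → z ∈ W := by
  -- the component of `z` orthogonal to `y` has Lorentz norm `√((mink y z)² - 1)`
  have key : ∀ y ∈ H3, ∀ z ∈ H3, ∀ i,
      |z i - mink y z * y i| ≤ y 0 * √(mink y z ^ 2 - 1) := by
    intro y hy z hz i
    set b := mink y z with hb
    have hb1 : 1 ≤ b := one_le_mink hy hz
    have hy' := hy.2
    have hy0 := hy.1
    set v : Fin 4 → ℝ := fun i => z i - b * y i with hv
    have o1 : v 0 * y 0 = v 1 * y 1 + v 2 * y 2 + v 3 * y 3 := by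
      simp only [hv]
      have : mink y z = b := rfl
      simp only [mink] at this
      linear_combination this - b * hy'
    have o2 : v 1 ^ 2 + v 2 ^ 2 + v 3 ^ 2 - v 0 ^ 2 = b ^ 2 - 1 := by
      simp only [hv]
      have : mink y z = b := rfl
      simp only [mink] at this
      linear_combination 2 * b * this - hz.2 - b ^ 2 * hy'
    have o3 : (v 0 * y 0) ^ 2 ≤ (v 1 ^ 2 + v 2 ^ 2 + v 3 ^ 2) * (y 0 ^ 2 - 1) := by
      have : y 0 ^ 2 - 1 = y 1 ^ 2 + y 2 ^ 2 + y 3 ^ 2 := by linarith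
      rw [o1, this]
      nlinarith [sq_nonneg (v 1 * y 2 - v 2 * y 1), sq_nonneg (v 1 * y 3 - v 3 * y 1),
        sq_nonneg (v 2 * y 3 - v 3 * y 2)]
    have o4 : v 1 ^ 2 + v 2 ^ 2 + v 3 ^ 2 ≤ y 0 ^ 2 * (b ^ 2 - 1) := by nlinarith
    have hb0 : 0 ≤ b ^ 2 - 1 := by nlinarith
    have o5 : v i ^ 2 ≤ y 0 ^ 2 * (b ^ 2 - 1) := by
      fin_cases i <;> simp <;> nlinarith [sq_nonneg (v 1), sq_nonneg (v 2), sq_nonneg (v 3)]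
    have : y 0 * √(b ^ 2 - 1) = √(y 0 ^ 2 * (b ^ 2 - 1)) := by
      rw [sqrt_mul (by positivity), sqrt_sq hy0.le]
    rw [this]
    exact abs_le_sqrt o5
  obtain ⟨ε, hε, hball⟩ := Metric.mem_nhds_iff.mp hW
  have hev : ∀ᶠ p : (Fin 4 → ℝ) × ℝ in 𝓝 x₀ ×ˢ 𝓝 1, ∀ i,
      p.1 0 * √(p.2 ^ 2 - 1) + |p.2 * p.1 i - x₀ i| < ε := by
    rw [← nhds_prod_eq, eventually_all]
    intro i
    refine ContinuousAt.eventually_lt (by fun_prop) continuousAt_const ?_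
    simpa using hε
  obtain ⟨pa, hpa, pb, hpb, hp⟩ := eventually_prod_iff.mp hev
  obtain ⟨δ, hδ, hδb⟩ := Metric.eventually_nhds_iff.mp hpb
  refine ⟨δ, hδ, hpa.mono fun y hy hyH z hz hlt => hball ?_⟩
  have h1 := one_le_mink hyH hz
  have h2 := hp hy (hδb (y := mink y z) (by
    rw [Real.dist_eq, abs_of_nonneg (by linarith)]; linarith))
  rw [Metric.mem_ball, dist_pi_lt_iff hε]
  intro i
  rw [Real.dist_eq]
  calc |z i - x₀ i| = |(z i - mink y z * y i) + (mink y z * y i - x₀ i)| := by ring_nf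
    _ ≤ |z i - mink y z * y i| + |mink y z * y i - x₀ i| := abs_add_le _ _
    _ < ε := lt_of_le_of_lt (by gcongr; exact key y hyH z hz i) (h2 i)

lemma sq_add_sq_eq_of_eventually {g : Matrix (Fin 4) (Fin 4) ℝ} {R R' : ℝ} {w : ℝ × ℝ}
    (H : ∀ᶠ w' in 𝓝 w, g *ᵥ cylP (R, w') ∈ tubeSurface R') (w' : ℝ × ℝ) :
    (g *ᵥ cylP (R, w')) 2 ^ 2 + (g *ᵥ cylP (R, w')) 3 ^ 2 = sinh R' ^ 2 := by
  have an : AnalyticOnNhd ℝ (fun w' : ℝ × ℝ =>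
      (g *ᵥ cylP (R, w')) 2 ^ 2 + (g *ᵥ cylP (R, w')) 3 ^ 2) univ := by
    simp only [Matrix.mulVec, dotProduct, Fin.sum_univ_four, cylP, cyl, Matrix.cons_val]
    rw [← contDiff_omega_iff_analyticOnNhd]
    fun_prop
  have := an.eq_of_eventuallyEq (g := fun _ => sinh R' ^ 2) (fun _ _ => analyticAt_const)
    (z₀ := w) (H.mono fun w' h => h.2)
  exact congrFun this w'

/-- If the function `y₂² + y₃²` is constant on the image of a cylinder, then the lower left block
of the matrix vanishes: averaging over angles `θ`, `θ + π` and lengths `±ζ` isolates the terms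
which grow along the axis. -/
lemma lower_left_eq_zero {g : Matrix (Fin 4) (Fin 4) ℝ} {R c : ℝ}
    (key : ∀ w, (g *ᵥ cylP (R, w)) 2 ^ 2 + (g *ᵥ cylP (R, w)) 3 ^ 2 = c) :
    (g 2 0 = 0 ∧ g 2 1 = 0) ∧ g 3 0 = 0 ∧ g 3 1 = 0 := by
  have hs1 : 0 < sinh (1 : ℝ) := sinh_pos_iff.mpr one_pos
  have hc : 0 < cosh R := cosh_pos R
  have k1 := key (0, 0)
  have k2 := key (π, 0)
  have k3 := key (0, 1)
  have k4 := key (0, -1)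
  have k5 := key (π, 1)
  have k6 := key (π, -1)
  simp only [Matrix.mulVec, dotProduct, Fin.sum_univ_four, cylP, cyl, Matrix.cons_val, cosh_zero,
    sinh_zero, cos_zero, sin_zero, cos_pi, sin_pi, cosh_neg, sinh_neg] at k1 k2 k3 k4 k5 k6
  have hsum : (cosh R * sinh 1) ^ 2 * ((g 2 0 ^ 2 + g 2 1 ^ 2) + (g 3 0 ^ 2 + g 3 1 ^ 2)) = 0 := by
    have hcs := cosh_sq (1 : ℝ)
    linear_combination (k3 + k4 + k5 + k6 - 2 * k1 - 2 * k2) / 4 -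
      cosh R ^ 2 * (g 2 0 ^ 2 + g 3 0 ^ 2) * hcs
  have hz := (mul_eq_zero.mp hsum).resolve_left (by positivity)
  rw [add_eq_zero_iff_of_nonneg (by positivity) (by positivity),
    add_eq_zero_iff_of_nonneg (by positivity) (by positivity),
    add_eq_zero_iff_of_nonneg (by positivity) (by positivity)] at hz
  simpa using hz

/-- The matrices which preserve the axis of the standard tube. -/
def PreservesAxis (g : Matrix (Fin 4) (Fin 4) ℝ) : Prop :=
  ((g 2 0 = 0 ∧ g 2 1 = 0) ∧ g 3 0 = 0 ∧ g 3 1 = 0) ∧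
    (g 0 2 = 0 ∧ g 0 3 = 0) ∧ g 1 2 = 0 ∧ g 1 3 = 0

lemma IsIsom.preservesAxis {g : Matrix (Fin 4) (Fin 4) ℝ} (hg : IsIsom g)
    (h : (g 2 0 = 0 ∧ g 2 1 = 0) ∧ g 3 0 = 0 ∧ g 3 1 = 0) : PreservesAxis g := by
  refine ⟨h, ?_⟩
  obtain ⟨⟨z20, z21⟩, z30, z31⟩ := h
  have r22 := hg.rows 2 2
  have r33 := hg.rows 3 3
  have r23 := hg.rows 2 3
  have r02 := hg.rows 0 2
  have r03 := hg.rows 0 3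
  have r12 := hg.rows 1 2
  have r13 := hg.rows 1 3
  simp [lorentz, z20, z21, z30, z31] at r22 r33 r23 r02 r03 r12 r13
  have hdet : (g 2 2 * g 3 3 - g 2 3 * g 3 2) ^ 2 = 1 := by
    linear_combination (g 3 2 * g 3 2 + g 3 3 * g 3 3) * r22 + r33
      - (g 2 2 * g 3 2 + g 2 3 * g 3 3) * r23
  have hd : g 2 2 * g 3 3 - g 2 3 * g 3 2 ≠ 0 := by
    intro h; rw [h] at hdet; norm_num at hdet
  have solve : ∀ a b : ℝ, a * g 2 2 + b * g 2 3 = 0 → a * g 3 2 + b * g 3 3 = 0 →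
      a = 0 ∧ b = 0 := by
    intro a b h1 h2
    constructor
    · apply (mul_eq_zero.mp _).resolve_right hd
      linear_combination g 3 3 * h1 - g 2 3 * h2
    · apply (mul_eq_zero.mp _).resolve_right hd
      linear_combination g 2 2 * h2 - g 3 2 * h1
  exact ⟨solve _ _ r02 r03, solve _ _ r12 r13⟩

lemma IsIsom.sq_add_sq_mulVec {g : Matrix (Fin 4) (Fin 4) ℝ} (hg : IsIsom g)
    (h : PreservesAxis g) (x : Fin 4 → ℝ) :
    (g *ᵥ x) 2 ^ 2 + (g *ᵥ x) 3 ^ 2 = x 2 ^ 2 + x 3 ^ 2 := by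
  have h1 := hg.mink_mulVec ![0, 0, x 2, x 3] ![0, 0, x 2, x 3]
  obtain ⟨⟨⟨z20, z21⟩, z30, z31⟩, ⟨z02, z03⟩, z12, z13⟩ := h
  simp [mink, Matrix.mulVec, dotProduct, Fin.sum_univ_four, z02, z03, z12, z13] at h1
  simp only [Matrix.mulVec, dotProduct, Fin.sum_univ_four, z20, z21, z30, z31]
  linear_combination -h1

/-- An isometry that maps an open piece of a cylinder about the axis into a cylinder about the
axis preserves the axis, and the two cylinders have the same radius. -/
lemma preservesAxis_of_eventually {g : Matrix (Fin 4) (Fin 4) ℝ} (hg : IsIsom g) {R R' : ℝ}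
    (hR : 0 < R) (hR' : 0 < R') {w : ℝ × ℝ}
    (H : ∀ᶠ w' in 𝓝 w, g *ᵥ cylP (R, w') ∈ tubeSurface R') : R = R' ∧ PreservesAxis g := by
  have key := sq_add_sq_eq_of_eventually H
  have hp := hg.preservesAxis (lower_left_eq_zero key)
  refine ⟨?_, hp⟩
  have k := key (0, 0)
  rw [hg.sq_add_sq_mulVec hp] at k
  simp [cylP, cyl] at k
  have hs : 0 < sinh R := sinh_pos_iff.mpr hR
  have hs' : 0 < sinh R' := sinh_pos_iff.mpr hR'
  exact sinh_injective ((pow_left_inj₀ hs.le hs'.le two_ne_zero).mp k)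

lemma PreservesAxis.radial_mulVec {g : Matrix (Fin 4) (Fin 4) ℝ} (h : PreservesAxis g)
    (R ρ : ℝ) (x : Fin 4 → ℝ) : radial R ρ (g *ᵥ x) = g *ᵥ radial R ρ x := by
  obtain ⟨⟨⟨z20, z21⟩, z30, z31⟩, ⟨z02, z03⟩, z12, z13⟩ := h
  ext i
  fin_cases i <;>
    simp [radial, Matrix.mulVec, dotProduct, Fin.sum_univ_four, z20, z21, z30, z31, z02, z03, z12,
      z13] <;> ring

lemma radial_self {R : ℝ} (hR : 0 < R) (x : Fin 4 → ℝ) : radial R R x = x := by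
  have h1 := (cosh_pos R).ne'
  have h2 := (sinh_pos_iff.mpr hR).ne'
  ext i
  fin_cases i <;> simp [radial, h1, h2]

lemma radial_cylP {R : ℝ} (hR : 0 < R) (ρ : ℝ) (w : ℝ × ℝ) :
    radial R ρ (cylP (R, w)) = cylP (ρ, w) := by
  have h1 := (cosh_pos R).ne'
  have h2 := (sinh_pos_iff.mpr hR).ne'
  ext i
  fin_cases i <;> simp [radial, cylP, cyl] <;> field_simp

/-! ### Hyperbolic atlases and developed maps -/

/-- A chart of a hyperbolic structure without boundary: a homeomorphism `f`, with inverse `e`,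
from an open set onto a relatively open subset of `H3`. -/
structure HypChart (N : Type*) [TopologicalSpace N] where
  source : Set N
  target : Set (Fin 4 → ℝ)
  f : N → Fin 4 → ℝ
  e : (Fin 4 → ℝ) → N
  isOpen_source : IsOpen source
  isOpen_target : ∃ W, IsOpen W ∧ target = W ∩ H3
  f_mem : ∀ p ∈ source, f p ∈ target
  e_mem : ∀ y ∈ target, e y ∈ source
  continuousOn_f : ContinuousOn f source
  continuousOn_e : ContinuousOn e target
  e_f : ∀ p ∈ source, e (f p) = p
  f_e : ∀ y ∈ target, f (e y) = y

/-- An atlas of hyperbolic charts whose transition maps are locally isometries. -/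
structure HypAtlas (N : Type*) [TopologicalSpace N] where
  charts : Set (HypChart N)
  cover : ∀ p : N, ∃ c ∈ charts, p ∈ c.source
  compat : ∀ c ∈ charts, ∀ d ∈ charts, ∀ p ∈ c.source ∩ d.source,
    ∃ g, IsIsom g ∧ ∀ᶠ q in 𝓝 p, d.f q = g *ᵥ c.f q

variable {N : Type*} [TopologicalSpace N]

namespace HypChart

lemma target_subset (c : HypChart N) : c.target ⊆ H3 := by
  obtain ⟨W, -, h⟩ := c.isOpen_target
  rw [h]; exact inter_subset_right

lemma target_mem (c : HypChart N) {y : Fin 4 → ℝ} (hy : y ∈ c.target) :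
    ∀ᶠ x in 𝓝 y, x ∈ H3 → x ∈ c.target := by
  obtain ⟨W, hW, h⟩ := c.isOpen_target
  rw [h] at hy ⊢
  filter_upwards [hW.mem_nhds hy.1] with x hx hH using ⟨hx, hH⟩

lemma f_injOn (c : HypChart N) {p q : N} (hp : p ∈ c.source) (hq : q ∈ c.source)
    (h : c.f p = c.f q) : p = q := by
  rw [← c.e_f p hp, h, c.e_f q hq]

lemma continuousAt_f (c : HypChart N) {p : N} (hp : p ∈ c.source) : ContinuousAt c.f p :=
  c.continuousOn_f.continuousAt (c.isOpen_source.mem_nhds hp)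

end HypChart

namespace HypAtlas

variable (𝒜 : HypAtlas N)

/-- The map `A` is near `z` a local isometry, where its domain carries the hyperbolic metric in
cylindrical coordinates. -/
def LocIso (A : ℝ × ℝ × ℝ → N) (z : ℝ × ℝ × ℝ) : Prop :=
  ∃ c ∈ 𝒜.charts, ∃ g, IsIsom g ∧ ∀ᶠ z' in 𝓝 z, A z' ∈ c.source ∧ c.f (A z') = g *ᵥ cylP z'

variable {𝒜} {A B : ℝ × ℝ × ℝ → N} {z : ℝ × ℝ × ℝ}

lemma LocIso.congr (hA : 𝒜.LocIso A z) (h : A =ᶠ[𝓝 z] B) : 𝒜.LocIso B z := by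
  obtain ⟨c, hc, g, hg, H⟩ := hA
  exact ⟨c, hc, g, hg, by filter_upwards [H, h] with z' h1 h2; rwa [← h2]⟩

lemma LocIso.continuousAt (hA : 𝒜.LocIso A z) : ContinuousAt A z := by
  obtain ⟨c, hc, g, hg, H⟩ := hA
  obtain ⟨h1, h2⟩ := H.self_of_nhds
  have h3 : ContinuousWithinAt c.e c.target (g *ᵥ cylP z) :=
    c.continuousOn_e _ (h2 ▸ c.f_mem _ h1)
  have h4 : Tendsto (fun z' => g *ᵥ cylP z') (𝓝 z) (𝓝[c.target] (g *ᵥ cylP z)) := by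
    refine tendsto_nhdsWithin_iff.mpr
      ⟨((continuous_mulVec g).comp continuous_cylP).continuousAt, ?_⟩
    filter_upwards [H] with z' h
    rw [← h.2]; exact c.f_mem _ h.1
  have h5 := h3.tendsto.comp h4
  have h6 : c.e (g *ᵥ cylP z) = A z := by rw [← h2, c.e_f _ h1]
  rw [h6] at h5
  refine h5.congr' ?_
  filter_upwards [H] with z' h
  rw [Function.comp, ← h.2, c.e_f _ h.1]

lemma LocIso.in_chart (hA : 𝒜.LocIso A z) {d : HypChart N} (hd : d ∈ 𝒜.charts)
    (hz : A z ∈ d.source) :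
    ∃ g, IsIsom g ∧ ∀ᶠ z' in 𝓝 z, A z' ∈ d.source ∧ d.f (A z') = g *ᵥ cylP z' := by
  have hcont := hA.continuousAt
  obtain ⟨c, hc, g, hg, H⟩ := hA
  obtain ⟨k, hk, K⟩ := 𝒜.compat c hc d hd (A z) ⟨H.self_of_nhds.1, hz⟩
  refine ⟨k * g, hk.mul hg, ?_⟩
  filter_upwards [H, hcont.eventually K, hcont.eventually (d.isOpen_source.mem_nhds hz)]
    with z' h1 h2 h3
  exact ⟨h3, by rw [h2, h1.2, Matrix.mulVec_mulVec]⟩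

lemma LocIso.comp {τ : ℝ × ℝ × ℝ → ℝ × ℝ × ℝ} {h : Matrix (Fin 4) (Fin 4) ℝ}
    (hA : 𝒜.LocIso A (τ z)) (hτ : ContinuousAt τ z) (hh : IsIsom h)
    (H : ∀ᶠ z' in 𝓝 z, cylP (τ z') = h *ᵥ cylP z') : 𝒜.LocIso (A ∘ τ) z := by
  obtain ⟨c, hc, g, hg, K⟩ := hA
  refine ⟨c, hc, g * h, hg.mul hh, ?_⟩
  filter_upwards [H, hτ.eventually K] with z' h1 h2
  exact ⟨h2.1, by rw [Function.comp, h2.2, h1, Matrix.mulVec_mulVec]⟩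

lemma LocIso.screw (w : ℝ × ℝ) (hA : 𝒜.LocIso A (z.1, w + z.2)) :
    𝒜.LocIso (fun z' => A (z'.1, w + z'.2)) z :=
  LocIso.comp (τ := fun z' : ℝ × ℝ × ℝ => (z'.1, w + z'.2)) hA (by fun_prop) (screw_isIsom w)
    (Eventually.of_forall fun z' => (screw_cylP w z').symm)

/-- The inverse of a chart composed with an isometry is a local isometry. -/
lemma locIso_chart {c : HypChart N} (hc : c ∈ 𝒜.charts) {g : Matrix (Fin 4) (Fin 4) ℝ}
    (hg : IsIsom g) (hz : g *ᵥ cylP z ∈ c.target) :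
    𝒜.LocIso (fun z' => c.e (g *ᵥ cylP z')) z := by
  refine ⟨c, hc, g, hg, ?_⟩
  have h1 : ContinuousAt (fun z' => g *ᵥ cylP z') z :=
    ((continuous_mulVec g).comp continuous_cylP).continuousAt
  filter_upwards [h1.eventually (c.target_mem hz)] with z' h
  have := h (hg.mulVec_mem (cylP_mem z'))
  exact ⟨c.e_mem _ this, c.f_e _ this⟩

/-- Two local isometries which agree near a point of a connected set agree near the whole set. -/
lemma eventuallyEq_of_isPreconnected [T2Space N] {S : Set (ℝ × ℝ × ℝ)} (hS : IsPreconnected S)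
    (hA : ∀ z ∈ S, 𝒜.LocIso A z) (hB : ∀ z ∈ S, 𝒜.LocIso B z) {z₀ : ℝ × ℝ × ℝ} (hz₀ : z₀ ∈ S)
    (h₀ : A =ᶠ[𝓝 z₀] B) : ∀ z ∈ S, A =ᶠ[𝓝 z] B := by
  set O : Set (ℝ × ℝ × ℝ) := {z | A =ᶠ[𝓝 z] B} with hO
  have hOo : IsOpen O := by
    rw [isOpen_iff_mem_nhds]
    intro z hz
    exact Filter.Eventually.eventually_nhds hz
  refine hS.subset_of_closure_inter_subset hOo ⟨z₀, hz₀, h₀⟩ ?_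
  rintro z ⟨hcl, hzS⟩
  have hfreq : ∃ᶠ z' in 𝓝 z, z' ∈ O := mem_closure_iff_frequently.mp hcl
  have cA := (hA z hzS).continuousAt
  have cB := (hB z hzS).continuousAt
  have hAB : A z = B z := by
    by_contra hne
    have : ∀ᶠ z' in 𝓝 z, A z' ≠ B z' :=
      (cA.prodMk cB).eventually (isClosed_diagonal.isOpen_compl.mem_nhds hne)
    obtain ⟨z', h1, h2⟩ := (hfreq.and_eventually this).exists
    exact h2 h1.self_of_nhds
  -- in a chart about the limit point both maps are given by matrices, which coincide
  obtain ⟨c, hc, g, hg, H⟩ := hA z hzS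
  obtain ⟨k, hk, K⟩ := (hB z hzS).in_chart hc (hAB ▸ H.self_of_nhds.1)
  obtain ⟨z', h1, h2, h3⟩ :=
    (hfreq.and_eventually (H.eventually_nhds.and K.eventually_nhds)).exists
  have hgk : g = k := by
    refine matrix_eq_of_eventually (z := z') ?_
    filter_upwards [h1, h2, h3] with y e1 e2 e3
    rw [← e2.2, ← e3.2, e1]
  show ∀ᶠ y in 𝓝 z, A y = B y
  filter_upwards [H, K] with y e1 e2
  exact c.f_injOn e1.1 e2.1 (by rw [e1.2, e2.2, hgk])

lemma LocIso.eventually_injective (hA : 𝒜.LocIso A z) (hz : 0 < z.1) :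
    ∃ V ∈ 𝓝 z, InjOn A V := by
  obtain ⟨c, hc, g, hg, H⟩ := hA
  refine ⟨_, inter_mem H (secAt_cylP hz), ?_⟩
  rintro x ⟨hx1, hx2⟩ y ⟨hy1, hy2⟩ hxy
  rw [mem_ofPred_eq] at hx1 hx2 hy1 hy2
  have : g *ᵥ cylP x = g *ᵥ cylP y := by rw [← hx1.2, ← hy1.2, hxy]
  rw [← hx2, ← hy2, hg.injective this]

/-- Local isometries are open maps. -/
lemma LocIso.image_mem_nhds (hA : 𝒜.LocIso A z) (hz : 0 < z.1) {V : Set (ℝ × ℝ × ℝ)}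
    (hV : V ∈ 𝓝 z) : A '' V ∈ 𝓝 (A z) := by
  obtain ⟨c, hc, g, hg, H⟩ := hA
  obtain ⟨h1, h2⟩ := H.self_of_nhds
  set y : N → Fin 4 → ℝ := fun p => isomInv g *ᵥ c.f p with hy
  have hyz : y (A z) = cylP z := by rw [hy]; simp only; rw [h2, hg.inv_mulVec]
  have cy : ContinuousAt y (A z) :=
    (continuous_mulVec _).continuousAt.comp (c.continuousAt_f h1)
  have hcy : Tendsto y (𝓝 (A z)) (𝓝 (cylP z)) := hyz ▸ cy.tendsto
  have cs : Tendsto (fun p => secAt z.2 (y p)) (𝓝 (A z)) (𝓝 z) := by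
    have := (continuousAt_secAt hz).tendsto.comp hcy
    rwa [secAt_self hz] at this
  filter_upwards [cs.eventually hV, cs.eventually H, hcy.eventually (cylP_secAt hz),
    c.isOpen_source.mem_nhds h1] with p k1 k2 k3 k4
  have hp : y p ∈ H3 := hg.inv.mulVec_mem (c.target_subset (c.f_mem p k4))
  refine ⟨_, k1, c.f_injOn k2.1 k4 ?_⟩
  rw [k2.2, k3 hp, hy]
  exact hg.mulVec_inv _

/-- Two local isometries with the same value at two points differ near these points by an
isometry of `H3`. -/
lemma LocIso.exists_isom {z₁ z₂ : ℝ × ℝ × ℝ} (hA : 𝒜.LocIso A z₁) (hB : 𝒜.LocIso B z₂)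
    (h : A z₁ = B z₂) : ∃ k, IsIsom k ∧ cylP z₁ = k *ᵥ cylP z₂ ∧
      ∃ V₁ ∈ 𝓝 z₁, ∃ V₂ ∈ 𝓝 z₂, ∀ x ∈ V₁, ∀ y ∈ V₂, A x = B y ↔ cylP x = k *ᵥ cylP y := by
  obtain ⟨c, hc, g, hg, H⟩ := hA
  obtain ⟨k, hk, K⟩ := hB.in_chart hc (h ▸ H.self_of_nhds.1)
  have key : ∀ x y, A x ∈ c.source ∧ c.f (A x) = g *ᵥ cylP x →
      B y ∈ c.source ∧ c.f (B y) = k *ᵥ cylP y →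
      (A x = B y ↔ cylP x = (isomInv g * k) *ᵥ cylP y) := by
    intro x y h1 h2
    rw [← Matrix.mulVec_mulVec, ← h2.2]
    constructor
    · intro h; rw [← h, h1.2, hg.inv_mulVec]
    · intro h; exact c.f_injOn h1.1 h2.1 (by rw [h1.2, h, hg.mulVec_inv])
  refine ⟨isomInv g * k, hg.inv.mul hk, (key _ _ H.self_of_nhds K.self_of_nhds).mp h,
    _, H, _, K, fun x hx y hy => key x y hx hy⟩

end HypAtlas

/-! ### Continuation along the rays normal to a tube -/

namespace HypAtlas

variable (𝒜 : HypAtlas N) (A₀ : ℝ × ℝ × ℝ → N)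

/-- `A` is a local isometry on `(0, T) × U` which agrees with `A₀` near the core. -/
def IsRayExt (T : ℝ) (U : Set (ℝ × ℝ)) (A : ℝ × ℝ × ℝ → N) : Prop :=
  ∀ w ∈ U, (∀ s ∈ Ioo 0 T, 𝒜.LocIso A (s, w)) ∧ ∃ ε > 0, ∀ᶠ w' in 𝓝 w, ∀ s ∈ Ioo 0 ε,
    A (s, w') = A₀ (s, w')

/-- The points `(s, w)` such that `A₀` can be continued along the rays near `w` beyond the
distance `s` from the core. -/
def devDom : Set (ℝ × ℝ × ℝ) :=
  {z | 0 < z.1 ∧ ∃ T U A, z.1 < T ∧ IsOpen U ∧ z.2 ∈ U ∧ 𝒜.IsRayExt A₀ T U A}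

open Classical in
/-- The continuation of `A₀` along the rays normal to the core. -/
def dev (z : ℝ × ℝ × ℝ) : N :=
  if h : ∃ A T U, z.1 < T ∧ IsOpen U ∧ z.2 ∈ U ∧ 𝒜.IsRayExt A₀ T U A then h.choose z else A₀ z

variable {𝒜 A₀} {T T' : ℝ} {U U' : Set (ℝ × ℝ)} {A A' : ℝ × ℝ × ℝ → N} {w : ℝ × ℝ} {s : ℝ}

lemma IsRayExt.eventuallyEq [T2Space N] (h : 𝒜.IsRayExt A₀ T U A) (h' : 𝒜.IsRayExt A₀ T' U' A')
    (hw : w ∈ U) (hw' : w ∈ U') (hs : 0 < s) (hT : s < T) (hT' : s < T') :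
    A =ᶠ[𝓝 (s, w)] A' := by
  obtain ⟨h1, ε, hε, h2⟩ := h w hw
  obtain ⟨h1', ε', hε', h2'⟩ := h' w hw'
  have hm : 0 < min (min ε ε') s := by positivity
  have hlt1 : min (min ε ε') s ≤ ε := (min_le_left _ _).trans (min_le_left _ _)
  have hlt2 : min (min ε ε') s ≤ ε' := (min_le_left _ _).trans (min_le_right _ _)
  have hlt3 : min (min ε ε') s ≤ s := min_le_right _ _
  set m := min (min ε ε') s
  refine eventuallyEq_of_isPreconnected (𝒜 := 𝒜) (S := Ioc 0 s ×ˢ {w})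
    (isPreconnected_Ioc.prod isPreconnected_singleton) ?_ ?_ (z₀ := (m / 2, w)) ?_ ?_ _ ?_
  · rintro ⟨t, v⟩ ⟨⟨ht0, hts⟩, rfl⟩
    exact h1 t ⟨ht0, by simp at hts ⊢; linarith⟩
  · rintro ⟨t, v⟩ ⟨⟨ht0, hts⟩, rfl⟩
    exact h1' t ⟨ht0, by simp at hts ⊢; linarith⟩
  · exact ⟨⟨by simp; linarith, by simp; linarith⟩, rfl⟩
  · have hI : Ioo 0 m ∈ 𝓝 (m / 2) := Ioo_mem_nhds (by linarith) (by linarith)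
    filter_upwards [prod_mem_nhds hI (h2.and h2')] with z hz
    obtain ⟨⟨hz1, hz2⟩, hz3, hz4⟩ := hz
    exact (hz3 z.1 ⟨hz1, by linarith⟩).trans (hz4 z.1 ⟨hz1, by linarith⟩).symm
  · exact ⟨⟨hs, le_rfl⟩, rfl⟩

lemma IsRayExt.dev_eq [T2Space N] (h : 𝒜.IsRayExt A₀ T U A) (hU : IsOpen U) (hw : w ∈ U)
    (hs : 0 < s) (hT : s < T) : 𝒜.dev A₀ =ᶠ[𝓝 (s, w)] A := by
  filter_upwards [prod_mem_nhds (Ioo_mem_nhds hs hT) (hU.mem_nhds hw)] with z hz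
  have hex : ∃ A T U, z.1 < T ∧ IsOpen U ∧ z.2 ∈ U ∧ 𝒜.IsRayExt A₀ T U A :=
    ⟨A, T, U, hz.1.2, hU, hz.2, h⟩
  rw [dev, dif_pos hex]
  obtain ⟨T', U', h1, -, h3, h4⟩ := hex.choose_spec
  exact (h4.eventuallyEq h h3 hz.2 hz.1.1 h1 hz.1.2).self_of_nhds

lemma dev_locIso [T2Space N] {z : ℝ × ℝ × ℝ} (hz : z ∈ 𝒜.devDom A₀) :
    𝒜.LocIso (𝒜.dev A₀) z := by
  obtain ⟨h0, T, U, A, h1, h2, h3, h4⟩ := hz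
  exact ((h4 z.2 h3).1 z.1 ⟨h0, h1⟩).congr (h4.dev_eq h2 h3 h0 h1).symm

lemma devDom_of_le (h : (s, w) ∈ 𝒜.devDom A₀) {t : ℝ} (ht : 0 < t) (hts : t ≤ s) :
    (t, w) ∈ 𝒜.devDom A₀ := by
  obtain ⟨h0, T, U, A, h1, h2, h3, h4⟩ := h
  exact ⟨ht, T, U, A, hts.trans_lt h1, h2, h3, h4⟩

lemma exists_gt_mem_devDom (h : (s, w) ∈ 𝒜.devDom A₀) : ∃ t > s, (t, w) ∈ 𝒜.devDom A₀ := by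
  obtain ⟨h0, T, U, A, h1, h2, h3, h4⟩ := h
  simp only at h0 h1
  exact ⟨(s + T) / 2, by linarith, by simp only; linarith, T, U, A, by simp only; linarith,
    h2, h3, h4⟩

/-- The continuation along a ray exists beyond the distance `T` if it exists up to `T` and has
there a limit point: a chart about the limit point contains a ball of definite radius about a
point of the ray close to it, and so the continuation of the ray. -/
lemma mem_devDom_of_clusterPt [T2Space N] (hT : 0 < T)
    (h : ∀ s ∈ Ioo 0 T, (s, w) ∈ 𝒜.devDom A₀) {x : N}
    (hx : MapClusterPt x (𝓝[<] T) fun s => 𝒜.dev A₀ (s, w)) : (T, w) ∈ 𝒜.devDom A₀ := by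
  obtain ⟨c, hc, hxc⟩ := 𝒜.cover x
  obtain ⟨W, hWo, hW⟩ := c.isOpen_target
  have hfx : c.f x ∈ W := (hW ▸ c.f_mem x hxc).1
  obtain ⟨δ, hδ, hball⟩ := exists_mink_ball (hWo.mem_nhds hfx)
  have hcosh : ∀ᶠ s in 𝓝[<] T, cosh (T - s) < 1 + δ := by
    refine nhdsWithin_le_nhds (ContinuousAt.eventually_lt (by fun_prop) continuousAt_const ?_)
    simpa using hδ
  have hpos : ∀ᶠ s in 𝓝[<] T, s ∈ Ioo 0 T := Ioo_mem_nhdsLT hT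
  have hsrc : ∀ᶠ p in 𝓝 x, p ∈ c.source := c.isOpen_source.mem_nhds hxc
  obtain ⟨s₁, ⟨hs1, hs2⟩, hs3, hs4⟩ :=
    ((hx.frequently (hsrc.and ((c.continuousAt_f hxc).eventually hball))).and_eventually
      (hcosh.and hpos)).exists
  obtain ⟨g, hg, H⟩ := (dev_locIso (h s₁ hs4)).in_chart hc hs1
  -- the remaining segment of the developed ray lies in the chart, and so do neighbouring rays
  have hseg : ∀ s ∈ Icc s₁ T, g *ᵥ cylP (s, w) ∈ W := by
    intro s hs
    refine hs2 (c.target_subset (c.f_mem _ hs1)) _ (hg.mulVec_mem (cylP_mem _)) ?_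
    rw [H.self_of_nhds.2, hg.mink_mulVec, mink_cylP]
    simp only [sub_self, cosh_zero, cos_zero, mul_one, ← cosh_sub]
    refine lt_of_le_of_lt ?_ hs3
    rw [cosh_le_cosh, abs_le, abs_of_nonneg (by linarith [hs4.2])]
    constructor <;> linarith [hs.1, hs.2]
  have hO : IsOpen {z | g *ᵥ cylP z ∈ W} :=
    hWo.preimage ((continuous_mulVec g).comp continuous_cylP)
  obtain ⟨u, v, hu, hv, hsu, hwv, huv⟩ := generalized_tube_lemma (s := Icc s₁ T) isCompact_Icc
    (t := {w}) isCompact_singleton (n := {z | g *ᵥ cylP z ∈ W}) hO (by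
      rintro ⟨s, w'⟩ ⟨hs, rfl⟩
      exact hseg s hs)
  obtain ⟨T', hT', hTu⟩ : ∃ T' > T, Icc s₁ T' ⊆ u := by
    obtain ⟨b, hb, hbu⟩ := mem_nhdsGE_iff_exists_Icc_subset.mp
      (mem_nhdsWithin_of_mem_nhds (hu.mem_nhds (hsu ⟨hs4.2.le, le_rfl⟩)))
    refine ⟨b, hb, fun t ht => ?_⟩
    rcases le_total t T with h' | h'
    · exact hsu ⟨ht.1, h'⟩
    · exact hbu ⟨h', ht.2⟩
  obtain ⟨-, T₁, U₁, A₁, k1, k2, k3, k4⟩ := h s₁ hs4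
  obtain ⟨I, hI, V, hV, hIV⟩ := mem_nhds_prod_iff.mp H
  have agree : ∀ z : ℝ × ℝ × ℝ, 0 < z.1 → z.1 < T₁ → z.1 ∈ I → z.2 ∈ U₁ → z.2 ∈ V →
      A₁ z = c.e (g *ᵥ cylP z) := by
    intro z z1 z2 z3 z4 z5
    obtain ⟨m1, m2⟩ := hIV (show z ∈ I ×ˢ V from ⟨z3, z5⟩)
    rw [← (k4.dev_eq k2 z4 z1 z2).self_of_nhds, ← m2, c.e_f _ m1]
  -- from the distance `s₁` on, the continuation is given by the inverse of the chart
  refine ⟨hT, T', U₁ ∩ (interior V ∩ v),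
    fun z => if z.1 ≤ s₁ then A₁ z else c.e (g *ᵥ cylP z), hT',
    k2.inter (isOpen_interior.inter hv),
    ⟨k3, mem_interior_iff_mem_nhds.mpr hV, hwv rfl⟩, ?_⟩
  rintro w' ⟨hw1, hw2, hw3⟩
  refine ⟨?_, ?_⟩
  · rintro s ⟨hs0, hsT⟩
    rcases lt_trichotomy s s₁ with hlt | rfl | hgt
    · refine ((k4 w' hw1).1 s ⟨hs0, hlt.trans k1⟩).congr ?_
      have : ∀ᶠ z : ℝ × ℝ × ℝ in 𝓝 (s, w'), z.1 < s₁ :=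
        ContinuousAt.eventually_lt (by fun_prop) continuousAt_const hlt
      filter_upwards [this] with z hz
      rw [if_pos hz.le]
    · refine ((k4 w' hw1).1 s ⟨hs0, k1⟩).congr ?_
      have h1 : Ioo 0 T₁ ∩ I ∈ 𝓝 s := inter_mem (Ioo_mem_nhds hs0 k1) hI
      filter_upwards [prod_mem_nhds h1 ((k2.inter isOpen_interior).mem_nhds ⟨hw1, hw2⟩)] with z hz
      obtain ⟨⟨⟨z1, z2⟩, z3⟩, z4, z5⟩ := hz
      split_ifs
      · rfl
      · exact agree z z1 z2 z3 z4 (interior_subset z5)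
    · have htar : g *ᵥ cylP (s, w') ∈ c.target := by
        rw [hW]
        exact ⟨huv (show (s, w') ∈ u ×ˢ v from ⟨hTu ⟨hgt.le, hsT.le⟩, hw3⟩),
          hg.mulVec_mem (cylP_mem _)⟩
      refine (locIso_chart hc hg htar).congr ?_
      have : ∀ᶠ z : ℝ × ℝ × ℝ in 𝓝 (s, w'), s₁ < z.1 :=
        ContinuousAt.eventually_lt continuousAt_const (by fun_prop) hgt
      filter_upwards [this] with z hz
      rw [if_neg hz.not_ge]
  · obtain ⟨-, ε, hε, k5⟩ := k4 w' hw1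
    refine ⟨min ε s₁, lt_min hε hs4.1, k5.mono fun w'' k6 s hs => ?_⟩
    have hle : s ≤ s₁ := (hs.2.trans_le (min_le_right _ _)).le
    simp only [if_pos hle]
    exact k6 s ⟨hs.1, hs.2.trans_le (min_le_left _ _)⟩

end HypAtlas

/-! ### Distance from the axis and normal projection to a tube exterior -/

/-- The distance from the axis. -/
def axisDist (x : Fin 4 → ℝ) : ℝ := arsinh √(x 2 ^ 2 + x 3 ^ 2)

/-- The normal projection to the exterior of the tube of radius `R`. -/
def extProj (R : ℝ) (x : Fin 4 → ℝ) : Fin 4 → ℝ := radial (axisDist x) (max (axisDist x) R) x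

lemma cylP_two_sq_add (z : ℝ × ℝ × ℝ) : cylP z 2 ^ 2 + cylP z 3 ^ 2 = sinh z.1 ^ 2 := by
  simp only [cylP, cyl, Matrix.cons_val]
  linear_combination sinh z.1 ^ 2 * sin_sq_add_cos_sq z.2.1

lemma axisDist_cylP {ρ : ℝ} (hρ : 0 ≤ ρ) (w : ℝ × ℝ) : axisDist (cylP (ρ, w)) = ρ := by
  rw [axisDist, cylP_two_sq_add, sqrt_sq (sinh_nonneg_iff.mpr hρ), arsinh_sinh]

lemma extProj_cylP {ρ : ℝ} (hρ : 0 < ρ) (R : ℝ) (w : ℝ × ℝ) :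
    extProj R (cylP (ρ, w)) = cylP (max ρ R, w) := by
  rw [extProj, axisDist_cylP hρ.le, radial_cylP hρ]

lemma exists_cylP {x : Fin 4 → ℝ} (hx : x ∈ H3) (h : 0 < x 2 ^ 2 + x 3 ^ 2) :
    ∃ ρ > 0, ∃ w, x = cylP (ρ, w) := by
  -- rotate `x` into the half-space where `sec` is defined
  have hn : ‖(⟨x 2, x 3⟩ : ℂ)‖ = √(x 2 ^ 2 + x 3 ^ 2) := by
    rw [Complex.norm_def, Complex.normSq_apply]; ring_nf
  have hpos : 0 < √(x 2 ^ 2 + x 3 ^ 2) := sqrt_pos.mpr h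
  have hne : (⟨x 2, x 3⟩ : ℂ) ≠ 0 := by rw [← norm_pos_iff, hn]; exact hpos
  set θ := Complex.arg ⟨x 2, x 3⟩
  have hc : cos θ = x 2 / √(x 2 ^ 2 + x 3 ^ 2) := by rw [Complex.cos_arg hne, hn]
  have hs : sin θ = x 3 / √(x 2 ^ 2 + x 3 ^ 2) := by rw [Complex.sin_arg, hn]
  have h2 : 0 < (screw (-(θ, (0 : ℝ))) *ᵥ x) 2 := by
    rw [screw_mulVec]
    simp only [Prod.fst_neg, cos_neg, sin_neg, hc, hs, Matrix.cons_val]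
    have : x 2 / √(x 2 ^ 2 + x 3 ^ 2) * x 2 - -(x 3 / √(x 2 ^ 2 + x 3 ^ 2)) * x 3
      = (x 2 ^ 2 + x 3 ^ 2) / √(x 2 ^ 2 + x 3 ^ 2) := by ring
    rw [this]; positivity
  have h3 := cylP_sec ((screw_isIsom (-(θ, (0 : ℝ)))).mulVec_mem hx) h2
  refine ⟨_, sec_fst_pos h2, (θ, 0) + (sec (screw (-(θ, (0 : ℝ))) *ᵥ x)).2, ?_⟩
  rw [← screw_cylP, h3]
  simpa using (screw_neg_screw (-(θ, (0 : ℝ))) x).symm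

lemma cylP_mem_tubeExterior {ρ R : ℝ} (hR : 0 < R) (hρ : 0 < ρ) (w : ℝ × ℝ) :
    cylP (ρ, w) ∈ tubeExterior R ↔ R ≤ ρ := by
  have h1 := sinh_pos_iff.mpr hR
  have h2 := sinh_pos_iff.mpr hρ
  rw [tubeExterior, mem_ofPred_eq, cylP_two_sq_add, pow_le_pow_iff_left₀ h1.le h2.le two_ne_zero,
    sinh_le_sinh]
  exact and_iff_right (cylP_mem _)

lemma cylP_mem_tubeSurface {ρ R : ℝ} (hR : 0 < R) (hρ : 0 < ρ) (w : ℝ × ℝ) :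
    cylP (ρ, w) ∈ tubeSurface R ↔ ρ = R := by
  have h1 := sinh_pos_iff.mpr hR
  have h2 := sinh_pos_iff.mpr hρ
  rw [tubeSurface, mem_ofPred_eq, cylP_two_sq_add, pow_left_inj₀ h2.le h1.le two_ne_zero,
    sinh_inj]
  exact and_iff_right (cylP_mem _)

lemma exists_cylP_of_mem_tubeExterior {R : ℝ} (hR : 0 < R) {x : Fin 4 → ℝ}
    (hx : x ∈ tubeExterior R) : ∃ ρ, R ≤ ρ ∧ ∃ w, x = cylP (ρ, w) := by
  have h1 := sinh_pos_iff.mpr hR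
  obtain ⟨ρ, hρ, w, rfl⟩ := exists_cylP hx.1 (lt_of_lt_of_le (by positivity) hx.2)
  exact ⟨ρ, (cylP_mem_tubeExterior hR hρ w).mp hx, w, rfl⟩

lemma continuous_axisDist : Continuous axisDist := by
  exact continuous_arsinh.comp (by fun_prop)

lemma continuousOn_extProj (R : ℝ) :
    ContinuousOn (extProj R) {x | 0 < x 2 ^ 2 + x 3 ^ 2} := by
  refine continuousOn_pi.mpr fun i => ?_
  have h1 : ∀ x ∈ {x : Fin 4 → ℝ | 0 < x 2 ^ 2 + x 3 ^ 2}, sinh (axisDist x) ≠ 0 := by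
    intro x hx
    rw [axisDist, sinh_arsinh]
    exact (sqrt_pos.mpr hx).ne'
  have h2 : ∀ x ∈ {x : Fin 4 → ℝ | 0 < x 2 ^ 2 + x 3 ^ 2}, cosh (axisDist x) ≠ 0 :=
    fun x _ => (cosh_pos _).ne'
  have h3 : ContinuousOn axisDist {x | 0 < x 2 ^ 2 + x 3 ^ 2} := continuous_axisDist.continuousOn
  fin_cases i <;> simp only [extProj, radial, Fin.zero_eta, Fin.mk_one, Fin.reduceFinMk,
    Matrix.cons_val] <;> fun_prop (disch := assumption)

lemma continuous_radial {α : Type*} [TopologicalSpace α] {R : ℝ} {a : α → ℝ}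
    {x : α → Fin 4 → ℝ} {S : Set α} (ha : ContinuousOn a S) (hx : ContinuousOn x S) :
    ContinuousOn (fun t => radial R (a t) (x t)) S := by
  refine continuousOn_pi.mpr fun i => ?_
  have hx' : ∀ i, ContinuousOn (fun t => x t i) S := fun i => by fun_prop
  fin_cases i <;> simp only [radial, Fin.zero_eta, Fin.mk_one, Fin.reduceFinMk,
    Matrix.cons_val, div_eq_mul_inv] <;> fun_prop

lemma PreservesAxis.of_mul {g h : Matrix (Fin 4) (Fin 4) ℝ} (hh : IsIsom h)
    (h1 : PreservesAxis (g * h)) (h2 : PreservesAxis h) : PreservesAxis g := by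
  have e : g = (g * h) * isomInv h := by rw [Matrix.mul_assoc, hh.mul_inv, Matrix.mul_one]
  rw [e]
  obtain ⟨⟨⟨a20, a21⟩, a30, a31⟩, ⟨a02, a03⟩, a12, a13⟩ := h1
  obtain ⟨⟨⟨b20, b21⟩, b30, b31⟩, ⟨b02, b03⟩, b12, b13⟩ := h2
  generalize g * h = k at *
  simp only [PreservesAxis, Matrix.mul_apply (M := k), Fin.sum_univ_four, a20, a21, a30, a31, a02,
    a03, a12, a13]
  simp [isomInv, lorentz, Matrix.mul_apply, Matrix.diagonal_apply, b20, b21,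
    b30, b31, b02, b03, b12, b13]

/-! ### Flat coordinates and angular coordinates on a torus -/

/-- The flat coordinates on the cylinder of radius `R` of the point with angle `w.1` and signed
length `w.2` along the axis. -/
def vis (R : ℝ) (w : ℝ × ℝ) : Plane := !₂[sinh R * w.1, cosh R * w.2]

/-- The angle and the signed length along the axis, in terms of flat coordinates. -/
def unvis (R : ℝ) (u : Plane) : ℝ × ℝ := (u 0 / sinh R, u 1 / cosh R)

lemma vis_unvis {R : ℝ} (hR : 0 < R) (u : Plane) : vis R (unvis R u) = u := by
  have h1 := (cosh_pos R).ne'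
  have h2 := (sinh_pos_iff.mpr hR).ne'
  ext i
  fin_cases i <;> simp [vis, unvis] <;> field_simp

lemma unvis_vis {R : ℝ} (hR : 0 < R) (w : ℝ × ℝ) : unvis R (vis R w) = w := by
  have h1 := (cosh_pos R).ne'
  have h2 := (sinh_pos_iff.mpr hR).ne'
  ext <;> simp [vis, unvis] <;> field_simp

lemma vis_add (R : ℝ) (w w' : ℝ × ℝ) : vis R (w + w') = vis R w + vis R w' := by
  ext i
  fin_cases i <;> simp [vis] <;> ring

lemma vis_sub (R : ℝ) (w w' : ℝ × ℝ) : vis R (w - w') = vis R w - vis R w' := by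
  ext i
  fin_cases i <;> simp [vis] <;> ring

lemma unvis_add (R : ℝ) (w w' : Plane) : unvis R (w + w') = unvis R w + unvis R w' := by
  ext <;> simp [unvis] <;> ring

lemma continuous_vis (R : ℝ) : Continuous (vis R) := by
  refine (PiLp.continuous_toLp 2 _).comp (continuous_pi fun i => ?_)
  fin_cases i <;> simp <;> fun_prop

lemma continuous_unvis (R : ℝ) : Continuous (unvis R) := by
  unfold unvis; fun_prop

lemma tubePoint_eq (R ρ : ℝ) (u : Plane) : tubePoint R ρ u = cylP (ρ, unvis R u) := rfl

namespace Chart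

variable {M : Type*} [TopologicalSpace M] (φ : Chart M)

lemma continuousOn : ContinuousOn φ.toFun φ.source :=
  continuousOn_iff_continuous_domRestrict.mpr φ.isEmbedding.continuous

lemma injOn : InjOn φ.toFun φ.source := fun x hx y hy h =>
  congrArg Subtype.val (φ.isEmbedding.injective (a₁ := ⟨x, hx⟩) (a₂ := ⟨y, hy⟩) h)

lemma exists_nhds {x : M} (hx : x ∈ φ.source) {V : Set M} (hV : V ∈ 𝓝 x) :
    ∃ V' ∈ 𝓝 (φ.toFun x), ∀ y ∈ φ.source, φ.toFun y ∈ V' → y ∈ V := by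
  have h1 : Subtype.val ⁻¹' V ∈ 𝓝 (⟨x, hx⟩ : φ.source) :=
    continuous_subtype_val.continuousAt.preimage_mem_nhds hV
  rw [φ.isEmbedding.isInducing.nhds_eq_comap] at h1
  obtain ⟨V', hV', h2⟩ := h1
  exact ⟨V', hV', fun y hy h => h2 (a := ⟨y, hy⟩) h⟩

lemma toFun_mem {x : M} (hx : x ∈ φ.source) : φ.toFun x ∈ tubeExterior φ.radius := by
  obtain ⟨W, -, h⟩ := φ.image_eq
  exact (h ▸ mem_image_of_mem φ.toFun hx).2

/-- The inverse of a chart. -/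
def inv [Nonempty M] : (Fin 4 → ℝ) → M := Function.invFunOn φ.toFun φ.source

lemma continuousOn_inv [Nonempty M] : ContinuousOn φ.inv (φ.toFun '' φ.source) := by
  rintro _ ⟨x, hx, rfl⟩
  have h0 : φ.inv (φ.toFun x) = x := φ.injOn.leftInvOn_invFunOn hx
  rw [ContinuousWithinAt, h0]
  intro V hV
  obtain ⟨V', hV', h⟩ := φ.exists_nhds hx hV
  rw [mem_map]
  filter_upwards [mem_nhdsWithin_of_mem_nhds hV', self_mem_nhdsWithin]
  rintro _ hy ⟨y, hys, rfl⟩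
  have : φ.inv (φ.toFun y) = y := φ.injOn.leftInvOn_invFunOn hys
  rw [mem_preimage, this]
  exact h y hys hy

lemma inv_toFun [Nonempty M] {x : M} (hx : x ∈ φ.source) : φ.inv (φ.toFun x) = x :=
  φ.injOn.leftInvOn_invFunOn hx

end Chart

end TubularHyp

namespace TubularManifold

open TubularHyp
open scoped Matrix

/-! ### The hyperbolic structure of the canonical filling -/

variable {M : Type*} [TopologicalSpace M] {ι : Type*} (X : TubularManifold M ι)

instance (i : ι) : DiscreteTopology (X.lattice i) := X.discrete i

instance (i : ι) : IsZLattice ℝ (X.lattice i) := X.isZLattice i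

lemma continuous_torus (i : ι) : Continuous (X.torus i) := by
  rw [continuous_iff_continuousAt]
  intro u V hV
  obtain ⟨φ, -, -, H⟩ := X.torus_chart i u
  obtain ⟨h1, h2⟩ := H.self_of_nhds
  obtain ⟨V', hV', h⟩ := φ.exists_nhds h1 hV
  have hc : ContinuousAt (fun v => tubePoint (X.radius i) (X.radius i) v) u := by
    simp only [tubePoint_eq]
    exact (continuous_cylP.comp (continuous_const.prodMk (continuous_unvis _))).continuousAt
  rw [h2] at hV'
  rw [mem_map]
  filter_upwards [H, hc.eventually hV'] with v hv1 hv2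
  exact h _ hv1.1 (by rw [hv1.2]; exact hv2)

/-- Every chart maps the points of the boundary tori to the surface of its tube: otherwise the
image of a neighbourhood would be a neighbourhood in `H3`, whereas in a chart adapted to the torus
it lies on one side of a cylinder. -/
lemma toFun_torus_mem {φ : Chart M} (hφ : φ ∈ X.charts) {i : ι} {u : Plane}
    (hu : X.torus i u ∈ φ.source) : φ.toFun (X.torus i u) ∈ tubeSurface φ.radius := by
  obtain ⟨ψ, hψ, hψR, H⟩ := X.torus_chart i u
  obtain ⟨h1, h2⟩ := H.self_of_nhds
  obtain ⟨g, hg, K⟩ := X.compat φ hφ ψ hψ _ ⟨hu, h1⟩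
  have hext := φ.toFun_mem hu
  refine ⟨hext.1, ?_⟩
  by_contra hne
  have hlt : sinh φ.radius ^ 2 < φ.toFun (X.torus i u) 2 ^ 2 + φ.toFun (X.torus i u) 3 ^ 2 :=
    lt_of_le_of_ne hext.2 (Ne.symm hne)
  obtain ⟨V', hV', hV⟩ := φ.exists_nhds hu (K.and (ψ.isOpen_source.mem_nhds h1))
  obtain ⟨W, hWo, hW⟩ := φ.image_eq
  have hR := X.radius_pos i
  set w := unvis (X.radius i) u
  have hx : φ.toFun (X.torus i u) = isomInv g *ᵥ cylP (X.radius i, w) :=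
    hg.eq_inv_mulVec (by rw [← K.self_of_nhds, h2, tubePoint_eq])
  have hxW : φ.toFun (X.torus i u) ∈ W := (hW ▸ mem_image_of_mem φ.toFun hu).1
  have ev : ∀ᶠ z in 𝓝 (φ.toFun (X.torus i u)), z ∈ H3 → g *ᵥ z ∈ tubeExterior ψ.radius := by
    have h3 : ∀ᶠ z : Fin 4 → ℝ in 𝓝 (φ.toFun (X.torus i u)),
        sinh φ.radius ^ 2 < z 2 ^ 2 + z 3 ^ 2 :=
      ContinuousAt.eventually_lt continuousAt_const (by fun_prop) hlt
    filter_upwards [h3, hWo.mem_nhds hxW, hV'] with z z1 z2 z3 z4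
    obtain ⟨y, hy, rfl⟩ : z ∈ φ.toFun '' φ.source := hW ▸ ⟨z2, z4, z1.le⟩
    obtain ⟨k1, k2⟩ := hV y hy z3
    rw [← show ψ.toFun y = g *ᵥ φ.toFun y from k1]
    exact ψ.toFun_mem k2
  have ct : ContinuousAt (fun t : ℝ => isomInv g *ᵥ cylP (t, w)) (X.radius i) :=
    ((continuous_mulVec _).comp (continuous_cylP.comp
      (continuous_id.prodMk continuous_const))).continuousAt
  rw [hx] at ev
  -- the points just inside the cylinder on the normal through `u` give the contradiction
  have ev2 : ∀ᶠ t in 𝓝[<] (X.radius i),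
      isomInv g *ᵥ cylP (t, w) ∈ H3 → g *ᵥ (isomInv g *ᵥ cylP (t, w)) ∈ tubeExterior ψ.radius :=
    nhdsWithin_le_nhds (ct.eventually ev)
  obtain ⟨t, ht1, ht2, ht3⟩ := (ev2.and (Ioo_mem_nhdsLT hR)).exists
  have := ht1 (hg.inv.mulVec_mem (cylP_mem _))
  rw [hg.mulVec_inv, hψR, cylP_mem_tubeExterior hR ht2] at this
  linarith

/-- In every chart a boundary torus is the image of the standard cylinder under an isometry which
preserves the axis; this makes the normal extension of the charts to the collars consistent. -/
lemma torus_in_chart {φ : Chart M} (hφ : φ ∈ X.charts) {i : ι} {u : Plane}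
    (hu : X.torus i u ∈ φ.source) : X.radius i = φ.radius ∧ ∃ g, IsIsom g ∧ PreservesAxis g ∧
      ∀ᶠ v in 𝓝 u, X.torus i v ∈ φ.source ∧
        φ.toFun (X.torus i v) = g *ᵥ cylP (X.radius i, unvis (X.radius i) v) := by
  obtain ⟨ψ, hψ, hψR, H⟩ := X.torus_chart i u
  obtain ⟨g, hg, K⟩ := X.compat ψ hψ φ hφ _ ⟨H.self_of_nhds.1, hu⟩
  have hc := (X.continuous_torus i).continuousAt (x := u)
  have ev : ∀ᶠ v in 𝓝 u, X.torus i v ∈ φ.source ∧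
      φ.toFun (X.torus i v) = g *ᵥ cylP (X.radius i, unvis (X.radius i) v) := by
    filter_upwards [H, hc.eventually K, hc.eventually (φ.isOpen_source.mem_nhds hu)]
      with v h1 h2 h3
    exact ⟨h3, by rw [h2, h1.2, tubePoint_eq]⟩
  have hR := X.radius_pos i
  have hv : Tendsto (vis (X.radius i)) (𝓝 (unvis (X.radius i) u)) (𝓝 u) := by
    have := (continuous_vis (X.radius i)).tendsto (unvis (X.radius i) u)
    rwa [vis_unvis hR] at this
  obtain ⟨h1, h2⟩ := preservesAxis_of_eventually hg hR φ.radius_pos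
    (w := unvis (X.radius i) u) (by
      filter_upwards [hv.eventually ev] with w hw
      rw [unvis_vis hR] at hw
      rw [← hw.2]
      exact X.toFun_torus_mem hφ hw.1)
  exact ⟨h1, g, hg, h2, ev⟩

lemma continuousOn_filling {α : Type*} [TopologicalSpace α] {f : α → X.Filling} {S : Set α}
    (h : ContinuousOn (fun a => (f a).1) S) : ContinuousOn f S :=
  (IsInducing.continuousOn_iff (g := Subtype.val) IsInducing.subtypeVal).mpr h

/-- The position of a point of the filling in cylindrical coordinates about the tube of a
chart. -/
lemma exists_coord {φ : Chart M} (hφ : φ ∈ X.charts) {p : X.Filling} (hp : p.1.1 ∈ φ.source) :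
    ∃ ρ > 0, ∃ w, X.fillingChart φ p = cylP (ρ, w) ∧
      φ.toFun p.1.1 = cylP (max ρ φ.radius, w) ∧ p.1.2 = max (φ.radius - ρ) 0 := by
  have hR := φ.radius_pos
  obtain ⟨ρ, hρ, w, hw⟩ := exists_cylP_of_mem_tubeExterior hR (φ.toFun_mem hp)
  rcases p.2 with h0 | ⟨i, u, h1, h2, h3⟩
  · refine ⟨ρ, hR.trans_le hρ, w, ?_, ?_, ?_⟩
    · rw [fillingChart, h0, sub_zero, radial_self hR, hw]
    · rw [max_eq_left hρ, hw]
    · rw [h0, max_eq_right (by linarith)]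
  · have hp' : X.torus i u ∈ φ.source := h1 ▸ hp
    have hRi := (X.torus_in_chart hφ hp').1
    have hs := X.toFun_torus_mem hφ hp'
    rw [h1, hw, cylP_mem_tubeSurface hR (hR.trans_le hρ)] at hs
    subst hs
    refine ⟨φ.radius - p.1.2, by linarith, w, ?_, ?_, ?_⟩
    · rw [fillingChart, hw, radial_cylP hR]
    · rw [max_eq_right (by linarith), hw]
    · rw [sub_sub_cancel, max_eq_left h2.le]

/-- The open subset of `H3` onto which the extension of a chart to the collars maps. -/
def fillingTarget (φ : Chart M) : Set (Fin 4 → ℝ) :=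
  ({x | 0 < x 2 ^ 2 + x 3 ^ 2} ∩ extProj φ.radius ⁻¹' φ.image_eq.choose) ∩ H3

open Classical in
/-- The inverse of the extension of a chart to the collars. -/
def fillingInv [Nonempty M] (φ : Chart M) (p₀ : X.Filling) (x : Fin 4 → ℝ) : X.Filling :=
  if h : max (φ.radius - axisDist x) 0 = 0 ∨ ∃ i u, X.torus i u = φ.inv (extProj φ.radius x)
      ∧ 0 < max (φ.radius - axisDist x) 0 ∧ max (φ.radius - axisDist x) 0 < X.radius i
    then ⟨(φ.inv (extProj φ.radius x), max (φ.radius - axisDist x) 0), h⟩ else p₀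

lemma exists_of_mem_fillingTarget [Nonempty M] {φ : Chart M} (hφ : φ ∈ X.charts) (p₀ : X.Filling)
    {x : Fin 4 → ℝ} (hx : x ∈ fillingTarget φ) :
    (X.fillingInv φ p₀ x).1 = (φ.inv (extProj φ.radius x), max (φ.radius - axisDist x) 0) ∧
    ∃ ρ > 0, ∃ w, ∃ y ∈ φ.source, x = cylP (ρ, w) ∧ φ.toFun y = cylP (max ρ φ.radius, w) ∧
      (X.fillingInv φ p₀ x).1 = (y, max (φ.radius - ρ) 0) := by
  have hR := φ.radius_pos
  obtain ⟨⟨h1, h2⟩, h3⟩ := hx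
  obtain ⟨ρ, hρ, w, rfl⟩ := exists_cylP h3 h1
  have hmem : extProj φ.radius (cylP (ρ, w)) ∈ φ.toFun '' φ.source := by
    rw [φ.image_eq.choose_spec.2]
    refine ⟨h2, ?_⟩
    rw [extProj_cylP hρ]
    exact (cylP_mem_tubeExterior hR (by positivity) w).mpr (le_max_right _ _)
  obtain ⟨y, hy, hyx⟩ := hmem
  have hinv : φ.inv (extProj φ.radius (cylP (ρ, w))) = y := by rw [← hyx, φ.inv_toFun hy]
  have hyx' : φ.toFun y = cylP (max ρ φ.radius, w) := by rw [hyx, extProj_cylP hρ]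
  have hval : (X.fillingInv φ p₀ (cylP (ρ, w))).1 =
      (φ.inv (extProj φ.radius (cylP (ρ, w))), max (φ.radius - axisDist (cylP (ρ, w))) 0) := by
    rw [fillingInv]
    split_ifs with h
    · rfl
    · exfalso
      apply h
      rw [hinv, axisDist_cylP hρ.le]
      rcases le_or_gt φ.radius ρ with hle | hlt
      · left; rw [max_eq_right (by linarith)]
      · right
        have hs : φ.toFun y ∈ tubeSurface φ.radius := by
          rw [hyx', max_eq_right hlt.le]
          exact (cylP_mem_tubeSurface hR hR w).mpr rfl
        obtain ⟨i, u, hu⟩ := X.boundary φ hφ y hy hs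
        have := (X.torus_in_chart hφ (hu ▸ hy : X.torus i u ∈ φ.source)).1
        refine ⟨i, u, hu, ?_⟩
        rw [max_eq_left (by linarith), this]
        constructor <;> linarith
  refine ⟨hval, ρ, hρ, w, y, hy, rfl, hyx', ?_⟩
  rw [hval, hinv, axisDist_cylP hρ.le]

lemma fillingChart_mem {φ : Chart M} (hφ : φ ∈ X.charts) {p : X.Filling}
    (hp : p.1.1 ∈ φ.source) : X.fillingChart φ p ∈ fillingTarget φ ∧
      extProj φ.radius (X.fillingChart φ p) = φ.toFun p.1.1 ∧
      max (φ.radius - axisDist (X.fillingChart φ p)) 0 = p.1.2 := by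
  obtain ⟨ρ, hρ, w, h1, h2, h3⟩ := X.exists_coord hφ hp
  have h4 : extProj φ.radius (X.fillingChart φ p) = φ.toFun p.1.1 := by
    rw [h1, extProj_cylP hρ, h2]
  refine ⟨⟨⟨?_, ?_⟩, ?_⟩, h4, ?_⟩
  · rw [h1, mem_ofPred_eq, cylP_two_sq_add]
    have := sinh_pos_iff.mpr hρ
    positivity
  · rw [mem_preimage, h4]
    exact (φ.image_eq.choose_spec.2 ▸ mem_image_of_mem φ.toFun hp :
      φ.toFun p.1.1 ∈ φ.image_eq.choose ∩ tubeExterior φ.radius).1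
  · rw [h1]; exact cylP_mem _
  · rw [h1, axisDist_cylP hρ.le, h3]

/-- A chart of `M`, extended to the collars, as a chart of the filling onto an open subset of
`H3`. -/
def hypChart [Nonempty M] (φ : Chart M) (hφ : φ ∈ X.charts) (p₀ : X.Filling) :
    HypChart X.Filling where
  source := {p | p.1.1 ∈ φ.source}
  target := fillingTarget φ
  f := X.fillingChart φ
  e := X.fillingInv φ p₀
  isOpen_source := φ.isOpen_source.preimage (continuous_fst.comp continuous_subtype_val)
  isOpen_target := ⟨_, (continuousOn_extProj φ.radius).isOpen_inter_preimage
    (isOpen_lt (by fun_prop) (by fun_prop)) φ.image_eq.choose_spec.1, rfl⟩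
  f_mem p hp := (X.fillingChart_mem hφ hp).1
  e_mem x hx := by
    obtain ⟨-, ρ, hρ, w, y, hy, -, -, h⟩ := X.exists_of_mem_fillingTarget hφ p₀ hx
    rw [mem_ofPred_eq, h]
    exact hy
  continuousOn_f := by
    refine continuous_radial ?_ (φ.continuousOn.comp ?_ fun p hp => hp)
    · exact (continuous_const.sub (continuous_snd.comp continuous_subtype_val)).continuousOn
    · exact (continuous_fst.comp continuous_subtype_val).continuousOn
  continuousOn_e := by
    refine X.continuousOn_filling ?_
    have h : ContinuousOn (fun x => (φ.inv (extProj φ.radius x), max (φ.radius - axisDist x) 0))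
        (fillingTarget φ) := by
      refine ContinuousOn.prodMk ?_ ?_
      · refine φ.continuousOn_inv.comp ((continuousOn_extProj φ.radius).mono fun x hx => hx.1.1) ?_
        intro x hx
        rw [φ.image_eq.choose_spec.2]
        obtain ⟨ρ, hρ, w, rfl⟩ := exists_cylP hx.2 hx.1.1
        refine ⟨hx.1.2, ?_⟩
        rw [extProj_cylP hρ]
        exact (cylP_mem_tubeExterior φ.radius_pos (by positivity) w).mpr (le_max_right _ _)
      · exact ((continuous_const.sub continuous_axisDist).max continuous_const).continuousOn
    exact h.congr fun x hx => (X.exists_of_mem_fillingTarget hφ p₀ hx).1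
  e_f p hp := by
    obtain ⟨h1, h2, h3⟩ := X.fillingChart_mem hφ hp
    apply Subtype.ext
    rw [(X.exists_of_mem_fillingTarget hφ p₀ h1).1, h2, h3, φ.inv_toFun hp]
  f_e x hx := by
    obtain ⟨-, ρ, hρ, w, y, hy, h1, h2, h3⟩ := X.exists_of_mem_fillingTarget hφ p₀ hx
    rw [fillingChart, h3, h1, h2]
    rcases le_or_gt φ.radius ρ with hle | hlt
    · rw [max_eq_right (by linarith), max_eq_left hle, sub_zero, radial_self φ.radius_pos]
    · rw [max_eq_left (by linarith), max_eq_right hlt.le, sub_sub_cancel,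
        radial_cylP φ.radius_pos]

lemma fillingChart_compat {φ ψ : Chart M} (hφ : φ ∈ X.charts) (hψ : ψ ∈ X.charts) {p : X.Filling}
    (hp : p.1.1 ∈ φ.source) (hp' : p.1.1 ∈ ψ.source) :
    ∃ g, IsIsom g ∧ ∀ᶠ q in 𝓝 p, X.fillingChart ψ q = g *ᵥ X.fillingChart φ q := by
  obtain ⟨g, hg, H⟩ := X.compat φ hφ ψ hψ p.1.1 ⟨hp, hp'⟩
  have hc : ContinuousAt (fun q : X.Filling => q.1.1) p :=
    (continuous_fst.comp continuous_subtype_val).continuousAt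
  refine ⟨g, hg, ?_⟩
  by_cases hb : ∃ i u, X.torus i u = p.1.1
  · obtain ⟨i, u, hu⟩ := hb
    have hφu : X.torus i u ∈ φ.source := hu ▸ hp
    have hψu : X.torus i u ∈ ψ.source := hu ▸ hp'
    obtain ⟨hr, k, hk, hkp, K⟩ := X.torus_in_chart hφ hφu
    have hr' := (X.torus_in_chart hψ hψu).1
    have hR := X.radius_pos i
    have hv : Tendsto (vis (X.radius i)) (𝓝 (unvis (X.radius i) u)) (𝓝 u) := by
      have := (continuous_vis (X.radius i)).tendsto (unvis (X.radius i) u)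
      rwa [vis_unvis hR] at this
    have ht := (X.continuous_torus i).tendsto u
    have hgp : PreservesAxis g := by
      refine PreservesAxis.of_mul hk ?_ hkp
      refine (preservesAxis_of_eventually (hg.mul hk) hR ψ.radius_pos
        (w := unvis (X.radius i) u) ?_).2
      rw [← hu] at H
      filter_upwards [hv.eventually K, hv.eventually (ht.eventually H),
        hv.eventually (ht.eventually (ψ.isOpen_source.mem_nhds hψu))] with w h1 h2 h3
      rw [unvis_vis hR] at h1
      rw [← Matrix.mulVec_mulVec, ← h1.2, ← h2]
      exact X.toFun_torus_mem hψ h3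
    filter_upwards [hc.eventually H] with q hq
    rw [fillingChart, fillingChart, hq, ← hr, ← hr', hgp.radial_mulVec]
  · -- near an interior point of `M` there are no collars
    have hb' : ∀ᶠ y in 𝓝 p.1.1, ¬ ∃ i u, X.torus i u = y := by
      have hne : φ.toFun p.1.1 ∉ tubeSurface φ.radius := fun h => hb (X.boundary φ hφ _ hp h)
      have hne' : ¬ φ.toFun p.1.1 2 ^ 2 + φ.toFun p.1.1 3 ^ 2 = sinh φ.radius ^ 2 :=
        fun h => hne ⟨(φ.toFun_mem hp).1, h⟩
      have hcφ : ContinuousAt φ.toFun p.1.1 :=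
        φ.continuousOn.continuousAt (φ.isOpen_source.mem_nhds hp)
      have ho : IsOpen {x : Fin 4 → ℝ | x 2 ^ 2 + x 3 ^ 2 ≠ sinh φ.radius ^ 2} :=
        isOpen_ne_fun (by fun_prop) (by fun_prop)
      filter_upwards [hcφ.eventually (ho.mem_nhds hne'), φ.isOpen_source.mem_nhds hp]
        with y h1 h2
      rintro ⟨i, u, rfl⟩
      exact h1 (X.toFun_torus_mem hφ h2).2
    filter_upwards [hc.eventually H, hc.eventually hb'] with q h1 h2
    have h0 : q.1.2 = 0 := q.2.resolve_right fun ⟨i, u, h, _⟩ => h2 ⟨i, u, h⟩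
    rw [fillingChart, fillingChart, h0, sub_zero, sub_zero, radial_self φ.radius_pos,
      radial_self ψ.radius_pos, h1]

lemma nonempty_of_filling (p₀ : X.Filling) : Nonempty M := ⟨p₀.1.1⟩

/-- The hyperbolic structure of the filling. -/
def atlas (p₀ : X.Filling) : HypAtlas X.Filling :=
  haveI := X.nonempty_of_filling p₀
  { charts := {c | ∃ φ, ∃ h : φ ∈ X.charts, c = X.hypChart φ h p₀}
    cover := fun p => by
      obtain ⟨φ, hφ, hp⟩ := X.cover p.1.1
      exact ⟨_, ⟨φ, hφ, rfl⟩, hp⟩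
    compat := by
      rintro _ ⟨φ, hφ, rfl⟩ _ ⟨ψ, hψ, rfl⟩ p ⟨hp, hp'⟩
      exact X.fillingChart_compat hφ hψ hp hp' }

lemma locIso_iff (p₀ : X.Filling) {A : ℝ × ℝ × ℝ → X.Filling} {z : ℝ × ℝ × ℝ} :
    (X.atlas p₀).LocIso A z ↔ ∃ φ ∈ X.charts, ∃ g, IsIsom g ∧ ∀ᶠ z' in 𝓝 z,
      (A z').1.1 ∈ φ.source ∧ X.fillingChart φ (A z') = g *ᵥ cylP z' := by
  constructor
  · rintro ⟨_, ⟨φ, hφ, rfl⟩, g, hg, H⟩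
    exact ⟨φ, hφ, g, hg, H⟩
  · rintro ⟨φ, hφ, g, hg, H⟩
    have := X.nonempty_of_filling p₀
    exact ⟨X.hypChart φ hφ p₀, ⟨φ, hφ, rfl⟩, g, hg, H⟩

/-! ### The collars -/

open Classical in
/-- The collar of the torus `i` in cylindrical coordinates about its core; it is meaningful for
`0 < ρ ≤ Rᵢ`. -/
def collar (p₀ : X.Filling) (i : ι) (z : ℝ × ℝ × ℝ) : X.Filling :=
  if h : 0 < z.1 ∧ z.1 ≤ X.radius i then
    ⟨(X.torus i (vis (X.radius i) z.2), X.radius i - z.1), by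
      rcases h.2.eq_or_lt with h' | h'
      · left; simp [h']
      · exact Or.inr ⟨i, _, rfl, by simp only; linarith, by simp only; linarith [h.1]⟩⟩
  else p₀

variable {X} {p₀ : X.Filling} {i : ι}

lemma collar_val {z : ℝ × ℝ × ℝ} (h0 : 0 < z.1) (h1 : z.1 ≤ X.radius i) :
    (X.collar p₀ i z).1 = (X.torus i (vis (X.radius i) z.2), X.radius i - z.1) := by
  rw [collar, dif_pos ⟨h0, h1⟩]

lemma continuousOn_collar : ContinuousOn (X.collar p₀ i) (Ioc 0 (X.radius i) ×ˢ univ) := by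
  refine X.continuousOn_filling ?_
  have h : Continuous fun z : ℝ × ℝ × ℝ =>
      (X.torus i (vis (X.radius i) z.2), X.radius i - z.1) := by
    have := X.continuous_torus i
    have := continuous_vis (X.radius i)
    fun_prop
  exact h.continuousOn.congr fun z hz => collar_val hz.1.1 hz.1.2

lemma collar_locIso {z : ℝ × ℝ × ℝ} (h0 : 0 < z.1) (h1 : z.1 < X.radius i) :
    (X.atlas p₀).LocIso (X.collar p₀ i) z := by
  rw [locIso_iff]
  obtain ⟨φ, hφ, hp⟩ := X.cover (X.torus i (vis (X.radius i) z.2))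
  obtain ⟨hr, g, hg, hgp, H⟩ := X.torus_in_chart hφ hp
  have hR := X.radius_pos i
  refine ⟨φ, hφ, g, hg, ?_⟩
  have hv : ContinuousAt (fun z' : ℝ × ℝ × ℝ => vis (X.radius i) z'.2) z :=
    ((continuous_vis _).comp continuous_snd).continuousAt
  have hI : ∀ᶠ z' : ℝ × ℝ × ℝ in 𝓝 z, z'.1 ∈ Ioo 0 (X.radius i) :=
    continuousAt_fst.eventually (Ioo_mem_nhds h0 h1)
  filter_upwards [hv.eventually H, hI] with z' h2 h3
  have := collar_val (p₀ := p₀) h3.1 h3.2.le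
  refine ⟨by rw [this]; exact h2.1, ?_⟩
  rw [fillingChart, this, h2.2, unvis_vis hR, ← hr, sub_sub_cancel, hgp.radial_mulVec,
    radial_cylP hR]

end TubularManifold

namespace TubularManifold

open TubularHyp
open scoped Matrix

/-! ### Tubes about the cores of the ends -/

variable {M : Type*} [TopologicalSpace M] {ι : Type*} (X : TubularManifold M ι)

/-- The normal exponential map of the core of the end `i`, in cylindrical coordinates: the
continuation of the collar along the rays normal to the core. -/
def tube (p₀ : X.Filling) (i : ι) : ℝ × ℝ × ℝ → X.Filling :=
  (X.atlas p₀).dev (X.collar p₀ i)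

/-- The domain on which the normal exponential map of the core of the end `i` is defined. -/
def tubeDom (p₀ : X.Filling) (i : ι) : Set (ℝ × ℝ × ℝ) :=
  (X.atlas p₀).devDom (X.collar p₀ i)

variable {X} {p₀ : X.Filling} {i j : ι} {s : ℝ} {w : ℝ × ℝ}

lemma isRayExt_collar : (X.atlas p₀).IsRayExt (X.collar p₀ i) (X.radius i) univ (X.collar p₀ i) :=
  fun _ _ => ⟨fun _ hs => collar_locIso hs.1 hs.2, 1, one_pos,
    Eventually.of_forall fun _ _ _ => rfl⟩

lemma collar_lattice {δ : ℝ × ℝ} (hδ : vis (X.radius i) δ ∈ X.lattice i) :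
    X.collar p₀ i (s, δ + w) = X.collar p₀ i (s, w) := by
  have : X.torus i (vis (X.radius i) (δ + w)) = X.torus i (vis (X.radius i) w) := by
    rw [X.torus_eq_iff]
    exact ⟨rfl, by rwa [vis_add, add_sub_cancel_right]⟩
  simp only [collar, this]

variable (X i) in
/-- Every point of the plane is equivalent under the lattice to a point of a compact set. -/
lemma exists_compact_reps : ∃ K : Set (ℝ × ℝ), IsCompact K ∧
    ∀ w, ∃ w' ∈ K, vis (X.radius i) (w - w') ∈ X.lattice i := by
  have hR := X.radius_pos i
  let b := (Module.Free.chooseBasis ℤ (X.lattice i)).ofZLatticeBasis ℝ (X.lattice i)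
  have hspan : Submodule.span ℤ (range b) = X.lattice i :=
    (Module.Free.chooseBasis ℤ (X.lattice i)).ofZLatticeBasis_span ℝ (X.lattice i)
  refine ⟨unvis (X.radius i) '' closure (ZSpan.fundamentalDomain b),
    ((ZSpan.fundamentalDomain_isBounded b).isCompact_closure).image (continuous_unvis _), ?_⟩
  intro w
  refine ⟨_, ⟨_, subset_closure (ZSpan.fract_mem_fundamentalDomain b (vis (X.radius i) w)), rfl⟩,
    ?_⟩
  rw [vis_sub, vis_unvis hR, ZSpan.fract_apply, sub_sub_cancel]
  exact hspan.le (ZSpan.floor b (vis (X.radius i) w)).2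

variable (X i) in
lemma isClosed_range_torus [T2Space M] : IsClosed (range (X.torus i)) := by
  obtain ⟨K, hK, h⟩ := X.exists_compact_reps i
  have hR := X.radius_pos i
  have : range (X.torus i) = (fun w => X.torus i (vis (X.radius i) w)) '' K := by
    apply Subset.antisymm
    · rintro _ ⟨u, rfl⟩
      obtain ⟨w', hw', hl⟩ := h (unvis (X.radius i) u)
      refine ⟨w', hw', ?_⟩
      rw [eq_comm, X.torus_eq_iff]
      rw [vis_sub, vis_unvis hR] at hl
      exact ⟨rfl, hl⟩
    · rintro _ ⟨w, -, rfl⟩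
      exact mem_range_self _
  rw [this]
  exact (hK.image ((X.continuous_torus i).comp (continuous_vis _))).isClosed

lemma mem_tubeDom_of_lt (hs : 0 < s) (hsR : s < X.radius i) : (s, w) ∈ X.tubeDom p₀ i :=
  ⟨hs, X.radius i, univ, _, hsR, isOpen_univ, mem_univ _, isRayExt_collar⟩

variable (X p₀) in
/-- The tubes of radius `r` are defined and their interiors are disjoint and embedded. -/
structure EmbTo (r : ℝ) : Prop where
  dom : ∀ i, ∀ s ∈ Ioo 0 r, ∀ w, (s, w) ∈ X.tubeDom p₀ i
  inj : ∀ i j, ∀ s ∈ Ioo 0 r, ∀ t ∈ Ioo 0 r, ∀ w w',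
    X.tube p₀ i (s, w) = X.tube p₀ j (t, w') →
      i = j ∧ s = t ∧ vis (X.radius i) (w - w') ∈ X.lattice i

lemma EmbTo.of_forall_lt {r : ℝ} (h : ∀ s < r, ∃ t > s, X.EmbTo p₀ t) : X.EmbTo p₀ r := by
  constructor
  · intro i s hs w
    obtain ⟨t, hst, ht⟩ := h s hs.2
    exact ht.dom i s ⟨hs.1, hst⟩ w
  · intro i j s hs t ht w w' heq
    obtain ⟨q, hq, hE⟩ := h (max s t) (max_lt hs.2 ht.2)
    exact hE.inj i j s ⟨hs.1, (le_max_left _ _).trans_lt hq⟩ t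
      ⟨ht.1, (le_max_right _ _).trans_lt hq⟩ w w' heq

lemma isRayExt_of_isTubeEmbedding {r : ℝ} (hr : 0 < r) {F : ι → ℝ → Plane → X.Filling}
    (hF : X.IsTubeEmbedding r F) : (X.atlas p₀).IsRayExt (X.collar p₀ i) r univ
      (fun z => F i z.1 (vis (X.radius i) z.2)) := by
  have hR := X.radius_pos i
  intro w _
  constructor
  · rintro s ⟨hs0, hsr⟩
    rw [locIso_iff]
    obtain ⟨φ, hφ, g, hg, h1, h2⟩ := hF.isometry i s ⟨hs0, hsr.le⟩ (vis (X.radius i) w)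
    have ht : Tendsto (fun z : ℝ × ℝ × ℝ => (z.1, vis (X.radius i) z.2)) (𝓝 (s, w))
        (𝓝[Ioc 0 r ×ˢ univ] (s, vis (X.radius i) w)) := by
      refine tendsto_nhdsWithin_iff.mpr ⟨?_, ?_⟩
      · exact (continuous_fst.prodMk ((continuous_vis _).comp continuous_snd)).tendsto (s, w)
      · filter_upwards [continuousAt_fst.eventually (Ioo_mem_nhds hs0 hsr)] with z hz
        exact ⟨⟨hz.1, hz.2.le⟩, mem_univ _⟩
    have hc := (hF.continuousOn i (s, vis (X.radius i) w) ⟨⟨hs0, hsr.le⟩, mem_univ _⟩).tendsto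
    have hop : IsOpen {q : X.Filling | q.1.1 ∈ φ.source} :=
      φ.isOpen_source.preimage (continuous_fst.comp continuous_subtype_val)
    refine ⟨φ, hφ, g, hg, ?_⟩
    filter_upwards [ht.eventually h2, (hc.comp ht).eventually (hop.mem_nhds h1)] with z z1 z2
    refine ⟨z2, ?_⟩
    rw [z1, tubePoint_eq, unvis_vis hR]
  · refine ⟨min r (X.radius i), lt_min hr hR, Eventually.of_forall fun w' s hs => ?_⟩
    have h1 : s ≤ r := hs.2.le.trans (min_le_left _ _)
    have h2 : s ≤ X.radius i := hs.2.le.trans (min_le_right _ _)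
    apply Subtype.ext
    simp only
    rw [hF.start i s ⟨hs.1, h1⟩ h2, collar_val hs.1 h2]

variable [T2Space M]

lemma tube_locIso {z : ℝ × ℝ × ℝ} (hz : z ∈ X.tubeDom p₀ i) :
    (X.atlas p₀).LocIso (X.tube p₀ i) z :=
  HypAtlas.dev_locIso hz

lemma tube_eq_collar_of_lt (hs : 0 < s) (hsR : s < X.radius i) :
    X.tube p₀ i (s, w) = X.collar p₀ i (s, w) :=
  (isRayExt_collar.dev_eq isOpen_univ (mem_univ w) hs hsR).self_of_nhds

lemma tendsto_tube_radius : Tendsto (fun s => X.tube p₀ i (s, w)) (𝓝[<] X.radius i)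
    (𝓝 (X.collar p₀ i (X.radius i, w))) := by
  have hR := X.radius_pos i
  have h1 : ContinuousWithinAt (X.collar p₀ i) (Ioc 0 (X.radius i) ×ˢ univ) (X.radius i, w) :=
    continuousOn_collar _ ⟨⟨hR, le_rfl⟩, mem_univ _⟩
  have h2 : Tendsto (fun s : ℝ => (s, w)) (𝓝[<] X.radius i)
      (𝓝[Ioc 0 (X.radius i) ×ˢ univ] (X.radius i, w)) := by
    refine tendsto_nhdsWithin_iff.mpr ⟨?_, ?_⟩
    · exact ((continuous_id.prodMk continuous_const).tendsto (X.radius i)).mono_left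
        nhdsWithin_le_nhds
    · filter_upwards [Ioo_mem_nhdsLT hR] with s hs using ⟨⟨hs.1, hs.2.le⟩, mem_univ _⟩
  refine (h1.tendsto.comp h2).congr' ?_
  filter_upwards [Ioo_mem_nhdsLT hR] with s hs
  exact (tube_eq_collar_of_lt hs.1 hs.2).symm

lemma mem_tubeDom_of_le (hs : 0 < s) (hsR : s ≤ X.radius i) : (s, w) ∈ X.tubeDom p₀ i := by
  rcases hsR.eq_or_lt with rfl | h
  · exact HypAtlas.mem_devDom_of_clusterPt hs (fun t ht => mem_tubeDom_of_lt ht.1 ht.2)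
      tendsto_tube_radius.mapClusterPt
  · exact mem_tubeDom_of_lt hs h

lemma tube_eq_collar (hs : 0 < s) (hsR : s ≤ X.radius i) :
    X.tube p₀ i (s, w) = X.collar p₀ i (s, w) := by
  rcases hsR.eq_or_lt with rfl | h
  · refine tendsto_nhds_unique ?_ (tendsto_tube_radius (p₀ := p₀) (w := w))
    have h1 := (tube_locIso (mem_tubeDom_of_le (p₀ := p₀) (w := w) hs le_rfl)).continuousAt
    exact (h1.tendsto.comp ((continuous_id.prodMk continuous_const).tendsto (X.radius i))).mono_left
      nhdsWithin_le_nhds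
  · exact tube_eq_collar_of_lt hs h

lemma tube_lattice {δ : ℝ × ℝ} (hδ : vis (X.radius i) δ ∈ X.lattice i)
    (h : (s, δ + w) ∈ X.tubeDom p₀ i) :
    (s, w) ∈ X.tubeDom p₀ i ∧ X.tube p₀ i (s, δ + w) = X.tube p₀ i (s, w) := by
  obtain ⟨h0, T, U, A, h1, h2, h3, h4⟩ := h
  have hc : Continuous fun v : ℝ × ℝ => δ + v := by fun_prop
  have hext : (X.atlas p₀).IsRayExt (X.collar p₀ i) T ((fun v => δ + v) ⁻¹' U)
      (fun z => A (z.1, δ + z.2)) := by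
    intro v hv
    obtain ⟨k1, ε, hε, k2⟩ := h4 _ hv
    refine ⟨fun t ht => HypAtlas.LocIso.screw (z := (t, v)) δ (k1 t ht), ε, hε, ?_⟩
    filter_upwards [hc.continuousAt.eventually k2] with v' h t ht
    rw [h t ht, collar_lattice hδ]
  refine ⟨⟨h0, T, _, _, h1, h2.preimage hc, h3, hext⟩, ?_⟩
  rw [tube, (h4.dev_eq h2 h3 h0 h1).self_of_nhds,
    (hext.dev_eq (h2.preimage hc) h3 h0 h1).self_of_nhds]

lemma embTo_of_mem_tubeRadii {r : ℝ} (hr : r ∈ X.tubeRadii) : X.EmbTo p₀ r := by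
  obtain ⟨hr0, F, hF⟩ := hr
  have key : ∀ i, ∀ s ∈ Ioo 0 r, ∀ w, X.tube p₀ i (s, w) = F i s (vis (X.radius i) w) :=
    fun i s hs w => ((isRayExt_of_isTubeEmbedding hr0 hF).dev_eq isOpen_univ (mem_univ w) hs.1
      hs.2).self_of_nhds
  constructor
  · exact fun i s hs w => ⟨hs.1, r, univ, _, hs.2, isOpen_univ, mem_univ _,
      isRayExt_of_isTubeEmbedding hr0 hF⟩
  · intro i j s hs t ht w w' heq
    rw [key i s hs, key j t ht, hF.eq_iff i j s ⟨hs.1, hs.2.le⟩ t ⟨ht.1, ht.2.le⟩] at heq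
    obtain ⟨rfl, h1, h2⟩ := heq
    exact ⟨rfl, h1, by rwa [vis_sub]⟩

lemma mem_tubeRadii {r : ℝ} (hr : 0 < r) (hdom : ∀ i, ∀ s ∈ Ioc 0 r, ∀ w, (s, w) ∈ X.tubeDom p₀ i)
    (hinj : ∀ i j, ∀ s ∈ Ioc 0 r, ∀ t ∈ Ioc 0 r, ∀ w w',
      X.tube p₀ i (s, w) = X.tube p₀ j (t, w') →
        i = j ∧ s = t ∧ vis (X.radius i) (w - w') ∈ X.lattice i) : r ∈ X.tubeRadii := by
  refine ⟨hr, fun i ρ u => X.tube p₀ i (ρ, unvis (X.radius i) u), ?_⟩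
  constructor
  · intro i ρ hρ hρR u
    rw [tube_eq_collar hρ.1 hρR, collar_val hρ.1 hρR]
    simp only [vis_unvis (X.radius_pos i)]
  · rintro i ⟨ρ, u⟩ ⟨hρ, -⟩
    have h1 := (tube_locIso (hdom i ρ hρ (unvis (X.radius i) u))).continuousAt
    have h2 : ContinuousAt (fun p : ℝ × Plane => (p.1, unvis (X.radius i) p.2)) (ρ, u) :=
      (continuous_fst.prodMk ((continuous_unvis _).comp continuous_snd)).continuousAt
    exact (ContinuousAt.comp (g := X.tube p₀ i) (x := (ρ, u)) h1 h2).continuousWithinAt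
  · intro i ρ hρ u
    have h2 : ContinuousAt (fun p : ℝ × Plane => (p.1, unvis (X.radius i) p.2)) (ρ, u) :=
      (continuous_fst.prodMk ((continuous_unvis _).comp continuous_snd)).continuousAt
    obtain ⟨φ, hφ, g, hg, H⟩ := 
      (X.locIso_iff p₀).mp (tube_locIso (hdom i ρ hρ (unvis (X.radius i) u)))
    refine ⟨φ, hφ, g, hg, H.self_of_nhds.1, nhdsWithin_le_nhds ?_⟩
    filter_upwards [h2.eventually H] with p hp
    rw [hp.2, tubePoint_eq]
  · intro i j ρ hρ σ hσ u v
    constructor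
    · intro h
      obtain ⟨rfl, h1, h2⟩ := hinj i j ρ hρ σ hσ _ _ h
      refine ⟨rfl, h1, ?_⟩
      rwa [vis_sub, vis_unvis (X.radius_pos i), vis_unvis (X.radius_pos i)] at h2
    · rintro ⟨rfl, rfl, h⟩
      have hδ : vis (X.radius i) (unvis (X.radius i) (u - v)) ∈ X.lattice i := by
        rwa [vis_unvis (X.radius_pos i)]
      have := (tube_lattice (p₀ := p₀) (s := ρ) (w := unvis (X.radius i) v) hδ
        (hdom i ρ hρ _)).2
      rwa [← unvis_add, sub_add_cancel] at this

variable (X) in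
lemma tubeRadii_nonempty [Finite ι] [Nonempty ι] : X.tubeRadii.Nonempty := by
  obtain ⟨k, hk⟩ := Finite.exists_min X.radius
  let p₀ : X.Filling := ⟨(X.torus k 0, 0), Or.inl rfl⟩
  have hR := X.radius_pos
  refine ⟨X.radius k, mem_tubeRadii (p₀ := p₀) (hR k)
    (fun i s hs w => mem_tubeDom_of_le hs.1 (hs.2.trans (hk i))) ?_⟩
  intro i j s hs t ht w w' h
  have hsi := hs.2.trans (hk i)
  have htj := ht.2.trans (hk j)
  rw [tube_eq_collar hs.1 hsi, tube_eq_collar ht.1 htj] at h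
  have h' := congrArg Subtype.val h
  rw [collar_val hs.1 hsi, collar_val ht.1 htj, Prod.mk.injEq, X.torus_eq_iff] at h'
  obtain ⟨⟨rfl, h1⟩, h2⟩ := h'
  exact ⟨rfl, by linarith, by rwa [vis_sub]⟩

/-- Points which approach the core of a tube do not converge in the filling: the limit would lie
at depth `Rᵢ` below the torus `i`, whereas the collar is only attached for depths less than
`Rᵢ`. -/
lemma not_tendsto_of_core {β : Type*} {f : Filter β} [f.NeBot] {σ : β → ℝ} {w : β → ℝ × ℝ}
    (hσ0 : ∀ᶠ b in f, 0 < σ b) (hσ : Tendsto σ f (𝓝 0)) {x : X.Filling}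
    (hx : Tendsto (fun b => X.tube p₀ i (σ b, w b)) f (𝓝 x)) : False := by
  have hR := X.radius_pos i
  have hval : ∀ᶠ b in f, (X.tube p₀ i (σ b, w b)).1 =
      (X.torus i (vis (X.radius i) (w b)), X.radius i - σ b) := by
    filter_upwards [hσ0, hσ.eventually (Iio_mem_nhds hR)] with b h1 h2
    rw [tube_eq_collar_of_lt h1 h2, collar_val h1 (le_of_lt h2)]
  have hx1 := (continuous_subtype_val.tendsto x).comp hx
  have hd : x.1.2 = X.radius i := by
    refine tendsto_nhds_unique ((continuous_snd.tendsto _).comp hx1) ?_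
    have : Tendsto (fun b => X.radius i - σ b) f (𝓝 (X.radius i)) := by
      simpa using hσ.const_sub (X.radius i)
    refine this.congr' ?_
    filter_upwards [hval] with b hb
    simp only [Function.comp, hb]
  obtain ⟨u, hu⟩ : x.1.1 ∈ range (X.torus i) := by
    refine (X.isClosed_range_torus i).mem_of_tendsto ((continuous_fst.tendsto _).comp hx1) ?_
    filter_upwards [hval] with b hb
    simp only [Function.comp, hb]
    exact mem_range_self _
  rcases x.2 with h0 | ⟨k, v, h1, h2, h3⟩
  · rw [hd] at h0; exact hR.ne' h0
  · rw [← hu, X.torus_eq_iff] at h1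
    obtain ⟨rfl, -⟩ := h1
    rw [hd] at h3
    exact lt_irrefl _ h3

/-- A family of points of the filling of a compact manifold either has a limit point or comes
arbitrarily close to the cores. -/
lemma exists_mapClusterPt_or [CompactSpace M] [Finite ι] {β : Type*} {f : Filter β} [f.NeBot]
    (p : β → X.Filling) : (∃ x, MapClusterPt x f p) ∨
      ∀ ε > 0, ∃ᶠ b in f, ∃ j, ∃ σ ∈ Ioo 0 ε, ∃ w, p b = X.tube p₀ j (σ, w) := by
  by_contra hcon
  obtain ⟨h1, h2⟩ := not_or.mp hcon
  push Not at h2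
  obtain ⟨ε, hε, h2⟩ := h2
  choose K hK hKrep using X.exists_compact_reps
  -- the complement of the tubes of radius `ε`
  let C : Set X.Filling := (fun y : M => (⟨(y, 0), Or.inl rfl⟩ : X.Filling)) '' univ ∪
    ⋃ j, X.collar p₀ j '' (Icc (min ε (X.radius j)) (X.radius j) ×ˢ K j)
  have hC : IsCompact C := by
    refine (isCompact_univ.image ?_).union (isCompact_iUnion fun j => ?_)
    · exact (continuous_id.prodMk continuous_const).subtype_mk _
    · refine (isCompact_Icc.prod (hK j)).image_of_continuousOn (continuousOn_collar.mono ?_)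
      rintro z ⟨⟨z1, z2⟩, -⟩
      exact ⟨⟨(lt_min hε (X.radius_pos j)).trans_le z1, z2⟩, mem_univ _⟩
  have hpC : ∀ᶠ b in f, p b ∈ C := by
    refine h2.mono fun b hb => ?_
    rcases hp : (p b).2 with h0 | ⟨j, u, k1, k2, k3⟩
    · exact Or.inl ⟨(p b).1.1, mem_univ _, Subtype.ext (Prod.ext rfl h0.symm)⟩
    · right
      have hR := X.radius_pos j
      obtain ⟨w, hw, hl⟩ := hKrep j (unvis (X.radius j) u)
      have hs0 : 0 < X.radius j - (p b).1.2 := by linarith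
      have hs1 : X.radius j - (p b).1.2 < X.radius j := by linarith
      have hpb : p b = X.collar p₀ j (X.radius j - (p b).1.2, w) := by
        apply Subtype.ext
        rw [collar_val hs0 hs1.le]
        refine Prod.ext ?_ (by simp)
        simp only
        rw [← k1, X.torus_eq_iff]
        rw [vis_sub, vis_unvis hR] at hl
        exact ⟨rfl, hl⟩
      refine mem_iUnion.mpr ⟨j, _, ⟨⟨?_, hs1.le⟩, hw⟩, hpb.symm⟩
      by_contra hlt
      have hlt' := (lt_min_iff.mp (not_le.mp hlt)).1
      refine hb j _ ⟨hs0, hlt'⟩ w ?_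
      rw [tube_eq_collar_of_lt hs0 hs1]
      exact hpb
  obtain ⟨x, -, hx⟩ := hC.exists_mapClusterPt_of_frequently hpC.frequently
  exact h1 ⟨x, hx⟩

end TubularManifold

namespace TubularHyp

open scoped Matrix

/-! ### Neighbourhoods of a ray -/

/-- The points with distance from the core in `I` and hyperbolic distance less than `arcosh κ`
from the point at distance `s₀` on the ray `θ = ζ = 0`. -/
def nearRay (I : Set ℝ) (s₀ κ : ℝ) : Set (ℝ × ℝ × ℝ) :=
  {z | z.1 ∈ I ∧ z.2.1 ∈ Ioo (-(π / 2)) (π / 2) ∧ mink (cylP z) (cylP (s₀, 0)) < κ}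

lemma mink_cylP_ray (z : ℝ × ℝ × ℝ) (s₀ : ℝ) : mink (cylP z) (cylP (s₀, 0)) =
    cosh z.1 * cosh s₀ * cosh z.2.2 - sinh z.1 * sinh s₀ * cos z.2.1 := by
  rw [mink_cylP]; simp

lemma mk_mem_nearRay {I : Set ℝ} {s₀ κ s : ℝ} :
    (s, 0) ∈ nearRay I s₀ κ ↔ s ∈ I ∧ cosh (s - s₀) < κ := by
  have : mink (cylP (s, 0)) (cylP (s₀, 0)) = cosh (s - s₀) := by
    rw [mink_cylP_ray, cosh_sub]; simp
  simp [nearRay, this, pi_pos]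

/-- Contracting angle and length along the axis decreases distances, so that the set is connected
through the ray. -/
lemma isPreconnected_nearRay {I : Set ℝ} (hI : I.OrdConnected) (hpos : I ⊆ Ioi 0) {s₀ κ : ℝ}
    (hs₀ : 0 < s₀) : IsPreconnected (nearRay I s₀ κ) := by
  have contract : ∀ z ∈ nearRay I s₀ κ, ∀ t ∈ Icc (0 : ℝ) 1,
      ((z.1, t * z.2.1, t * z.2.2) : ℝ × ℝ × ℝ) ∈ nearRay I s₀ κ := by
    rintro ⟨ρ, θ, ζ⟩ ⟨h1, h2, h3⟩ t ⟨ht0, ht1⟩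
    rw [mink_cylP_ray] at h3
    simp only at h1 h2 h3
    have hs1 := sinh_pos_iff.mpr (hpos h1)
    have hs2 := sinh_pos_iff.mpr hs₀
    have habs : |t * θ| ≤ |θ| := by
      rw [abs_mul, abs_of_nonneg ht0]; nlinarith [abs_nonneg θ]
    have hθ : |θ| < π / 2 := abs_lt.mpr h2
    refine ⟨h1, abs_lt.mp (habs.trans_lt hθ), ?_⟩
    rw [mink_cylP_ray]
    have e1 : cosh (t * ζ) ≤ cosh ζ := by
      rw [cosh_le_cosh, abs_mul, abs_of_nonneg ht0]; nlinarith [abs_nonneg ζ]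
    have e2 : cos θ ≤ cos (t * θ) := by
      rw [← cos_abs θ, ← cos_abs (t * θ)]
      exact cos_le_cos_of_nonneg_of_le_pi (abs_nonneg _) (by linarith [pi_pos]) habs
    have e3 : cosh ρ * cosh s₀ * cosh (t * ζ) ≤ cosh ρ * cosh s₀ * cosh ζ := by gcongr
    have e4 : sinh ρ * sinh s₀ * cos θ ≤ sinh ρ * sinh s₀ * cos (t * θ) := by gcongr
    simp only
    linarith
  have base : ∀ z ∈ nearRay I s₀ κ, (z.1, 0) ∈ nearRay I s₀ κ := by
    intro z hz
    have := contract z hz 0 (by simp)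
    simp only [zero_mul] at this
    exact this
  rcases (nearRay I s₀ κ).eq_empty_or_nonempty with he | ⟨x₀, hx₀⟩
  · rw [he]; exact isPreconnected_empty
  refine isPreconnected_of_forall (x₀.1, 0) fun z hz => ?_
  refine ⟨(fun t : ℝ => ((z.1, t * z.2.1, t * z.2.2) : ℝ × ℝ × ℝ)) '' Icc 0 1 ∪
    (fun s : ℝ => ((s, 0) : ℝ × ℝ × ℝ)) '' uIcc z.1 x₀.1, ?_, ?_, ?_, ?_⟩
  · rintro _ (⟨t, ht, rfl⟩ | ⟨s, hs, rfl⟩)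
    · exact contract z hz t ht
    · have k1 := mk_mem_nearRay.mp (base z hz)
      have k2 := mk_mem_nearRay.mp (base x₀ hx₀)
      refine mk_mem_nearRay.mpr ⟨hI.uIcc_subset k1.1 k2.1 hs, ?_⟩
      have hs' := mem_uIcc.mp hs
      have : |s - s₀| ≤ |z.1 - s₀| ∨ |s - s₀| ≤ |x₀.1 - s₀| := by
        rcases le_total s s₀ with h | h
        · rw [abs_of_nonpos (by linarith : s - s₀ ≤ 0)]
          rcases hs' with h' | h'
          · left; linarith [neg_abs_le (z.1 - s₀)]
          · right; linarith [neg_abs_le (x₀.1 - s₀)]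
        · rw [abs_of_nonneg (by linarith : 0 ≤ s - s₀)]
          rcases hs' with h' | h'
          · right; linarith [le_abs_self (x₀.1 - s₀)]
          · left; linarith [le_abs_self (z.1 - s₀)]
      rcases this with h | h
      · exact (cosh_le_cosh.mpr h).trans_lt k1.2
      · exact (cosh_le_cosh.mpr h).trans_lt k2.2
  · exact Or.inr ⟨x₀.1, right_mem_uIcc, rfl⟩
  · exact Or.inl ⟨1, by simp, by simp⟩
  · refine IsPreconnected.union (z.1, 0) ⟨0, by simp, by simp⟩ ⟨z.1, left_mem_uIcc, rfl⟩ ?_ ?_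
    · exact isPreconnected_Icc.image _ (by fun_prop)
    · exact isPreconnected_uIcc.image _ (by fun_prop)

end TubularHyp

namespace TubularManifold

open TubularHyp
open scoped Matrix

variable {M : Type*} [TopologicalSpace M] {ι : Type*} {X : TubularManifold M ι}
variable {p₀ : X.Filling} {i j : ι} {r s : ℝ} {w : ℝ × ℝ}

/-! ### Extending the tubes to twice their radius -/

lemma EmbTo.mono (hE : X.EmbTo p₀ r) (h : s ≤ r) : X.EmbTo p₀ s :=
  ⟨fun i t ht => hE.dom i t ⟨ht.1, ht.2.trans_le h⟩,
    fun i j t ht u hu => hE.inj i j t ⟨ht.1, ht.2.trans_le h⟩ u ⟨hu.1, hu.2.trans_le h⟩⟩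

variable [T2Space M]

/-- A convergent sequence of points of a tube has its limit in the tube, and the angular
coordinates converge after passing to a subsequence and changing them by lattice vectors. -/
lemma exists_subseq_tube {x : X.Filling} {t : ℕ → ℝ} {v : ℕ → ℝ × ℝ} {t₀ : ℝ}
    (hdom : ∀ n, (t n, v n) ∈ X.tubeDom p₀ j) (hdom₀ : 0 < t₀ → ∀ v, (t₀, v) ∈ X.tubeDom p₀ j)
    (ht : Tendsto t atTop (𝓝 t₀))
    (hx : Tendsto (fun n => X.tube p₀ j (t n, v n)) atTop (𝓝 x)) :
    0 < t₀ ∧ ∃ v₀, x = X.tube p₀ j (t₀, v₀) ∧ ∃ v' : ℕ → ℝ × ℝ,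
      (∀ n, vis (X.radius j) (v n - v' n) ∈ X.lattice j) ∧
      ∃ φ : ℕ → ℕ, StrictMono φ ∧ Tendsto (v' ∘ φ) atTop (𝓝 v₀) := by
  have h0 : 0 < t₀ := by
    have h1 : 0 ≤ t₀ := ge_of_tendsto' ht fun n => (hdom n).1.le
    rcases h1.eq_or_lt with rfl | h2
    · exact (not_tendsto_of_core (Eventually.of_forall fun n => (hdom n).1) ht hx).elim
    · exact h2
  obtain ⟨K, hK, hrep⟩ := X.exists_compact_reps j
  choose v' hv'K hv' using fun n => hrep (v n)
  obtain ⟨v₀, -, φ, hφ, hlim⟩ := hK.tendsto_subseq hv'K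
  refine ⟨h0, v₀, ?_, v', hv', φ, hφ, hlim⟩
  have heq : ∀ n, X.tube p₀ j (t n, v' n) = X.tube p₀ j (t n, v n) := by
    intro n
    have := (tube_lattice (p₀ := p₀) (s := t n) (w := v' n) (hv' n) (by
      rw [sub_add_cancel]; exact hdom n)).2
    rw [← this, sub_add_cancel]
  have hc := (tube_locIso (hdom₀ h0 v₀)).continuousAt.tendsto
  have h1 : Tendsto (fun n => (t (φ n), v' (φ n))) atTop (𝓝 (t₀, v₀)) := by
    rw [nhds_prod_eq]
    exact (ht.comp hφ.tendsto_atTop).prodMk hlim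
  refine tendsto_nhds_unique (hx.comp hφ.tendsto_atTop) ((hc.comp h1).congr fun n => ?_)
  exact heq _

/-- The boundary of an embedded tube is disjoint from the open tubes: the local isometries are
open, so that otherwise points of the interior of the first tube would have two distances from
cores. -/
lemma EmbTo.tube_ne (hE : X.EmbTo p₀ r) (hdom : (r, w) ∈ X.tubeDom p₀ i) {t : ℝ}
    (ht : t ∈ Ioo 0 r) (v : ℝ × ℝ) : X.tube p₀ i (r, w) ≠ X.tube p₀ j (t, v) := by
  intro h
  have hV : {y : ℝ × ℝ × ℝ | y.1 ∈ Ioo 0 ((t + r) / 2)} ∈ 𝓝 (t, v) :=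
    continuousAt_fst.eventually (Ioo_mem_nhds ht.1 (by linarith [ht.2]))
  have him := (tube_locIso (hE.dom j t ht v)).image_mem_nhds ht.1 hV
  rw [← h] at him
  have hc : Tendsto (fun s => X.tube p₀ i (s, w)) (𝓝[<] r) (𝓝 (X.tube p₀ i (r, w))) :=
    ((tube_locIso hdom).continuousAt.tendsto.comp
      ((continuous_id.prodMk continuous_const).tendsto r)).mono_left nhdsWithin_le_nhds
  obtain ⟨s, ⟨⟨t', v'⟩, ⟨ht0, ht1⟩, heq⟩, hs1, hs2⟩ := ((hc.eventually him).and
    (Ioo_mem_nhdsLT (show (t + r) / 2 < r by linarith [ht.2]))).exists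
  simp only at ht0 ht1
  have := (hE.inj j i t' ⟨ht0, by linarith⟩ s ⟨by linarith [ht.1], hs2⟩ v' w heq).2.1
  linarith

/-- A ray normal to the core of an embedded tube of radius `r`, which leaves this tube, needs at
least the length `r - σ` to come to distance `σ` from a core: going back along the ray, the
distance from this core changes at most with unit speed, until the ray leaves the tube. -/
lemma EmbTo.two_mul_le (hE : X.EmbTo p₀ r) {s₁ σ : ℝ} {w' : ℝ × ℝ}
    (hdom : (s₁, w) ∈ X.tubeDom p₀ i) (hs : r ≤ s₁) (hσ : σ ∈ Ioo 0 r)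
    (heq : X.tube p₀ i (s₁, w) = X.tube p₀ j (σ, w')) : 2 * r ≤ σ + s₁ := by
  by_contra! hlt
  have hr : 0 < r := hσ.1.trans hσ.2
  have hdom' : ∀ a ∈ Icc 0 (s₁ - r), (s₁ - a, w) ∈ X.tubeDom p₀ i := fun a ha =>
    HypAtlas.devDom_of_le hdom (by linarith [ha.2]) (by linarith [ha.1])
  -- the distances `a` from the end of the ray up to which the estimate holds
  let S : Set ℝ := {a | ∃ t ∈ Ioc 0 (σ + a), ∃ v, X.tube p₀ i (s₁ - a, w) = X.tube p₀ j (t, v)}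
  have hS : Icc 0 (s₁ - r) ⊆ S := by
    refine IsClosed.Icc_subset_of_forall_mem_nhdsWithin ?_ ?_ ?_
    · refine IsSeqClosed.isClosed fun a a₀ ha ha₀ => ?_
      have hIcc : a₀ ∈ Icc 0 (s₁ - r) :=
        isClosed_Icc.mem_of_tendsto ha₀ (Eventually.of_forall fun n => (ha n).2)
      refine ⟨?_, hIcc⟩
      choose t ht v hv using fun n => (ha n).1
      have htK : ∀ n, t n ∈ Icc 0 r := fun n => ⟨(ht n).1.le, by linarith [(ht n).2, (ha n).2.2]⟩
      obtain ⟨t₀, -, φ, hφ, hlim⟩ := isCompact_Icc.tendsto_subseq htK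
      have ht₀ : t₀ ≤ σ + a₀ :=
        le_of_tendsto_of_tendsto' hlim ((ha₀.comp hφ.tendsto_atTop).const_add σ)
          fun n => (ht (φ n)).2
      have hp : Tendsto (fun n => X.tube p₀ i (s₁ - a (φ n), w)) atTop
          (𝓝 (X.tube p₀ i (s₁ - a₀, w))) := by
        refine (tube_locIso (hdom' a₀ hIcc)).continuousAt.tendsto.comp ?_
        rw [nhds_prod_eq]
        exact ((ha₀.comp hφ.tendsto_atTop).const_sub s₁).prodMk tendsto_const_nhds
      have hd : ∀ n v, (t n, v) ∈ X.tubeDom p₀ j := fun n v =>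
        hE.dom j _ ⟨(ht n).1, by linarith [(ht n).2, (ha n).2.2]⟩ v
      obtain ⟨h0, v₀, hv₀, -⟩ := exists_subseq_tube (p₀ := p₀) (j := j) (t := t ∘ φ) (v := v ∘ φ)
        (t₀ := t₀) (fun n => hd _ _)
        (fun h0 v => hE.dom j _ ⟨h0, by linarith [hIcc.2]⟩ v) hlim
        (hp.congr fun n => hv (φ n))
      exact ⟨t₀, ⟨h0, ht₀⟩, v₀, hv₀⟩
    · exact ⟨σ, ⟨hσ.1, by simp⟩, w', by simpa using heq⟩
    · rintro a ⟨⟨t, ht, v, hv⟩, ha⟩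
      have htr : t ∈ Ioo 0 r := ⟨ht.1, by linarith [ht.2, ha.2]⟩
      have hB := tube_locIso (hE.dom j t htr v)
      have hA := tube_locIso (hdom' a ⟨ha.1, ha.2.le⟩)
      obtain ⟨k, hk, hkz, V₁, hV₁, V₂, hV₂, H⟩ := hA.exists_isom hB hv
      have hpos : {y : ℝ × ℝ × ℝ | 0 < y.1} ∈ 𝓝 (t, v) :=
        continuousAt_fst.eventually (Ioi_mem_nhds ht.1)
      have him := hB.image_mem_nhds ht.1 (inter_mem hV₂ hpos)
      rw [← hv] at him
      have hc : Tendsto (fun b => ((s₁ - b, w) : ℝ × ℝ × ℝ)) (𝓝[>] a) (𝓝 (s₁ - a, w)) :=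
        (((continuous_const.sub continuous_id).prodMk continuous_const).tendsto a).mono_left
          nhdsWithin_le_nhds
      filter_upwards [hc.eventually hV₁, (hA.continuousAt.tendsto.comp hc).eventually him,
        Ioo_mem_nhdsGT ha.2] with b hb1 hb2 hb3
      obtain ⟨⟨t', v'⟩, ⟨hy1, hy2⟩, hy3⟩ := hb2
      have hcyl := (H _ hb1 _ hy1).mp hy3.symm
      have h1 := cosh_sub_le_mink_cylP (z := (t', v')) (z' := (t, v)) hy2.le ht.1.le
      rw [← hk.mink_mulVec, ← hcyl, ← hkz, mink_cylP] at h1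
      simp only [sub_self, cosh_zero, cos_zero, mul_one, ← cosh_sub] at h1
      have habs : |s₁ - b - (s₁ - a)| = b - a := by
        rw [show s₁ - b - (s₁ - a) = -(b - a) by ring, abs_neg, abs_of_pos (sub_pos.mpr hb3.1)]
      rw [cosh_le_cosh, habs] at h1
      refine ⟨t', ⟨hy2, ?_⟩, v', hy3.symm⟩
      linarith [le_abs_self (t' - t), ht.2]
  obtain ⟨t, ht, v, hv⟩ := hS (show s₁ - r ∈ Icc 0 (s₁ - r) from ⟨by linarith, le_rfl⟩)
  rw [sub_sub_cancel] at hv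
  exact hE.tube_ne (HypAtlas.devDom_of_le hdom hr hs) ⟨ht.1, by linarith [ht.2]⟩ v hv

/-- If the tubes of radius `r` have disjoint embedded interiors, then the normal exponential maps
of the cores are defined up to the distance `2r`: by compactness of `M`, a ray can only cease to
exist by running into a core, and this takes it at least the distance `2r`. -/
lemma EmbTo.mem_tubeDom [CompactSpace M] [Finite ι] (hE : X.EmbTo p₀ r) (hr : 0 < r)
    (hs : s ∈ Ioo 0 (2 * r)) : (s, w) ∈ X.tubeDom p₀ i := by
  by_contra hnot
  let B : Set ℝ := {t | 0 < t ∧ (t, w) ∉ X.tubeDom p₀ i}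
  have hsB : s ∈ B := ⟨hs.1, hnot⟩
  have hlow : ∀ t ∈ B, r ≤ t := fun t ht => by
    by_contra! h
    exact ht.2 (hE.dom i t ⟨ht.1, h⟩ w)
  have hbdd : BddBelow B := ⟨r, hlow⟩
  set T := sInf B
  have hrT : r ≤ T := le_csInf ⟨s, hsB⟩ hlow
  have hT2 : T < 2 * r := (csInf_le hbdd hsB).trans_lt hs.2
  have hbelow : ∀ t ∈ Ioo 0 T, (t, w) ∈ X.tubeDom p₀ i := fun t ht => by
    by_contra h
    exact notMem_of_lt_csInf ht.2 hbdd ⟨ht.1, h⟩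
  have hT : (T, w) ∈ X.tubeDom p₀ i := by
    rcases exists_mapClusterPt_or (p₀ := p₀) (f := 𝓝[<] T) fun s => X.tube p₀ i (s, w) with
      ⟨x, hx⟩ | hcore
    · exact HypAtlas.mem_devDom_of_clusterPt (hr.trans_le hrT) hbelow hx
    · exfalso
      have hev : ∀ᶠ s in 𝓝[<] T, s ∈ Ioo (r / 2) T ∧ (r < T → r < s) := by
        refine (show ∀ᶠ s in 𝓝[<] T, s ∈ Ioo (r / 2) T from
          Ioo_mem_nhdsLT (by linarith)).and ?_
        by_cases h : r < T
        · filter_upwards [Ioo_mem_nhdsLT h] with s hs _ using hs.1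
        · exact Eventually.of_forall fun s h' => (h h').elim
      obtain ⟨t, ⟨j, σ, hσ, v, heq⟩, ht, ht'⟩ :=
        ((hcore (min (r / 2) (2 * r - T)) (by
          rw [gt_iff_lt, lt_min_iff]; constructor <;> linarith)).and_eventually hev).exists
      have hσ1 := (lt_min_iff.mp hσ.2).1
      have hσ2 := (lt_min_iff.mp hσ.2).2
      rcases hrT.eq_or_lt with h | h
      · have := (hE.inj i j t ⟨by linarith [ht.1], by rw [h]; exact ht.2⟩ σ
          ⟨hσ.1, by linarith⟩ w v heq).2.1
        linarith [ht.1]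
      · have := hE.two_mul_le (hbelow t ⟨by linarith [ht.1], ht.2⟩) (ht' h).le
          ⟨hσ.1, by linarith⟩ heq
        linarith [ht.2]
  obtain ⟨t, htT, ht⟩ := HypAtlas.exists_gt_mem_devDom hT
  obtain ⟨b, hb, hbt⟩ := (csInf_lt_iff hbdd ⟨s, hsB⟩).mp htT
  exact hb.2 (HypAtlas.devDom_of_le ht hb.1 hbt.le)

/-! ### The tube radius is finite -/

/-- Infinitely many points far apart on an embedded ray cannot accumulate: near a limit point two
of them would lie in a common ball, which is isometric to a ball in the tube. -/
lemma not_forall_embTo [CompactSpace M] [Finite ι] (i : ι) : ¬ ∀ r, X.EmbTo p₀ r := by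
  intro hE
  have hdom : ∀ z : ℝ × ℝ × ℝ, 0 < z.1 → z ∈ X.tubeDom p₀ i := fun z hz =>
    (hE (z.1 + 1)).dom i z.1 ⟨hz, by linarith⟩ z.2
  let p : ℕ → X.Filling := fun n => X.tube p₀ i ((n : ℝ) + 1, 0)
  have hinj : ∀ (n : ℕ) j t w, 0 < t → p n = X.tube p₀ j (t, w) → (n : ℝ) + 1 = t := by
    intro n j t w ht heq
    exact ((hE (max ((n : ℝ) + 1) t + 1)).inj i j _
      ⟨by positivity, by linarith [le_max_left ((n : ℝ) + 1) t]⟩ t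
      ⟨ht, by linarith [le_max_right ((n : ℝ) + 1) t]⟩ 0 w heq).2.1
  rcases exists_mapClusterPt_or (p₀ := p₀) (f := atTop) p with ⟨x, hx⟩ | hcore
  swap
  · obtain ⟨n, j, σ, hσ, w, heq⟩ := (hcore 1 one_pos).exists
    have := hinj n j σ w hσ.1 heq
    have : (0 : ℝ) ≤ n := n.cast_nonneg
    linarith [hσ.2]
  obtain ⟨c, hc, hxc⟩ := (X.atlas p₀).cover x
  obtain ⟨W, hWo, hW⟩ := c.isOpen_target
  have hfx : c.f x ∈ W := (hW ▸ c.f_mem x hxc).1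
  obtain ⟨δ, hδ, hball⟩ := exists_mink_ball (hWo.mem_nhds hfx)
  have hcosh1 : 1 < cosh (1 : ℝ) := one_lt_cosh.mpr one_ne_zero
  have hδ' : 1 < min (1 + δ) (cosh 1) := lt_min (by linarith) hcosh1
  set κ := min (1 + δ) (cosh 1)
  have hclose : ∀ᶠ q : (Fin 4 → ℝ) × (Fin 4 → ℝ) in 𝓝 (c.f x) ×ˢ 𝓝 (c.f x),
      mink q.1 q.2 < κ := by
    rw [← nhds_prod_eq]
    refine ContinuousAt.eventually_lt continuous_mink.continuousAt continuousAt_const ?_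
    rw [(mem_H3_iff.mp (c.target_subset (c.f_mem x hxc))).2]
    exact hδ'
  obtain ⟨V, hV, hVκ⟩ := mem_prod_same_iff.mp hclose
  have hsrc : ∀ᶠ q in 𝓝 x, q ∈ c.source := c.isOpen_source.mem_nhds hxc
  have hcf := c.continuousAt_f hxc
  have hfreq := hx.frequently (hsrc.and ((hcf.eventually hball).and (hcf.eventually hV)))
  obtain ⟨n, -, hn1, hn2, hn3⟩ := hfreq.forall_exists_of_atTop 0
  obtain ⟨m, hm, hm1, -, hm3⟩ := hfreq.forall_exists_of_atTop (n + 1)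
  have hnpos : (0 : ℝ) < (n : ℝ) + 1 := by positivity
  obtain ⟨g, hg, H⟩ := (tube_locIso (hdom ((n : ℝ) + 1, 0) hnpos)).in_chart hc hn1
  obtain ⟨hH1, hH2⟩ := H.self_of_nhds
  -- on the ball about the point `n` of the ray, the tube is the inverse of the chart
  have key : ∀ z ∈ nearRay (Ioi 0) ((n : ℝ) + 1) κ,
      X.tube p₀ i =ᶠ[𝓝 z] fun z' => c.e (g *ᵥ cylP z') := by
    refine HypAtlas.eventuallyEq_of_isPreconnected (𝒜 := X.atlas p₀) (z₀ := ((n : ℝ) + 1, 0))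
      (isPreconnected_nearRay ordConnected_Ioi subset_rfl hnpos)
      (fun z hz => tube_locIso (hdom z hz.1)) ?_ ?_ ?_
    · intro z hz
      refine HypAtlas.locIso_chart hc hg ?_
      rw [hW]
      refine ⟨hn2 (c.target_subset (c.f_mem _ hn1)) _ (hg.mulVec_mem (cylP_mem z)) ?_,
        hg.mulVec_mem (cylP_mem z)⟩
      rw [show c.f (p n) = g *ᵥ cylP ((n : ℝ) + 1, 0) from hH2, hg.mink_mulVec, mink_comm]
      exact hz.2.2.trans_le (min_le_left _ _)
    · exact mk_mem_nearRay.mpr ⟨hnpos, by simpa using hδ'⟩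
    · filter_upwards [H] with z hz
      rw [← hz.2, c.e_f _ hz.1]
  -- the point `m` belongs to this ball, at a distance from the core different from `m + 1`
  set y := isomInv g *ᵥ c.f (p m) with hy
  have hyH : y ∈ H3 := hg.inv.mulVec_mem (c.target_subset (c.f_mem _ hm1))
  have hyκ : mink y (cylP ((n : ℝ) + 1, 0)) < κ := by
    rw [hy, hg.mink_inv_mulVec, ← hH2]
    exact hVκ (show (c.f (p m), c.f (p n)) ∈ V ×ˢ V from ⟨hm3, hn3⟩)
  have hy2 : 0 < y 2 := by
    have h1 : 1 ≤ y 0 := by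
      have := one_le_mink hyH origin_mem
      simpa [mink, origin] using this
    have h2 : cosh 1 ≤ cosh ((n : ℝ) + 1) := by
      rw [cosh_le_cosh, abs_of_pos one_pos, abs_of_pos hnpos]
      linarith [show (0 : ℝ) ≤ n from n.cast_nonneg]
    have h3 : mink y (cylP ((n : ℝ) + 1, 0)) < cosh 1 := hyκ.trans_le (min_le_right _ _)
    simp [mink, cylP, cyl] at h3
    have h4 : 0 < y 2 * sinh ((n : ℝ) + 1) := by nlinarith [cosh_pos ((n : ℝ) + 1)]
    exact pos_of_mul_pos_left h4 (sinh_pos_iff.mpr hnpos).le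
  have hcy := cylP_sec hyH hy2
  have hz : sec y ∈ nearRay (Ioi 0) ((n : ℝ) + 1) κ :=
    ⟨sec_fst_pos hy2, sec_snd_mem y, by rw [hcy]; exact hyκ⟩
  have heq : p m = X.tube p₀ i (sec y) := by
    rw [(key _ hz).self_of_nhds]
    simp only
    rw [hcy, hy, hg.mulVec_inv, c.e_f _ hm1]
  have h1 := hinj m i _ _ (sec_fst_pos hy2) heq
  have h2 : cosh ((sec y).1 - ((n : ℝ) + 1)) < cosh 1 :=
    (cosh_sub_le_mink_cylP (z' := ((n : ℝ) + 1, 0)) (sec_fst_pos hy2).le hnpos.le).trans_lt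
      (by rw [hcy]; exact hyκ.trans_le (min_le_right _ _))
  rw [cosh_lt_cosh, abs_one, ← h1] at h2
  have h3 : ((n + 1 : ℕ) : ℝ) ≤ m := by exact_mod_cast hm
  push_cast at h3
  linarith [le_abs_self ((m : ℝ) + 1 - ((n : ℝ) + 1))]

variable (X) in
lemma bddAbove_tubeRadii [CompactSpace M] [Finite ι] [Nonempty ι] : BddAbove X.tubeRadii := by
  obtain ⟨k⟩ := ‹Nonempty ι›
  let p₀ : X.Filling := ⟨(X.torus k 0, 0), Or.inl rfl⟩
  by_contra h
  refine not_forall_embTo (p₀ := p₀) k fun r => ?_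
  obtain ⟨r', hr', hlt⟩ := not_bddAbove_iff.mp h r
  exact (embTo_of_mem_tubeRadii hr').mono hlt.le

end TubularManifold

namespace TubularManifold

open TubularHyp
open scoped Matrix

variable {M : Type*} [TopologicalSpace M] {ι : Type*} {X : TubularManifold M ι}
variable {p₀ : X.Filling} {i j : ι} {r s : ℝ} {w : ℝ × ℝ}
variable [T2Space M]

/-! ### Tubes of maximal radius touch -/

/-- Coincidences of points of tubes of radii decreasing to `r` converge to a point where tubes of
radius `r` touch, since a tube is locally embedded. -/
lemma EmbTo.exists_touching_of_seq [CompactSpace M] [Finite ι] (hE : X.EmbTo p₀ r) (hr : 0 < r)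
    {s t q : ℕ → ℝ} {w w' : ℕ → ℝ × ℝ} (hq : Tendsto q atTop (𝓝 r)) (hq2 : ∀ n, q n < 2 * r)
    (hs : ∀ n, s n ∈ Icc r (q n)) (ht : ∀ n, t n ∈ Ioc 0 (q n))
    (heq : ∀ n, X.tube p₀ i (s n, w n) = X.tube p₀ j (t n, w' n))
    (hne : ∀ n, ¬ (i = j ∧ s n = t n ∧ vis (X.radius i) (w n - w' n) ∈ X.lattice i)) :
    ∃ v v', X.tube p₀ i (r, v) = X.tube p₀ j (r, v') ∧
      ¬ (i = j ∧ vis (X.radius i) (v - v') ∈ X.lattice i) := by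
  have hdom : ∀ k, ∀ a ∈ Ioo 0 (2 * r), ∀ v, (a, v) ∈ X.tubeDom p₀ k :=
    fun k a ha v => hE.mem_tubeDom hr ha
  have hs_lim : Tendsto s atTop (𝓝 r) :=
    tendsto_of_tendsto_of_tendsto_of_le_of_le tendsto_const_nhds hq (fun n => (hs n).1)
      fun n => (hs n).2
  have hsd : ∀ n, s n ∈ Ioo 0 (2 * r) := fun n =>
    ⟨hr.trans_le (hs n).1, (hs n).2.trans_lt (hq2 n)⟩
  have htd : ∀ n, t n ∈ Ioo 0 (2 * r) := fun n => ⟨(ht n).1, (ht n).2.trans_lt (hq2 n)⟩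
  have hrd : r ∈ Ioo 0 (2 * r) := ⟨hr, by linarith⟩
  obtain ⟨K, hK, hrep⟩ := X.exists_compact_reps i
  choose u huK hu using fun n => hrep (w n)
  have htu : ∀ n, X.tube p₀ i (s n, w n) = X.tube p₀ i (s n, u n) := by
    intro n
    have := (tube_lattice (p₀ := p₀) (s := s n) (w := u n) (hu n) (hdom _ _ (hsd n) _)).2
    rwa [sub_add_cancel] at this
  obtain ⟨v, -, φ, hφ, hv⟩ := hK.tendsto_subseq huK
  obtain ⟨t₀, -, ψ, hψ, ht₀⟩ := (isCompact_Icc (a := (0 : ℝ)) (b := 2 * r)).tendsto_subseq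
    (x := t ∘ φ) fun n => ⟨(htd (φ n)).1.le, (htd (φ n)).2.le⟩
  have hφψ := hφ.tendsto_atTop.comp hψ.tendsto_atTop
  have hlim1 : Tendsto (fun n => (s (φ (ψ n)), u (φ (ψ n)))) atTop (𝓝 (r, v)) := by
    rw [nhds_prod_eq]
    exact (hs_lim.comp hφψ).prodMk (hv.comp hψ.tendsto_atTop)
  have hlocA := tube_locIso (hdom i r hrd v)
  have hx := hlocA.continuousAt.tendsto.comp hlim1
  have ht₀r : t₀ ≤ r := le_of_tendsto_of_tendsto' ht₀ (hq.comp hφψ) fun n => (ht _).2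
  obtain ⟨h0, v', hv', u', hu', χ, hχ, hχlim⟩ := exists_subseq_tube (p₀ := p₀) (j := j)
    (t := (t ∘ φ) ∘ ψ) (v := fun n => w' (φ (ψ n))) (t₀ := t₀)
    (fun n => hdom _ _ (htd _) _) (fun h0 v => hdom _ _ ⟨h0, by linarith⟩ v) ht₀
    (hx.congr fun n => by
      simp only [Function.comp]
      rw [← htu, heq])
  have htr : t₀ = r := by
    by_contra h
    exact hE.tube_ne (hdom i r hrd v) ⟨h0, lt_of_le_of_ne ht₀r h⟩ v' hv'
  subst htr
  refine ⟨v, v', hv', ?_⟩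
  -- a limit in which the two points coincide in the tube contradicts its local injectivity
  rintro ⟨rfl, hl⟩
  obtain ⟨V, hV, hVinj⟩ := hlocA.eventually_injective hr
  have hlim2 : Tendsto (fun n => (t (φ (ψ (χ n))), (v - v') + u' (χ n))) atTop (𝓝 (t₀, v)) := by
    rw [nhds_prod_eq]
    refine (ht₀.comp hχ.tendsto_atTop).prodMk ?_
    simpa using hχlim.const_add (v - v')
  obtain ⟨n, hn1, hn2⟩ := ((hlim1.comp hχ.tendsto_atTop).eventually hV |>.and
    (hlim2.eventually hV)).exists
  simp only [Function.comp] at hn1 hn2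
  have e1 : X.tube p₀ i (t (φ (ψ (χ n))), (v - v') + u' (χ n)) =
      X.tube p₀ i (t (φ (ψ (χ n))), u' (χ n)) :=
    (tube_lattice hl (hdom _ _ (htd _) _)).2
  have e2 : X.tube p₀ i (t (φ (ψ (χ n))), w' (φ (ψ (χ n)))) =
      X.tube p₀ i (t (φ (ψ (χ n))), u' (χ n)) := by
    have := (tube_lattice (p₀ := p₀) (s := t (φ (ψ (χ n)))) (w := u' (χ n)) (hu' (χ n))
      (hdom _ _ (htd _) _)).2
    rwa [sub_add_cancel] at this
  have e3 := hVinj hn1 hn2 (by rw [e1, ← e2, ← htu, heq])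
  rw [Prod.mk.injEq] at e3
  refine hne (φ (ψ (χ n))) ⟨rfl, e3.1, ?_⟩
  have e4 : w (φ (ψ (χ n))) - w' (φ (ψ (χ n))) =
      (w (φ (ψ (χ n))) - u (φ (ψ (χ n)))) + (v - v') - (w' (φ (ψ (χ n))) - u' (χ n)) := by
    rw [e3.2]; abel
  rw [e4, vis_sub, vis_add]
  exact sub_mem (add_mem (hu _) hl) (hu' (χ n))

/-- At the maximal radius `r`, two tubes, or a tube and its translate, touch: the tubes of radius
slightly larger than `r` are still defined, so that they can only fail to be embedded. -/
lemma EmbTo.exists_touching [CompactSpace M] [Finite ι] (hE : X.EmbTo p₀ r) (hr : 0 < r)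
    (hsup : ∀ r' > r, r' ∉ X.tubeRadii) :
    ∃ i j v v', X.tube p₀ i (r, v) = X.tube p₀ j (r, v') ∧
      ¬ (i = j ∧ vis (X.radius i) (v - v') ∈ X.lattice i) := by
  let q : ℕ → ℝ := fun n => r + r / (n + 2)
  have hq0 : ∀ n, r < q n := fun n => by
    have : 0 < r / ((n : ℝ) + 2) := by positivity
    simp only [q]; linarith
  have hq2 : ∀ n, q n < 2 * r := fun n => by
    have : r / ((n : ℝ) + 2) < r := by
      apply div_lt_self hr
      have : (0 : ℝ) ≤ n := n.cast_nonneg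
      linarith
    simp only [q]; linarith
  have hq : Tendsto q atTop (𝓝 r) := by
    have h1 : Tendsto (fun n : ℕ => (n : ℝ) + 2) atTop atTop :=
      tendsto_atTop_add_const_right _ _ tendsto_natCast_atTop_atTop
    simpa using (h1.const_div_atTop r).const_add r
  have hseq : ∀ n, ∃ i j, ∃ s ∈ Icc r (q n), ∃ t ∈ Ioc 0 (q n), ∃ w w',
      X.tube p₀ i (s, w) = X.tube p₀ j (t, w') ∧
        ¬ (i = j ∧ s = t ∧ vis (X.radius i) (w - w') ∈ X.lattice i) := by
    intro n
    by_contra! hcon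
    refine hsup (q n) (hq0 n) (mem_tubeRadii (p₀ := p₀) (hr.trans (hq0 n))
      (fun i s hs w => hE.mem_tubeDom hr ⟨hs.1, hs.2.trans_lt (hq2 n)⟩) ?_)
    intro i j s hs t ht w w' heq
    rcases le_or_gt r s with h | h
    · exact hcon i j s ⟨h, hs.2⟩ t ht w w' heq
    rcases le_or_gt r t with h' | h'
    · obtain ⟨rfl, h1, h2⟩ := hcon j i t ⟨h', ht.2⟩ s hs w' w heq.symm
      refine ⟨rfl, h1.symm, ?_⟩
      have := neg_mem h2
      rwa [vis_sub, neg_sub, ← vis_sub] at this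
    · exact hE.inj i j s ⟨hs.1, h⟩ t ⟨ht.1, h'⟩ w w' heq
  choose I J s hs t ht w w' heq hne using hseq
  obtain ⟨i, j, hij⟩ : ∃ i j, ∃ᶠ n in atTop, I n = i ∧ J n = j := by
    by_contra! hcon
    have : ∀ᶠ n in atTop, ∀ i j, ¬ (I n = i ∧ J n = j) :=
      eventually_all.mpr fun i => eventually_all.mpr fun j => by simpa using hcon i j
    obtain ⟨n, hn⟩ := this.exists
    exact hn _ _ ⟨rfl, rfl⟩
  obtain ⟨φ, hφ, hIJ⟩ := extraction_of_frequently_atTop hij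
  refine ⟨i, j, hE.exists_touching_of_seq hr (q := q ∘ φ) (s := s ∘ φ) (t := t ∘ φ)
    (w := w ∘ φ) (w' := w' ∘ φ) (hq.comp hφ.tendsto_atTop) (fun n => hq2 _) (fun n => hs _)
    (fun n => ht _) (fun n => ?_) (fun n => ?_)⟩
  · have := heq (φ n)
    rwa [(hIJ n).1, (hIJ n).2] at this
  · have := hne (φ n)
    rwa [(hIJ n).1, (hIJ n).2] at this

end TubularManifold

namespace TubularHyp

open scoped Matrix

/-! ### Tangency of tubes -/

/-- A vector orthogonal to a point of `H3` is spacelike. -/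
lemma mink_self_neg {x v : Fin 4 → ℝ} (hx : x ∈ H3) (hv : mink v x = 0) (h0 : v ≠ 0) :
    mink v v < 0 := by
  obtain ⟨hx0, hx1⟩ := hx
  simp only [mink] at hv ⊢
  have o1 : v 0 * x 0 = v 1 * x 1 + v 2 * x 2 + v 3 * x 3 := by linarith
  have o2 : (v 0 * x 0) ^ 2 ≤ (v 1 ^ 2 + v 2 ^ 2 + v 3 ^ 2) * (x 0 ^ 2 - 1) := by
    have : x 0 ^ 2 - 1 = x 1 ^ 2 + x 2 ^ 2 + x 3 ^ 2 := by linarith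
    rw [o1, this]
    nlinarith [sq_nonneg (v 1 * x 2 - v 2 * x 1), sq_nonneg (v 1 * x 3 - v 3 * x 1),
      sq_nonneg (v 2 * x 3 - v 3 * x 2)]
  by_contra! hcon
  have o3 : v 1 ^ 2 + v 2 ^ 2 + v 3 ^ 2 ≤ v 0 ^ 2 := by linarith
  have hs : v 1 ^ 2 + v 2 ^ 2 + v 3 ^ 2 = 0 := by
    refine le_antisymm ?_ (by positivity)
    nlinarith [sq_nonneg (x 0)]
  have hv0 : v 0 ^ 2 = 0 := by
    have : v 0 ^ 2 * x 0 ^ 2 ≤ 0 := by rw [hs] at o2; nlinarith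
    have h2 : 0 < x 0 ^ 2 := by positivity
    nlinarith [sq_nonneg (v 0)]
  have q1 := sq_nonneg (v 1)
  have q2 := sq_nonneg (v 2)
  have q3 := sq_nonneg (v 3)
  have h1 : v 1 = 0 := pow_eq_zero_iff two_ne_zero |>.mp (by linarith)
  have h2 : v 2 = 0 := pow_eq_zero_iff two_ne_zero |>.mp (by linarith)
  have h3 : v 3 = 0 := pow_eq_zero_iff two_ne_zero |>.mp (by linarith)
  apply h0
  ext k
  fin_cases k
  · exact pow_eq_zero_iff two_ne_zero |>.mp hv0
  · exact h1
  · exact h2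
  · exact h3

/-- The curve in `H3` through `x` with velocity `-v`, where `v` is orthogonal to `x`. -/
def inwardCurve (x v : Fin 4 → ℝ) (t : ℝ) : Fin 4 → ℝ :=
  (√(1 + t ^ 2 * mink v v))⁻¹ • (x - t • v)

lemma mulVec_inwardCurve {g : Matrix (Fin 4) (Fin 4) ℝ} (hg : IsIsom g) (x v : Fin 4 → ℝ)
    (t : ℝ) : g *ᵥ inwardCurve x v t = inwardCurve (g *ᵥ x) (g *ᵥ v) t := by
  rw [inwardCurve, inwardCurve, hg.mink_mulVec, Matrix.mulVec_smul, Matrix.mulVec_sub,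
    Matrix.mulVec_smul]

lemma tendsto_inwardCurve (x v : Fin 4 → ℝ) : Tendsto (inwardCurve x v) (𝓝 0) (𝓝 x) := by
  have h : ContinuousAt (inwardCurve x v) 0 := by
    unfold inwardCurve
    have : √(1 + (0 : ℝ) ^ 2 * mink v v) ≠ 0 := by simp
    fun_prop (disch := assumption)
  have := h.tendsto
  simpa [inwardCurve] using this

lemma inwardCurve_mem {x v : Fin 4 → ℝ} (hx : x ∈ H3) (hv : mink v x = 0) :
    ∀ᶠ t in 𝓝 0, inwardCurve x v t ∈ H3 := by
  have h1 : ∀ᶠ t : ℝ in 𝓝 0, 0 < 1 + t ^ 2 * mink v v :=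
    ContinuousAt.eventually_lt continuousAt_const (by fun_prop) (by simp)
  have h2 : ∀ᶠ t in 𝓝 0, 0 < inwardCurve x v t 0 :=
    ((continuous_apply 0).continuousAt.tendsto.comp (tendsto_inwardCurve x v)).eventually
      (Ioi_mem_nhds hx.1)
  filter_upwards [h1, h2] with t ht1 ht2
  rw [mem_H3_iff]
  refine ⟨ht2, ?_⟩
  have hm := (mem_H3_iff.mp hx).2
  have hs := sq_sqrt ht1.le
  have hpos : √(1 + t ^ 2 * mink v v) ≠ 0 := (sqrt_pos.mpr ht1).ne'
  have : mink (inwardCurve x v t) (inwardCurve x v t) =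
      (√(1 + t ^ 2 * mink v v))⁻¹ ^ 2 * (mink x x - 2 * t * mink v x + t ^ 2 * mink v v) := by
    simp only [inwardCurve, mink, Pi.smul_apply, Pi.sub_apply, smul_eq_mul]
    ring
  rw [this, hm, hv, mul_zero, sub_zero, inv_pow, hs]
  exact inv_mul_cancel₀ ht1.ne'

/-- A curve starting on a tube in an inward direction runs into the interior of the tube. -/
lemma sec_inwardCurve_lt {r : ℝ} (hr : 0 < r) {v : Fin 4 → ℝ} (hv : mink v (cylP (r, 0)) = 0)
    (hin : 0 < cosh r * v 2 - sinh r * v 0) :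
    ∀ᶠ t in 𝓝[>] 0, (sec (inwardCurve (cylP (r, 0)) v t)).1 < r := by
  set x := cylP (r, 0) with hx
  have hC := cosh_pos r
  have hS := sinh_pos_iff.mpr hr
  set E := cosh r ^ 2 * (v 2 ^ 2 + v 3 ^ 2) - sinh r ^ 2 * (v 0 ^ 2 - v 1 ^ 2) with hE
  have h3 : ∀ᶠ t : ℝ in 𝓝[>] 0,
      t * E < 2 * (sinh r * cosh r) * (cosh r * v 2 - sinh r * v 0) := by
    refine nhdsWithin_le_nhds (ContinuousAt.eventually_lt (by fun_prop) continuousAt_const ?_)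
    rw [zero_mul]; positivity
  have h1 : ∀ᶠ t : ℝ in 𝓝 0, 0 < 1 + t ^ 2 * mink v v :=
    ContinuousAt.eventually_lt continuousAt_const (by fun_prop) (by simp)
  filter_upwards [h3, nhdsWithin_le_nhds h1, nhdsWithin_le_nhds (inwardCurve_mem (cylP_mem _) hv),
    self_mem_nhdsWithin] with t ht1 ht2 ht3 ht4
  have ht4 : 0 < t := ht4
  set y := inwardCurve x v t with hy
  set c := (√(1 + t ^ 2 * mink v v))⁻¹ with hc
  have hc0 : 0 < c := inv_pos.mpr (sqrt_pos.mpr ht2)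
  have hycomp : ∀ k, y k = c * (x k - t * v k) := fun k => by
    simp [hy, inwardCurve, hc]
  have hx0 : x 0 = cosh r ∧ x 1 = 0 ∧ x 2 = sinh r ∧ x 3 = 0 := by
    simp [hx, cylP, cyl]
  obtain ⟨hx0, hx1, hx2, hx3⟩ := hx0
  have key : cosh r ^ 2 * (y 2 ^ 2 + y 3 ^ 2) < sinh r ^ 2 * (y 0 ^ 2 - y 1 ^ 2) := by
    simp only [hycomp, hx0, hx1, hx2, hx3]
    have h5 : 0 < c ^ 2 * (t * (2 * (sinh r * cosh r) * (cosh r * v 2 - sinh r * v 0) - t * E)) := by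
      have := sub_pos.mpr ht1
      positivity
    rw [hE] at h5
    linarith
  have hyH := ht3.2
  have hlt : y 2 ^ 2 + y 3 ^ 2 < sinh r ^ 2 := by
    have := cosh_sq r
    nlinarith
  rw [sec, ← arsinh_sinh r, arsinh_lt_arsinh, sqrt_lt' hS]
  exact hlt

/-- Two tubes of radius `r` with disjoint interiors, of which the second is the image of the
first under an isometry fixing a common boundary point, have opposite normal vectors at this
point: otherwise there is a direction pointing into both of them. -/
lemma mulVec_normal_eq_neg {k : Matrix (Fin 4) (Fin 4) ℝ} (hk : IsIsom k) {r : ℝ} (hr : 0 < r)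
    (hfix : k *ᵥ cylP (r, 0) = cylP (r, 0))
    (H : ∀ᶠ p : (ℝ × ℝ × ℝ) × (ℝ × ℝ × ℝ) in 𝓝 ((r, 0), (r, 0)),
      p.1.1 < r → p.2.1 < r → cylP p.1 ≠ k *ᵥ cylP p.2) :
    k *ᵥ ![sinh r, 0, cosh r, 0] = -![sinh r, 0, cosh r, 0] := by
  set n : Fin 4 → ℝ := ![sinh r, 0, cosh r, 0] with hn
  have hx : cylP (r, 0) = ![cosh r, 0, sinh r, 0] := by
    ext i; fin_cases i <;> simp [cylP, cyl]
  have hcs := cosh_sq r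
  have hnn : mink n n = -1 := by simp [mink, hn]; nlinarith
  have hnx : mink n (cylP (r, 0)) = 0 := by simp [mink, hn, hx]; ring
  have hvn : ∀ v, -mink v n = cosh r * v 2 - sinh r * v 0 := fun v => by
    simp [mink, hn]; ring
  by_contra hne
  -- the direction `-v` bisects the two inward normals `-n` and `-k n`
  set v := n + k *ᵥ n with hv
  have hv0 : v ≠ 0 := fun h => hne (eq_neg_of_add_eq_zero_right h)
  have hadd : ∀ a b c : Fin 4 → ℝ, mink (a + b) c = mink a c + mink b c := fun a b c => by
    simp [mink]; ring
  have hknx : mink (k *ᵥ n) (cylP (r, 0)) = 0 := by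
    rw [← hfix, hk.mink_mulVec, hnx]
  have hvx : mink v (cylP (r, 0)) = 0 := by rw [hv, hadd, hnx, hknx, add_zero]
  have hknkn : mink (k *ᵥ n) (k *ᵥ n) = -1 := by rw [hk.mink_mulVec, hnn]
  have hneg := mink_self_neg (cylP_mem _) hvx hv0
  have hvv : mink v v = -2 + 2 * mink (k *ᵥ n) n := by
    rw [hv, hadd, mink_comm n, mink_comm (k *ᵥ n) (n + _), hadd, hadd, hnn, hknkn, mink_comm n]
    ring
  have hin : 0 < cosh r * v 2 - sinh r * v 0 := by
    rw [← hvn, hv, hadd, hnn]; linarith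
  set v' := isomInv k *ᵥ v with hv'
  have hfix' : isomInv k *ᵥ cylP (r, 0) = cylP (r, 0) := (hk.eq_inv_mulVec hfix).symm
  have hvx' : mink v' (cylP (r, 0)) = 0 := by rw [hv', hk.mink_inv_mulVec, hfix, hvx]
  have hin' : 0 < cosh r * v' 2 - sinh r * v' 0 := by
    rw [← hvn, hv', hk.mink_inv_mulVec, hv, hadd, hknkn, mink_comm]; linarith
  have hsx : sec (cylP (r, 0)) = (r, 0) := sec_cylP hr (by simp [pi_pos]) (by simp [pi_pos])
  have hx2 : 0 < cylP (r, 0) 2 := by simp [cylP, cyl, hr]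
  have hpos : ∀ v : Fin 4 → ℝ, ∀ᶠ t in 𝓝 0, 0 < inwardCurve (cylP (r, 0)) v t 2 := fun v =>
    ((continuous_apply 2).continuousAt.tendsto.comp (tendsto_inwardCurve _ v)).eventually
      (Ioi_mem_nhds hx2)
  have hsec : ∀ v : Fin 4 → ℝ, Tendsto (fun t => sec (inwardCurve (cylP (r, 0)) v t)) (𝓝 0)
      (𝓝 (r, 0)) := fun v => by
    have := (continuousAt_sec hx2).tendsto.comp (tendsto_inwardCurve _ v)
    rwa [hsx] at this
  have hpair : Tendsto (fun t => (sec (inwardCurve (cylP (r, 0)) v t),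
      sec (inwardCurve (cylP (r, 0)) v' t))) (𝓝[>] 0) (𝓝 ((r, 0), (r, 0))) := by
    rw [nhds_prod_eq]
    exact ((hsec v).prodMk (hsec v')).mono_left nhdsWithin_le_nhds
  have e4 := (hpos v).filter_mono (nhdsWithin_le_nhds (s := Ioi 0))
  have e5 := (hpos v').filter_mono (nhdsWithin_le_nhds (s := Ioi 0))
  have e6 := (inwardCurve_mem (cylP_mem _) hvx).filter_mono (nhdsWithin_le_nhds (s := Ioi 0))
  have e7 := (inwardCurve_mem (cylP_mem _) hvx').filter_mono (nhdsWithin_le_nhds (s := Ioi 0))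
  obtain ⟨t, h1, h2, h3, h4, h5, h6, h7⟩ := ((hpair.eventually H).and
    ((sec_inwardCurve_lt hr hvx hin).and ((sec_inwardCurve_lt hr hvx' hin').and
    (e4.and (e5.and (e6.and e7)))))).exists
  apply h1 h2 h3
  simp only
  rw [cylP_sec h6 h4, cylP_sec h7 h5, mulVec_inwardCurve hk, hfix, hv', hk.mulVec_inv]

lemma isClosed_coe_of_discrete (Γ : Submodule ℤ Plane) [DiscreteTopology Γ] :
    IsClosed (Γ : Set Plane) :=
  have : DiscreteTopology Γ.toAddSubgroup := inferInstanceAs (DiscreteTopology Γ)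
  AddSubgroup.isClosed_of_discrete (H := Γ.toAddSubgroup)

/-- An isometry which fixes the point `cylP (r, 0)` and reverses the normal there is determined on
the plane spanned by the two vectors. -/
lemma isomInv_mulVec_coords {k : Matrix (Fin 4) (Fin 4) ℝ} (hk : IsIsom k) {r : ℝ}
    (hfix : k *ᵥ cylP (r, 0) = cylP (r, 0))
    (hn : k *ᵥ ![sinh r, 0, cosh r, 0] = -![sinh r, 0, cosh r, 0]) (y : Fin 4 → ℝ) :
    (isomInv k *ᵥ y) 0 = cosh (2 * r) * y 0 - sinh (2 * r) * y 2 ∧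
      (isomInv k *ᵥ y) 2 = sinh (2 * r) * y 0 - cosh (2 * r) * y 2 := by
  have h1 := hk.mink_inv_mulVec y (cylP (r, 0))
  have h2 := hk.mink_inv_mulVec y ![sinh r, 0, cosh r, 0]
  rw [hfix] at h1
  rw [hn] at h2
  simp [mink, cylP, cyl] at h1 h2
  have hcs := cosh_sq r
  rw [cosh_two_mul, sinh_two_mul]
  constructor
  · linear_combination cosh r * h1 - sinh r * h2 - (isomInv k *ᵥ y) 0 * hcs
  · linear_combination sinh r * h1 - cosh r * h2 - (isomInv k *ᵥ y) 2 * hcs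

end TubularHyp

namespace TubularManifold

open TubularHyp
open scoped Matrix

variable {M : Type*} [TopologicalSpace M] {ι : Type*} {X : TubularManifold M ι}
variable {p₀ : X.Filling} {i j : ι} {r s : ℝ} {w w' : ℝ × ℝ}

/-- The isometry `k` takes the standard tube of radius `r` to a tube of the same radius which
touches it at the point `cylP (r, 0)`, this point being fixed. In terms of the inverse of `k`, which
expresses points in the coordinates of the second tube, this determines two of the four
coordinates; the others depend on the angle between the axes. -/
structure IsTangency (r : ℝ) (k : Matrix (Fin 4) (Fin 4) ℝ) : Prop where
  isIsom : IsIsom k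
  inv_zero : ∀ y, (isomInv k *ᵥ y) 0 = cosh (2 * r) * y 0 - sinh (2 * r) * y 2
  inv_two : ∀ y, (isomInv k *ᵥ y) 2 = sinh (2 * r) * y 0 - cosh (2 * r) * y 2

lemma IsTangency.mulVec_zero {k : Matrix (Fin 4) (Fin 4) ℝ} (hk : IsTangency r k)
    (z : ℝ × ℝ × ℝ) : (isomInv k *ᵥ cylP z) 0 = mink (cylP z) (cylP (2 * r, 0)) := by
  rw [hk.inv_zero]
  simp [mink, cylP, cyl]
  ring

/-- Where the standard tube of radius `2r` meets the ball of radius `r` about the nearest point of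
the axis of the second tube, the cylindrical coordinates of the second tube are defined, with
distance less than `r` from the axis. -/
lemma IsTangency.of_mem_nearRay {k : Matrix (Fin 4) (Fin 4) ℝ} (hk : IsTangency r k) (hr : 0 < r)
    {z : ℝ × ℝ × ℝ} (hz : z ∈ nearRay (Ioo 0 (2 * r)) (2 * r) (cosh r)) :
    0 < (isomInv k *ᵥ cylP z) 2 ∧ (sec (isomInv k *ᵥ cylP z)).1 ∈ Ioo 0 r := by
  obtain ⟨⟨hz1, hz2⟩, hz3, hz4⟩ := hz
  have hy0 := hk.mulVec_zero z
  have hy2 := hk.inv_two (cylP z)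
  have hyH := hk.isIsom.inv.mulVec_mem (cylP_mem z)
  set y := isomInv k *ᵥ cylP z
  have h2 : 0 < y 2 := by
    have hS : 0 < sinh (2 * r) := sinh_pos_iff.mpr (by linarith)
    have hs : 0 < sinh z.1 := sinh_pos_iff.mpr hz1
    have h1 : 0 < sinh (2 * r - z.1) := sinh_pos_iff.mpr (by linarith)
    rw [sinh_sub] at h1
    have e1 : sinh (2 * r) * cosh z.1 * 1 ≤ sinh (2 * r) * cosh z.1 * cosh z.2.2 := by
      gcongr; exact one_le_cosh _
    have e2 : cosh (2 * r) * sinh z.1 * cos z.2.1 ≤ cosh (2 * r) * sinh z.1 * 1 := by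
      gcongr; exact cos_le_one _
    rw [hy2]
    simp only [cylP, cyl, Matrix.cons_val]
    linarith
  refine ⟨h2, sec_fst_pos h2, ?_⟩
  have h3 : cosh (sec y).1 < cosh r := by
    rw [cosh_sec_fst, sqrt_lt' (cosh_pos r)]
    have h4 : y 0 < cosh r := by rw [hy0]; exact hz4
    have := hyH.2
    have := hyH.1
    nlinarith [sq_nonneg (y 1)]
  rw [cosh_lt_cosh, abs_of_pos (sec_fst_pos h2), abs_of_pos hr] at h3
  exact h3

variable [T2Space M]

/-- At a touching point of two tubes, the development of the second tube in the coordinates of the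
first one is the standard tangent tube. -/
lemma EmbTo.exists_isTangency (hE : X.EmbTo p₀ r) (hr : 0 < r) (hi : (r, w) ∈ X.tubeDom p₀ i)
    (hj : (r, w') ∈ X.tubeDom p₀ j) (heq : X.tube p₀ i (r, w) = X.tube p₀ j (r, w'))
    (hne : ¬ (i = j ∧ vis (X.radius i) (w - w') ∈ X.lattice i)) :
    ∃ k, IsTangency r k ∧ (fun z => X.tube p₀ i (z.1, w + z.2)) =ᶠ[𝓝 (r, 0)]
      fun z => X.tube p₀ j ((sec (isomInv k *ᵥ cylP z)).1,
        w' + (sec (isomInv k *ᵥ cylP z)).2) := by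
  have hA : (X.atlas p₀).LocIso (fun z => X.tube p₀ i (z.1, w + z.2)) (r, 0) :=
    HypAtlas.LocIso.screw w (tube_locIso (by simpa using hi))
  have hB : (X.atlas p₀).LocIso (fun z => X.tube p₀ j (z.1, w' + z.2)) (r, 0) :=
    HypAtlas.LocIso.screw w' (tube_locIso (by simpa using hj))
  obtain ⟨k, hk, hfix, V₁, hV₁, V₂, hV₂, H⟩ := hA.exists_isom hB (by simpa using heq)
  have hpos : ∀ᶠ p : (ℝ × ℝ × ℝ) × (ℝ × ℝ × ℝ) in 𝓝 ((r, 0), (r, 0)), 0 < p.1.1 ∧ 0 < p.2.1 :=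
    (ContinuousAt.eventually_lt continuousAt_const (by fun_prop) hr).and
      (ContinuousAt.eventually_lt continuousAt_const (by fun_prop) hr)
  have hlat : ∀ᶠ p : (ℝ × ℝ × ℝ) × (ℝ × ℝ × ℝ) in 𝓝 ((r, 0), (r, 0)),
      ¬ (i = j ∧ vis (X.radius i) (w + p.1.2 - (w' + p.2.2)) ∈ X.lattice i) := by
    by_cases hij : i = j
    · have hc : Continuous fun p : (ℝ × ℝ × ℝ) × (ℝ × ℝ × ℝ) =>
          vis (X.radius i) (w + p.1.2 - (w' + p.2.2)) :=
        (continuous_vis _).comp (by fun_prop)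
      have ho : IsOpen {p : (ℝ × ℝ × ℝ) × (ℝ × ℝ × ℝ) |
          vis (X.radius i) (w + p.1.2 - (w' + p.2.2)) ∈ X.lattice i}ᶜ :=
        ((isClosed_coe_of_discrete (X.lattice i)).preimage hc).isOpen_compl
      have hmem : ((r, 0), (r, 0)) ∈ {p : (ℝ × ℝ × ℝ) × (ℝ × ℝ × ℝ) |
          vis (X.radius i) (w + p.1.2 - (w' + p.2.2)) ∈ X.lattice i}ᶜ := by
        intro h
        exact hne ⟨hij, by simpa using h⟩
      filter_upwards [ho.mem_nhds hmem] with p hp h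
      exact hp h.2
    · exact Eventually.of_forall fun p h => hij h.1
  have hnormal := mulVec_normal_eq_neg hk hr hfix.symm (by
    filter_upwards [prod_mem_nhds hV₁ hV₂, hpos, hlat] with p hp1 hp2 hp3 h1 h2 h
    have := hE.inj i j _ ⟨hp2.1, h1⟩ _ ⟨hp2.2, h2⟩ _ _ ((H _ hp1.1 _ hp1.2).mpr h)
    exact hp3 ⟨this.1, this.2.2⟩)
  have hcoord := isomInv_mulVec_coords hk hfix.symm hnormal
  refine ⟨k, ⟨hk, fun y => (hcoord y).1, fun y => (hcoord y).2⟩, ?_⟩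
  have hfix' : isomInv k *ᵥ cylP (r, 0) = cylP (r, 0) := (hk.eq_inv_mulVec hfix.symm).symm
  have hx2 : 0 < cylP (r, 0) 2 := by simp [cylP, cyl, hr]
  have hc : Tendsto (fun z => isomInv k *ᵥ cylP z) (𝓝 (r, 0)) (𝓝 (cylP (r, 0))) := by
    have := ((continuous_mulVec (isomInv k)).comp continuous_cylP).tendsto (r, 0)
    rwa [Function.comp, hfix'] at this
  have hsec : Tendsto (fun z => sec (isomInv k *ᵥ cylP z)) (𝓝 (r, 0)) (𝓝 (r, 0)) := by
    have := (continuousAt_sec hx2).tendsto.comp hc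
    rwa [sec_cylP hr (by simp [pi_pos]) (by simp [pi_pos])] at this
  have h2 : ∀ᶠ z in 𝓝 (r, 0), 0 < (isomInv k *ᵥ cylP z) 2 :=
    ((continuous_apply 2).continuousAt.tendsto.comp hc).eventually (Ioi_mem_nhds hx2)
  filter_upwards [hV₁, hsec.eventually hV₂, h2] with z hz1 hz2 hz3
  refine (H z hz1 _ hz2).mpr ?_
  rw [cylP_sec (hk.inv.mulVec_mem (cylP_mem z)) hz3, hk.mulVec_inv]

/-- The part of the tube of radius `2r` which lies, in the development, within the distance `r`
of the core of a touching tube, is mapped to this tube. -/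
lemma EmbTo.tube_eq_near (hE : X.EmbTo p₀ r) (hr : 0 < r)
    (hdom : ∀ s ∈ Ioo 0 (2 * r), ∀ w, (s, w) ∈ X.tubeDom p₀ i)
    {k : Matrix (Fin 4) (Fin 4) ℝ} (hk : IsTangency r k)
    (hgerm : (fun z => X.tube p₀ i (z.1, w + z.2)) =ᶠ[𝓝 (r, 0)]
      fun z => X.tube p₀ j ((sec (isomInv k *ᵥ cylP z)).1,
        w' + (sec (isomInv k *ᵥ cylP z)).2)) :
    ∀ z ∈ nearRay (Ioo 0 (2 * r)) (2 * r) (cosh r),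
      (fun z => X.tube p₀ i (z.1, w + z.2)) =ᶠ[𝓝 z]
      fun z => X.tube p₀ j ((sec (isomInv k *ᵥ cylP z)).1,
        w' + (sec (isomInv k *ᵥ cylP z)).2) := by
  have h1 : ∀ᶠ s in 𝓝[>] r, (fun z => X.tube p₀ i (z.1, w + z.2)) =ᶠ[𝓝 (s, 0)]
      fun z => X.tube p₀ j ((sec (isomInv k *ᵥ cylP z)).1,
        w' + (sec (isomInv k *ᵥ cylP z)).2) := by
    have hc : Tendsto (fun s : ℝ => ((s, 0) : ℝ × ℝ × ℝ)) (𝓝[>] r) (𝓝 (r, 0)) :=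
      ((continuous_id.prodMk continuous_const).tendsto r).mono_left nhdsWithin_le_nhds
    exact hc.eventually hgerm.eventually_nhds
  obtain ⟨s, hs1, hs2⟩ := (h1.and (Ioo_mem_nhdsGT (show r < 2 * r by linarith))).exists
  have hcont : Continuous fun z => isomInv k *ᵥ cylP z :=
    (continuous_mulVec _).comp continuous_cylP
  refine HypAtlas.eventuallyEq_of_isPreconnected (𝒜 := X.atlas p₀) (z₀ := (s, 0))
    (isPreconnected_nearRay ordConnected_Ioo (fun t ht => ht.1) (by linarith)) ?_ ?_ ?_ hs1
  · intro z hz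
    exact HypAtlas.LocIso.screw w (tube_locIso (hdom _ hz.1 _))
  · intro z hz
    obtain ⟨h2, h3⟩ := hk.of_mem_nearRay hr hz
    refine HypAtlas.LocIso.comp (A := fun z => X.tube p₀ j (z.1, w' + z.2))
      (τ := fun z => sec (isomInv k *ᵥ cylP z)) (h := isomInv k) ?_ ?_ hk.isIsom.inv ?_
    · exact HypAtlas.LocIso.screw w' (tube_locIso (hE.dom j _ h3 _))
    · exact ContinuousAt.comp (g := sec) (continuousAt_sec h2) hcont.continuousAt
    · have h4 : ∀ᶠ z' in 𝓝 z, 0 < (isomInv k *ᵥ cylP z') 2 :=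
        ContinuousAt.eventually_lt continuousAt_const
          ((continuous_apply 2).comp hcont).continuousAt h2
      filter_upwards [h4] with z' hz'
      exact cylP_sec (hk.isIsom.inv.mulVec_mem (cylP_mem z')) hz'
  · refine mk_mem_nearRay.mpr ⟨⟨hr.trans hs2.1, hs2.2⟩, ?_⟩
    rw [cosh_lt_cosh, abs_of_nonpos (by linarith [hs2.2]), abs_of_pos hr]
    linarith [hs2.1]

end TubularManifold

namespace TubularHyp

/-- The midpoint of the points at distance `2r` on two rays normal to the axis: if these points
have distance less than `2r`, then the midpoint has distance less than `r` from both of them. It is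
described in coordinates relative to either ray; `hlt` bounds the hyperbolic cosine of the distance
of the two points. -/
lemma exists_midpoint {r : ℝ} (hr : 0 < r) {Δ : ℝ × ℝ} (hΔ : Δ ≠ 0) (hθ : |Δ.1| < π / 2)
    (hlt : cosh (2 * r) ^ 2 * cosh Δ.2 - sinh (2 * r) ^ 2 * cos Δ.1 < cosh (2 * r)) :
    ∃ ρ, (ρ, (1 / 2 : ℝ) • Δ) ∈ nearRay (Ioo 0 (2 * r)) (2 * r) (cosh r) ∧
      (ρ, -(1 / 2 : ℝ) • Δ) ∈ nearRay (Ioo 0 (2 * r)) (2 * r) (cosh r) := by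
  obtain ⟨θ, ζ⟩ := Δ
  simp only at hθ hlt
  have hπ := pi_pos
  obtain ⟨hθ1, hθ2⟩ := abs_lt.mp hθ
  set c := cos (θ / 2) with hc
  set d := cosh (ζ / 2) with hd
  have hc0 : 0 < c := cos_pos_of_mem_Ioo ⟨by linarith, by linarith⟩
  have hd0 : 0 < d := cosh_pos _
  have hd1 : 1 ≤ d := one_le_cosh _
  have hc1 : c ≤ 1 := cos_le_one _
  have hcd : c < d := by
    refine lt_of_le_of_ne (hc1.trans hd1) fun h => hΔ ?_
    have e1 : c = 1 := by linarith
    have e2 : d = 1 := by linarith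
    have e3 : θ / 2 = 0 :=
      (cos_eq_one_iff_of_lt_of_lt (by linarith) (by linarith)).mp e1
    have e4 : ζ / 2 = 0 := by
      by_contra h0
      exact (one_lt_cosh.mpr h0).ne' e2
    rw [Prod.mk_eq_zero]
    constructor <;> linarith
  have hcosθ : cos θ = 2 * c ^ 2 - 1 := by rw [hc, ← cos_two_mul]; ring_nf
  have hcoshζ : cosh ζ = 2 * d ^ 2 - 1 := by
    have h1 := cosh_two_mul (ζ / 2)
    have h2 := cosh_sq (ζ / 2)
    rw [show 2 * (ζ / 2) = ζ by ring] at h1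
    rw [h1, hd]; linarith
  have hC := cosh_pos (2 * r)
  have hS : 0 < sinh (2 * r) := sinh_pos_iff.mpr (by linarith)
  have hCS := cosh_sq (2 * r)
  have h2r : cosh (2 * r) = 2 * cosh r ^ 2 - 1 := by
    have h1 := cosh_two_mul r
    have h2 := cosh_sq r
    linarith
  set C := cosh (2 * r)
  set S := sinh (2 * r)
  have hcc : c ^ 2 < d ^ 2 := by nlinarith
  set E := C ^ 2 * d ^ 2 - S ^ 2 * c ^ 2 with hE
  have hEc : c ^ 2 < E := by rw [hE, hCS]; nlinarith
  have hE0 : 0 < E := lt_of_le_of_lt (sq_nonneg c) hEc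
  have hErr : E < cosh r ^ 2 := by
    rw [hcosθ, hcoshζ] at hlt
    rw [hE]
    nlinarith
  have hD0 : 0 < √E := sqrt_pos.mpr hE0
  have hDsq := sq_sqrt hE0.le
  have hcD : c < √E := lt_sqrt_of_sq_lt hEc
  have hsinh : sinh (arsinh (S * c / √E)) = S * c / √E := sinh_arsinh _
  have hcosh : cosh (arsinh (S * c / √E)) = C * d / √E := by
    rw [cosh_arsinh, sqrt_eq_iff_mul_self_eq (by positivity) (by positivity)]
    field_simp
    rw [hDsq, hE]
    ring
  have hρ0 : 0 < arsinh (S * c / √E) := arsinh_pos_iff.mpr (by positivity)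
  have hρ2 : arsinh (S * c / √E) < 2 * r := by
    rw [← arsinh_sinh (2 * r), arsinh_lt_arsinh, div_lt_iff₀ hD0]
    exact mul_lt_mul_of_pos_left hcD hS
  have hdist : C * d / √E * C * d - S * c / √E * S * c < cosh r := by
    have : C * d / √E * C * d - S * c / √E * S * c = √E := by
      field_simp
      rw [hDsq, hE]
    rw [this, sqrt_lt' (cosh_pos r)]
    exact hErr
  have e1 : (1 / 2 : ℝ) • ((θ, ζ) : ℝ × ℝ) = (θ / 2, ζ / 2) := by
    ext <;> simp <;> ring
  have e2 : -(1 / 2 : ℝ) • ((θ, ζ) : ℝ × ℝ) = (-(θ / 2), -(ζ / 2)) := by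
    ext <;> simp <;> ring
  refine ⟨arsinh (S * c / √E), ?_, ?_⟩
  · rw [e1]
    refine ⟨⟨hρ0, hρ2⟩, ⟨by simp only; linarith, by simp only; linarith⟩, ?_⟩
    rw [mink_cylP_ray]
    simp only [hsinh, hcosh]
    exact hdist
  · rw [e2]
    refine ⟨⟨hρ0, hρ2⟩, ⟨by simp only; linarith, by simp only; linarith⟩, ?_⟩
    rw [mink_cylP_ray]
    simp only [hsinh, hcosh, cosh_neg, cos_neg]
    exact hdist

end TubularHyp

namespace TubularManifold

open TubularHyp
open scoped Matrix

variable {M : Type*} [TopologicalSpace M] {ι : Type*} {X : TubularManifold M ι}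
variable {p₀ : X.Filling} {i : ι} {r : ℝ} [T2Space M]

/-- Two points at which the tube about the end `i` touches tubes of the same radius `r` have
distance at least `2r` when they are pushed out to the cores of these tubes: otherwise, the
midpoint would belong to both tubes, which would have the same core, orthogonal to the ray
through either point. -/
lemma EmbTo.touching_separated [CompactSpace M] [Finite ι] (hE : X.EmbTo p₀ r) (hr : 0 < r)
    {j₁ j₂ : ι} {w₁ w₂ w₁' w₂' : ℝ × ℝ}
    (heq₁ : X.tube p₀ i (r, w₁) = X.tube p₀ j₁ (r, w₁'))
    (hne₁ : ¬ (i = j₁ ∧ vis (X.radius i) (w₁ - w₁') ∈ X.lattice i))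
    (heq₂ : X.tube p₀ i (r, w₂) = X.tube p₀ j₂ (r, w₂'))
    (hne₂ : ¬ (i = j₂ ∧ vis (X.radius i) (w₂ - w₂') ∈ X.lattice i))
    (hne : w₂ - w₁ ≠ 0) (hθ : |(w₂ - w₁).1| < π / 2) :
    cosh (2 * r) ≤
      cosh (2 * r) ^ 2 * cosh (w₂ - w₁).2 - sinh (2 * r) ^ 2 * cos (w₂ - w₁).1 := by
  by_contra! hlt
  have hdom : ∀ k, ∀ a ∈ Ioo 0 (2 * r), ∀ v, (a, v) ∈ X.tubeDom p₀ k :=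
    fun k a ha v => hE.mem_tubeDom hr ha
  have hrd : r ∈ Ioo 0 (2 * r) := ⟨hr, by linarith⟩
  obtain ⟨k₁, hk₁, hg₁⟩ := hE.exists_isTangency hr (hdom _ _ hrd _) (hdom _ _ hrd _) heq₁ hne₁
  obtain ⟨k₂, hk₂, hg₂⟩ := hE.exists_isTangency hr (hdom _ _ hrd _) (hdom _ _ hrd _) heq₂ hne₂
  obtain ⟨ρ, hz₁, hz₂⟩ := exists_midpoint hr hne hθ hlt
  set Δ := w₂ - w₁ with hΔ
  have hn₁ := hE.tube_eq_near hr (hdom i) hk₁ hg₁ _ hz₁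
  have hn₂ := hE.tube_eq_near hr (hdom i) hk₂ hg₂ _ hz₂
  obtain ⟨hp₁, hs₁⟩ := hk₁.of_mem_nearRay hr hz₁
  obtain ⟨hp₂, hs₂⟩ := hk₂.of_mem_nearRay hr hz₂
  set z₁ : ℝ × ℝ × ℝ := (ρ, (1 / 2 : ℝ) • Δ) with hz₁def
  set z₂ : ℝ × ℝ × ℝ := (ρ, -(1 / 2 : ℝ) • Δ) with hz₂def
  let τ₁ : ℝ × ℝ × ℝ → ℝ × ℝ × ℝ := fun z => sec (isomInv k₁ *ᵥ cylP z)
  let τ₂ : ℝ × ℝ × ℝ → ℝ × ℝ × ℝ := fun z => sec (isomInv k₂ *ᵥ cylP z)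
  let sh : ℝ × ℝ × ℝ → ℝ × ℝ × ℝ := fun z => (z.1, -Δ + z.2)
  have hsh : sh z₁ = z₂ := by
    simp only [sh, hz₁def, hz₂def, Prod.mk.injEq, true_and]
    module
  have hshA : ∀ z : ℝ × ℝ × ℝ, ((sh z).1, w₂ + (sh z).2) = (z.1, w₁ + z.2) := by
    intro z
    simp only [sh, hΔ, Prod.mk.injEq, true_and]
    abel
  have hct : ∀ k : Matrix (Fin 4) (Fin 4) ℝ, Continuous fun z => isomInv k *ᵥ cylP z :=
    fun k => (continuous_mulVec _).comp continuous_cylP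
  have cτ₁ : ContinuousAt τ₁ z₁ :=
    ContinuousAt.comp (g := sec) (continuousAt_sec hp₁) (hct k₁).continuousAt
  have csh : Tendsto sh (𝓝 z₁) (𝓝 z₂) := by
    have : Continuous sh := by fun_prop
    rw [← hsh]; exact this.tendsto z₁
  have cτ₂' : ContinuousAt τ₂ z₂ :=
    ContinuousAt.comp (g := sec) (continuousAt_sec hp₂) (hct k₂).continuousAt
  have cτ₂ : Tendsto (τ₂ ∘ sh) (𝓝 z₁) (𝓝 (τ₂ z₂)) := cτ₂'.tendsto.comp csh
  -- near the midpoint the two descriptions in terms of the touching tubes agree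
  have hag : ∀ᶠ z in 𝓝 z₁, X.tube p₀ j₁ ((τ₁ z).1, w₁' + (τ₁ z).2) =
      X.tube p₀ j₂ ((τ₂ (sh z)).1, w₂' + (τ₂ (sh z)).2) := by
    filter_upwards [hn₁, csh.eventually hn₂] with z h1 h2
    rw [← h1, ← h2, hshA]
  have hag₀ := hag.self_of_nhds
  rw [hsh] at hag₀
  obtain ⟨rfl, hτ, hlat⟩ := hE.inj _ _ _ hs₁ _ hs₂ _ _ hag₀
  set δ := w₁' + (τ₁ z₁).2 - (w₂' + (τ₂ z₂).2) with hδ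
  obtain ⟨V, hV, hVinj⟩ := (tube_locIso (hE.dom j₁ _ hs₁ (w₁' + (τ₁ z₁).2))).eventually_injective
    hs₁.1
  have hlim₁ : Tendsto (fun z => ((τ₁ z).1, w₁' + (τ₁ z).2)) (𝓝 z₁)
      (𝓝 ((τ₁ z₁).1, w₁' + (τ₁ z₁).2)) :=
    (cτ₁.fst.prodMk (continuousAt_const.add cτ₁.snd)).tendsto
  have hlim₂ : Tendsto (fun z => ((τ₂ (sh z)).1, δ + (w₂' + (τ₂ (sh z)).2))) (𝓝 z₁)
      (𝓝 ((τ₁ z₁).1, w₁' + (τ₁ z₁).2)) := by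
    have h1 : Continuous fun z : ℝ × ℝ × ℝ => (z.1, δ + (w₂' + z.2)) := by fun_prop
    have h2 := (h1.tendsto (τ₂ z₂)).comp cτ₂
    have h3 : ((τ₂ z₂).1, δ + (w₂' + (τ₂ z₂).2)) = ((τ₁ z₁).1, w₁' + (τ₁ z₁).2) := by
      rw [hδ, sub_add_cancel, Prod.mk.injEq]
      exact ⟨hτ.symm, rfl⟩
    rw [← h3]
    exact h2
  have hsmall : ∀ᶠ z in 𝓝 z₁, (τ₂ (sh z)).1 ∈ Ioo 0 r :=
    ((continuous_fst.tendsto _).comp cτ₂).eventually (Ioo_mem_nhds hs₂.1 hs₂.2)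
  have hpos₁ : ∀ᶠ z in 𝓝 z₁, 0 < (isomInv k₁ *ᵥ cylP z) 2 :=
    ContinuousAt.eventually_lt continuousAt_const
      ((continuous_apply 2).comp (hct k₁)).continuousAt hp₁
  have hpos₂ : ∀ᶠ z in 𝓝 z₁, 0 < (isomInv k₂ *ᵥ cylP (sh z)) 2 :=
    (((continuous_apply 2).comp (hct k₂)).continuousAt.tendsto.comp csh).eventually
      (Ioi_mem_nhds hp₂)
  -- therefore the developments of the touching tubes agree up to a deck transformation
  have hmat : screw w₁' * isomInv k₁ = screw (δ + w₂') * (isomInv k₂ * screw (-Δ)) := by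
    refine matrix_eq_of_eventually (z := z₁) ?_
    filter_upwards [hag, hlim₁.eventually hV, hlim₂.eventually hV, hsmall, hpos₁, hpos₂]
      with z h1 h2 h3 h4 h5 h6
    have h7 := (tube_lattice (p₀ := p₀) (s := (τ₂ (sh z)).1) (w := w₂' + (τ₂ (sh z)).2) hlat
      (hE.dom _ _ h4 _)).2
    have h8 := hVinj h2 h3 (by rw [h1, h7])
    have h9 := congrArg cylP h8
    rw [← add_assoc, ← screw_cylP, ← screw_cylP,
      cylP_sec (hk₁.isIsom.inv.mulVec_mem (cylP_mem z)) h5,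
      cylP_sec (hk₂.isIsom.inv.mulVec_mem (cylP_mem _)) h6] at h9
    rw [← Matrix.mulVec_mulVec, h9, ← Matrix.mulVec_mulVec, ← Matrix.mulVec_mulVec, screw_cylP]
  -- compare the images of the point at distance `2r` on the second ray
  have happ := congrArg (· *ᵥ cylP (2 * r, Δ)) hmat
  simp only [← Matrix.mulVec_mulVec] at happ
  rw [screw_cylP, neg_add_cancel] at happ
  -- it lies on the core of the touching tube, hence so does its image for the first tangency, and
  -- this forces the two rays to coincide
  have hCS := cosh_sq (2 * r)
  have hy0 := hk₂.inv_zero (cylP (2 * r, 0))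
  have hy2 := hk₂.inv_two (cylP (2 * r, 0))
  have hyH := (hk₂.isIsom.inv.mulVec_mem (cylP_mem (2 * r, 0))).2
  have hx2 := hk₁.inv_two (cylP (2 * r, Δ))
  set y := isomInv k₂ *ᵥ cylP (2 * r, 0)
  set x := isomInv k₁ *ᵥ cylP (2 * r, Δ)
  simp [cylP, cyl] at hy0 hy2 hx2
  have hy0' : y 0 = 1 := by rw [hy0]; linarith
  have hy2' : y 2 = 0 := by rw [hy2]; ring
  have hy3 : y 3 = 0 := by
    rw [hy0', hy2'] at hyH
    exact pow_eq_zero_iff two_ne_zero |>.mp (by nlinarith [sq_nonneg (y 1), sq_nonneg (y 3)])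
  have happ2 := congrFun happ 2
  have happ3 := congrFun happ 3
  simp [screw_mulVec, hy2', hy3] at happ2 happ3
  have hx2' : x 2 = 0 := by
    linear_combination cos w₁'.1 * happ2 + sin w₁'.1 * happ3 - x 2 * sin_sq_add_cos_sq w₁'.1
  have hS : 0 < sinh (2 * r) := sinh_pos_iff.mpr (by linarith)
  have hC := cosh_pos (2 * r)
  have hcc : cosh Δ.2 = cos Δ.1 := by
    rw [hx2'] at hx2
    have : sinh (2 * r) * cosh (2 * r) * (cosh Δ.2 - cos Δ.1) = 0 := by linarith
    have := (mul_eq_zero.mp this).resolve_left (by positivity)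
    linarith
  have h1 := one_le_cosh Δ.2
  have h2 := cos_le_one Δ.1
  have h3 : Δ.2 = 0 := by
    by_contra h0
    linarith [one_lt_cosh.mpr h0]
  have h4 : Δ.1 = 0 := by
    obtain ⟨a, b⟩ := abs_lt.mp hθ
    exact (cos_eq_one_iff_of_lt_of_lt (by linarith [pi_pos]) (by linarith [pi_pos])).mp
      (by linarith)
  exact hne (Prod.ext h4 h3)

end TubularManifold

namespace TubularHyp

/-! ### Packings by lattices in the plane -/

/-- Let `p`, `s` and `p + s - 2 q` be the squared lengths of the sides of a triangle, so that
`p a² + 2 q a b + s b²` is the squared length in coordinates along two of its sides. If all three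
vertices have distance at least `1` from some point `(a, b)` of the triangle, then the squared
circumradius, which is `p s (p + s - 2 q) / (4 D)`, is at least `1`. -/
lemma four_mul_disc_le_of_triangle {p q s a b : ℝ} (hD : 0 < p * s - q ^ 2)
    (hp : 0 < p) (ha : 0 ≤ a) (hb : 0 ≤ b) (hab : a + b ≤ 1)
    (h₀ : 1 ≤ a ^ 2 * p + 2 * a * b * q + b ^ 2 * s)
    (h₁ : 1 ≤ (a - 1) ^ 2 * p + 2 * (a - 1) * b * q + b ^ 2 * s)
    (h₂ : 1 ≤ a ^ 2 * p + 2 * a * (b - 1) * q + (b - 1) ^ 2 * s) :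
    4 * (p * s - q ^ 2) ≤ p * s * (p + s - 2 * q) := by
  set D := p * s - q ^ 2 with hDdef
  -- the barycentric mean of the squared distances
  have hW : 1 ≤ a * (1 - a) * p + b * (1 - b) * s - 2 * a * b * q := by
    have := mul_le_mul_of_nonneg_left h₀ (by linarith : 0 ≤ 1 - a - b)
    have := mul_le_mul_of_nonneg_left h₁ ha
    have := mul_le_mul_of_nonneg_left h₂ hb
    nlinarith
  set u := 2 * D * a - s * (p - q) with hu
  set w := 2 * D * b - p * (s - q) with hw
  have hform : 0 ≤ p * u ^ 2 + 2 * q * u * w + s * w ^ 2 := by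
    have : p * (p * u ^ 2 + 2 * q * u * w + s * w ^ 2) = (p * u + q * w) ^ 2 + D * w ^ 2 := by
      rw [hDdef]; ring
    have : 0 ≤ p * (p * u ^ 2 + 2 * q * u * w + s * w ^ 2) := by rw [this]; positivity
    exact nonneg_of_mul_nonneg_right this hp
  have hid : p * u ^ 2 + 2 * q * u * w + s * w ^ 2 = D * (p * s * (p + s - 2 * q) -
      4 * D * (a * (1 - a) * p + b * (1 - b) * s - 2 * a * b * q)) := by
    rw [hu, hw, hDdef]; ring
  rw [hid] at hform
  have := nonneg_of_mul_nonneg_right hform hD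
  nlinarith

/-- A triangle with sides in reduced position, no side shorter than `1` and circumradius at least
`1` has at least the area of the equilateral triangle of circumradius `1`. -/
lemma three_le_disc_of_circumradius {p q s : ℝ} (hp : 1 ≤ p) (hq : 0 ≤ q) (hqp : 2 * q ≤ p)
    (hps : p ≤ s) (h : 4 * (p * s - q ^ 2) ≤ p * s * (p + s - 2 * q)) :
    3 ≤ p * s - q ^ 2 := by
  set D := p * s - q ^ 2 with hDdef
  have hDp : p ^ 2 - q ^ 2 ≤ D := by nlinarith
  rcases le_or_gt 2 p with h2 | h2
  · nlinarith
  have hf : 0 ≤ D ^ 2 + D * (q ^ 2 + (p - q) ^ 2 - 4 * p) + q ^ 2 * (p - q) ^ 2 := by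
    have : p * (p * s * (p + s - 2 * q) - 4 * D) =
        D ^ 2 + D * (q ^ 2 + (p - q) ^ 2 - 4 * p) + q ^ 2 * (p - q) ^ 2 := by
      rw [hDdef]; ring
    rw [← this]
    exact mul_nonneg (by linarith) (by linarith)
  -- the quadratic polynomial in `D` on the left is negative at `p ^ 2 - q ^ 2`, and not positive
  -- at `3`
  by_contra! hD3
  have hf₀ : (p ^ 2 - q ^ 2) ^ 2 + (p ^ 2 - q ^ 2) * (q ^ 2 + (p - q) ^ 2 - 4 * p)
      + q ^ 2 * (p - q) ^ 2 < 0 := by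
    have : (p ^ 2 - q ^ 2) ^ 2 + (p ^ 2 - q ^ 2) * (q ^ 2 + (p - q) ^ 2 - 4 * p)
      + q ^ 2 * (p - q) ^ 2 = -(2 * p * (p - q) * (2 * (p + q) - p ^ 2)) := by ring
    rw [this, neg_lt_zero]
    refine mul_pos (mul_pos (by linarith) (by linarith)) (by nlinarith)
  have hf₃ : 3 ^ 2 + 3 * (q ^ 2 + (p - q) ^ 2 - 4 * p) + q ^ 2 * (p - q) ^ 2 ≤ 0 := by
    have hm₀ : 0 ≤ q * (p - q) := mul_nonneg hq (by linarith)
    have hm₁ : q * (p - q) ≤ 1 := by nlinarith [sq_nonneg (p - 2 * q)]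
    nlinarith
  nlinarith [mul_nonneg (mul_nonneg (sub_nonneg.mpr hD3.le) (sub_nonneg.mpr hDp))
    (by linarith : 0 ≤ 3 - (p ^ 2 - q ^ 2)), mul_pos (sub_pos.mpr hD3) (neg_pos.mpr hf₀),
    mul_nonneg (sub_nonneg.mpr hDp) (neg_nonneg.mpr hf₃),
    mul_nonneg hf (by linarith : 0 ≤ 3 - (p ^ 2 - q ^ 2))]

/-- If a lattice with reduced form `p a² + 2 q a b + s b²` has no nonzero vectors of length less
than `1` and leaves the open disc of radius `1` about some point free, then its discriminant is at
least that of the hexagonal lattice of covering radius `1`. -/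
lemma three_le_disc_of_hole {p q s a b : ℝ} (hp : 1 ≤ p) (hq : 0 ≤ q) (hqp : 2 * q ≤ p)
    (hps : p ≤ s)
    (h : ∀ m n : ℤ, 1 ≤ (a - m) ^ 2 * p + 2 * (a - m) * (b - n) * q + (b - n) ^ 2 * s) :
    3 ≤ p * s - q ^ 2 := by
  have hD : 0 < p * s - q ^ 2 := by nlinarith
  refine three_le_disc_of_circumradius hp hq hqp hps ?_
  have h00 := h ⌊a⌋ ⌊b⌋
  have h10 := h (⌊a⌋ + 1) ⌊b⌋
  have h01 := h ⌊a⌋ (⌊b⌋ + 1)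
  have h11 := h (⌊a⌋ + 1) (⌊b⌋ + 1)
  push_cast at h10 h01 h11
  have ha0 := Int.floor_le a
  have hb0 := Int.floor_le b
  have ha1 := Int.lt_floor_add_one a
  have hb1 := Int.lt_floor_add_one b
  -- the point lies in one of the two triangles into which a diagonal divides the parallelogram
  rcases le_or_gt ((a - ⌊a⌋) + (b - ⌊b⌋)) 1 with hab | hab
  · refine four_mul_disc_le_of_triangle (a := a - ⌊a⌋) (b := b - ⌊b⌋) hD (by linarith)
      (by linarith) (by linarith) hab h00 ?_ ?_
    · linarith
    · linarith
  · refine four_mul_disc_le_of_triangle (a := ⌊a⌋ + 1 - a) (b := ⌊b⌋ + 1 - b) hD (by linarith)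
      (by linarith) (by linarith) (by linarith) ?_ ?_ ?_
    · linarith
    · linarith
    · linarith

/-- The positive definite form with orthogonal axes along the coordinate axes of the plane. -/
def axisForm (A B : ℝ) (v : Plane) : ℝ := A * v 0 ^ 2 + B * v 1 ^ 2

lemma finite_axisForm_le {A B : ℝ} (hA : 0 < A) (hB : 0 < B) (Γ : Submodule ℤ Plane)
    [DiscreteTopology Γ] (N : ℝ) : {x ∈ (Γ : Set Plane) | axisForm A B x ≤ N}.Finite := by
  have hb : Bornology.IsBounded {x : Plane | axisForm A B x ≤ N} := by
    refine isBounded_iff_forall_norm_le.mpr ⟨√(N / A + N / B), fun x hx => ?_⟩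
    rw [EuclideanSpace.norm_eq]
    refine sqrt_le_sqrt ?_
    simp only [Fin.sum_univ_two, norm_eq_abs, sq_abs]
    simp only [axisForm, mem_ofPred_eq] at hx
    refine add_le_add ?_ ?_
    · rw [le_div_iff₀ hA]; nlinarith [mul_nonneg hB.le (sq_nonneg (x 1))]
    · rw [le_div_iff₀ hB]; nlinarith [mul_nonneg hA.le (sq_nonneg (x 0))]
  refine (Metric.finite_isBounded_inter_isClosed (s := (Γ : Set Plane))
    ‹DiscreteTopology Γ›.isDiscrete hb (isClosed_coe_of_discrete Γ)).subset fun x hx => ⟨hx.2, hx.1⟩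

lemma exists_det_eq_covolume (Γ : Submodule ℤ Plane) [DiscreteTopology Γ] [IsZLattice ℝ Γ] :
    ∃ x ∈ Γ, ∃ y ∈ Γ, |x 0 * y 1 - x 1 * y 0| = ZLattice.covolume Γ := by
  have := ZLattice.module_free ℝ Γ
  have := ZLattice.module_finite ℝ Γ
  let b : Module.Basis (Fin 2) ℤ Γ := Module.finBasisOfFinrankEq ℤ Γ (by
    rw [ZLattice.rank ℝ Γ, finrank_euclideanSpace_fin])
  refine ⟨b 0, (b 0).2, b 1, (b 1).2, ?_⟩
  have h := ZLattice.covolume_eq_det_mul_measureReal Γ (μ := MeasureTheory.volume) b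
    (EuclideanSpace.basisFun (Fin 2) ℝ).toBasis
  rw [h, MeasureTheory.measureReal_def,
    MeasureTheory.measure_congr (ZSpan.fundamentalDomain_ae_parallelepiped _ _)]
  rw [OrthonormalBasis.coe_toBasis, OrthonormalBasis.volume_parallelepiped]
  rw [Module.Basis.det_apply, Matrix.det_fin_two]
  simp [Module.Basis.toMatrix_apply]
  ring_nf

/-- A lattice in the plane has a basis that is reduced with respect to a given form, namely one
that minimizes the sum of the squared lengths. -/
lemma exists_reduced_basis {A B : ℝ} (hA : 0 < A) (hB : 0 < B) (Γ : Submodule ℤ Plane)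
    [DiscreteTopology Γ] [IsZLattice ℝ Γ] :
    ∃ x ∈ Γ, ∃ y ∈ Γ, |x 0 * y 1 - x 1 * y 0| = ZLattice.covolume Γ ∧
      0 ≤ A * x 0 * y 0 + B * x 1 * y 1 ∧
      2 * (A * x 0 * y 0 + B * x 1 * y 1) ≤ axisForm A B x ∧
      axisForm A B x ≤ axisForm A B y := by
  obtain ⟨x₀, hx₀, y₀, hy₀, hd₀⟩ := exists_det_eq_covolume Γ
  have h0 : ∀ x, 0 ≤ axisForm A B x := fun x => by unfold axisForm; positivity
  let f : Plane × Plane → ℝ := fun z => axisForm A B z.1 + axisForm A B z.2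
  let S : Set (Plane × Plane) := {z | z.1 ∈ Γ ∧ z.2 ∈ Γ ∧
    |z.1 0 * z.2 1 - z.1 1 * z.2 0| = ZLattice.covolume Γ ∧ f z ≤ f (x₀, y₀)}
  have hS : S.Finite := by
    refine ((finite_axisForm_le hA hB Γ (f (x₀, y₀))).prod
      (finite_axisForm_le hA hB Γ (f (x₀, y₀)))).subset ?_
    rintro ⟨x, y⟩ ⟨hx, hy, -, hf⟩
    have := h0 x
    have := h0 y
    simp only [f] at hf
    exact ⟨⟨hx, by simp only [f]; linarith⟩, ⟨hy, by simp only [f]; linarith⟩⟩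
  obtain ⟨⟨x, y⟩, ⟨hx, hy, hd, hf⟩, hmin⟩ := Set.exists_min_image S f hS
    ⟨(x₀, y₀), hx₀, hy₀, hd₀, le_rfl⟩
  have hmin' : ∀ x' ∈ Γ, ∀ y' ∈ Γ, |x' 0 * y' 1 - x' 1 * y' 0| = ZLattice.covolume Γ →
      axisForm A B x + axisForm A B y ≤ axisForm A B x' + axisForm A B y' := by
    intro x' hx' y' hy' hd'
    by_cases hle : f (x', y') ≤ f (x₀, y₀)
    · exact hmin (x', y') ⟨hx', hy', hd', hle⟩
    · exact hf.trans (not_le.mp hle).le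
  set q := A * x 0 * y 0 + B * x 1 * y 1 with hq
  simp only at hd
  have e1 := hmin' x hx (y + x) (Γ.add_mem hy hx) (by rw [← hd]; simp; ring_nf)
  have e2 := hmin' x hx (y - x) (Γ.sub_mem hy hx) (by rw [← hd]; simp; ring_nf)
  have e3 := hmin' (x + y) (Γ.add_mem hx hy) y hy (by rw [← hd]; simp; ring_nf)
  have e4 := hmin' (x - y) (Γ.sub_mem hx hy) y hy (by rw [← hd]; simp; ring_nf)
  simp only [axisForm, PiLp.add_apply, PiLp.sub_apply] at e1 e2 e3 e4
  have b1 : 2 * |q| ≤ axisForm A B x := by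
    rw [← abs_two, ← abs_mul, abs_le, axisForm, hq]; constructor <;> nlinarith
  have b2 : 2 * |q| ≤ axisForm A B y := by
    rw [← abs_two, ← abs_mul, abs_le, axisForm, hq]; constructor <;> nlinarith
  have hneg : ∀ z, axisForm A B (-z) = axisForm A B z := fun z => by simp [axisForm]
  rcases le_total (axisForm A B x) (axisForm A B y) with hxy | hxy <;>
    rcases le_total 0 q with hq0 | hq0
  · rw [abs_of_nonneg hq0] at b1
    exact ⟨x, hx, y, hy, hd, hq0, b1, hxy⟩
  · rw [abs_of_nonpos hq0] at b1
    refine ⟨x, hx, -y, Γ.neg_mem hy, ?_, ?_, ?_, ?_⟩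
    · rw [← hd, ← abs_neg]; simp; ring_nf
    · simp; linarith
    · simp; linarith
    · rwa [hneg]
  · rw [abs_of_nonneg hq0] at b2
    refine ⟨y, hy, x, hx, ?_, ?_, ?_, hxy⟩
    · rw [← hd, ← abs_neg]; ring_nf
    · linarith
    · linarith
  · rw [abs_of_nonpos hq0] at b2
    refine ⟨y, hy, -x, Γ.neg_mem hx, ?_, ?_, ?_, ?_⟩
    · rw [← hd]; simp; ring_nf
    · simp; linarith
    · simp; linarith
    · rwa [hneg]

variable {A B : ℝ} {Γ : Submodule ℤ Plane} [DiscreteTopology Γ] [IsZLattice ℝ Γ]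

/-- The density bound for packings of the plane by translates of an ellipse along a lattice. -/
lemma sqrt_three_div_two_le_covolume (hA : 0 < A) (hB : 0 < B)
    (h : ∀ γ ∈ Γ, γ ≠ 0 → 1 ≤ axisForm A B γ) :
    √3 / 2 ≤ √(A * B) * ZLattice.covolume Γ := by
  obtain ⟨x, hx, y, hy, hd, hq, hqx, hxy⟩ := exists_reduced_basis hA hB Γ
  have hcov := ZLattice.covolume_pos Γ MeasureTheory.volume
  have hx0 : x ≠ 0 := by
    rintro rfl
    simp at hd
    linarith
  have hp := h x hx hx0
  rw [← hd]
  have h4 : √3 / 2 = √(3 / 4) := by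
    rw [sqrt_div (by norm_num), show (4 : ℝ) = 2 ^ 2 by norm_num, sqrt_sq (by norm_num)]
  rw [h4, ← sqrt_sq_eq_abs, ← sqrt_mul (by positivity)]
  refine sqrt_le_sqrt ?_
  set q := A * x 0 * y 0 + B * x 1 * y 1 with hqdef
  have : A * B * (x 0 * y 1 - x 1 * y 0) ^ 2 = axisForm A B x * axisForm A B y - q ^ 2 := by
    rw [hqdef, axisForm, axisForm]; ring
  rw [this]
  nlinarith

/-- The density bound for packings of the plane by two translates, under a lattice, of an
ellipse. -/
lemma sqrt_three_le_covolume (hA : 0 < A) (hB : 0 < B)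
    (h : ∀ γ ∈ Γ, γ ≠ 0 → 1 ≤ axisForm A B γ) {v : Plane}
    (hv : ∀ γ ∈ Γ, 1 ≤ axisForm A B (v + γ)) :
    √3 ≤ √(A * B) * ZLattice.covolume Γ := by
  obtain ⟨x, hx, y, hy, hd, hq, hqx, hxy⟩ := exists_reduced_basis hA hB Γ
  have hcov := ZLattice.covolume_pos Γ MeasureTheory.volume
  have hx0 : x ≠ 0 := by
    rintro rfl
    simp at hd
    linarith
  have hp := h x hx hx0
  rw [← hd]
  rw [← sqrt_sq_eq_abs, ← sqrt_mul (by positivity)]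
  refine sqrt_le_sqrt ?_
  set q := A * x 0 * y 0 + B * x 1 * y 1 with hqdef
  have : A * B * (x 0 * y 1 - x 1 * y 0) ^ 2 = axisForm A B x * axisForm A B y - q ^ 2 := by
    rw [hqdef, axisForm, axisForm]; ring
  rw [this]
  have hd0 : x 0 * y 1 - x 1 * y 0 ≠ 0 := by
    intro h0
    rw [h0, abs_zero] at hd
    linarith
  -- the coordinates of `v` with respect to the basis `x`, `y`
  set d := x 0 * y 1 - x 1 * y 0 with hddef
  set a := (v 0 * y 1 - v 1 * y 0) / d with ha
  set b := (x 0 * v 1 - x 1 * v 0) / d with hb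
  have hv0 : v 0 = a * x 0 + b * y 0 := by
    rw [ha, hb]; field_simp; rw [hddef]; ring
  have hv1 : v 1 = a * x 1 + b * y 1 := by
    rw [ha, hb]; field_simp; rw [hddef]; ring
  refine three_le_disc_of_hole (a := a) (b := b) hp hq hqx hxy fun m n => ?_
  refine (hv (-m • x + -n • y) (Γ.add_mem (Γ.smul_mem _ hx) (Γ.smul_mem _ hy))).trans_eq ?_
  simp [axisForm, hv0, hv1, hqdef]
  ring

/-! ### The separation of touching points -/

lemma convexOn_sinh : ConvexOn ℝ (Ici 0) sinh := by
  refine convexOn_of_deriv2_nonneg (convex_Ici 0) continuous_sinh.continuousOn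
    differentiable_sinh.differentiableOn ?_ fun x hx => ?_
  · rw [Real.deriv_sinh]
    exact differentiable_cosh.differentiableOn
  · rw [interior_Ici] at hx
    simp only [Function.iterate_succ, Function.iterate_zero, Function.comp, id, Real.deriv_sinh,
      Real.deriv_cosh]
    exact (sinh_pos_iff.mpr hx).le

/-- As `(cosh ζ - 1) / ζ²` increases with `|ζ|`, its value at `log 2` is a bound. -/
lemma cosh_sub_one_le {ζ : ℝ} (h : |ζ| ≤ log 2) : cosh ζ - 1 ≤ ζ ^ 2 / (4 * log 2 ^ 2) := by
  have hL : 0 < log 2 := log_pos (by norm_num)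
  rw [← cosh_abs, ← sq_abs]
  set t := |ζ| / log 2 with ht
  have ht0 : 0 ≤ t := by positivity
  have ht1 : t ≤ 1 := (div_le_one hL).mpr h
  have hb : 0 ≤ log 2 / 2 := by positivity
  have h1 := convexOn_sinh.2 (mem_Ici.mpr le_rfl) (mem_Ici.mpr hb) (sub_nonneg.mpr ht1) ht0
    (sub_add_cancel 1 t)
  simp only [smul_eq_mul, mul_zero, zero_add, sinh_zero] at h1
  have e1 : |ζ| = 2 * (t * (log 2 / 2)) := by rw [ht]; field_simp
  have e2 : cosh (2 * (log 2 / 2)) = 5 / 4 := by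
    rw [mul_div_cancel₀ _ two_ne_zero, cosh_log (by norm_num)]; norm_num
  have e3 : |ζ| ^ 2 / (4 * log 2 ^ 2) = t ^ 2 / 4 := by rw [ht]; field_simp
  rw [e3, e1]
  rw [cosh_two_mul, cosh_sq] at e2 ⊢
  have h2 : 0 ≤ sinh (t * (log 2 / 2)) := sinh_nonneg_iff.mpr (by positivity)
  have h3 := mul_self_le_mul_self h2 h1
  nlinarith

/-- The separation of touching points, in terms of a quadratic form in the differences `θ` of the
angles and `ζ` of the lengths. If `|θ| ≥ π / 2` or `|ζ| ≥ log 2`, then one term of the form alone is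
at least `1`, and for the remaining values the bounds of `cos` and `cosh` by quadratic polynomials
apply. -/
lemma one_le_form_of_separated {r θ ζ : ℝ} (hr : 0 < r)
    (h : |θ| < π / 2 → cosh (2 * r) ≤ cosh (2 * r) ^ 2 * cosh ζ - sinh (2 * r) ^ 2 * cos θ) :
    1 ≤ (cosh r * θ) ^ 2 + (cosh (2 * r) / (√8 * log 2 * sinh r) * ζ) ^ 2 := by
  have hL : 0 < log 2 := log_pos (by norm_num)
  have hS : 0 < sinh r := sinh_pos_iff.mpr hr
  have hC := one_le_cosh r
  have hc2 : cosh (2 * r) = 1 + 2 * sinh r ^ 2 := by rw [cosh_two_mul, cosh_sq]; ring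
  have hs2 : sinh (2 * r) ^ 2 = 4 * sinh r ^ 2 * cosh r ^ 2 := by rw [sinh_two_mul]; ring
  have hb : (cosh (2 * r) / (√8 * log 2 * sinh r) * ζ) ^ 2 =
      cosh (2 * r) ^ 2 * (ζ ^ 2 / (4 * log 2 ^ 2)) / (2 * sinh r ^ 2) := by
    rw [mul_pow, div_pow, mul_pow, mul_pow, sq_sqrt (by norm_num)]
    field_simp
    ring
  rw [hb]
  rcases le_or_gt (π / 2) |θ| with hθ | hθ
  · have h1 : 1 ≤ θ ^ 2 := by
      rw [← sq_abs]
      nlinarith [pi_gt_three]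
    have h2 : 0 ≤ cosh (2 * r) ^ 2 * (ζ ^ 2 / (4 * log 2 ^ 2)) / (2 * sinh r ^ 2) := by
      positivity
    nlinarith [mul_le_mul hC hC zero_le_one (by linarith)]
  rcases le_or_gt |ζ| (log 2) with hζ | hζ
  · have h1 := h hθ
    have h2 := cosh_sub_one_le hζ
    have h3 := one_sub_sq_div_two_le_cos (x := θ)
    have h4 : 2 * sinh r ^ 2 * (1 - (cosh r * θ) ^ 2) ≤
        cosh (2 * r) ^ 2 * (ζ ^ 2 / (4 * log 2 ^ 2)) := by
      have k1 := mul_le_mul_of_nonneg_left h2 (sq_nonneg (cosh (2 * r)))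
      have k2 := mul_le_mul_of_nonneg_left h3 (sq_nonneg (sinh (2 * r)))
      have k3 := cosh_sq (2 * r)
      rw [hs2] at k2 h1 k3
      nlinarith
    have h5 : 1 - (cosh r * θ) ^ 2 ≤
        cosh (2 * r) ^ 2 * (ζ ^ 2 / (4 * log 2 ^ 2)) / (2 * sinh r ^ 2) := by
      rw [le_div_iff₀ (by positivity)]
      linarith
    linarith
  · have h1 : 1 / 4 ≤ ζ ^ 2 / (4 * log 2 ^ 2) := by
      rw [div_le_div_iff₀ (by norm_num) (by positivity), ← sq_abs ζ]
      nlinarith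
    have h2 : 1 ≤ cosh (2 * r) ^ 2 * (ζ ^ 2 / (4 * log 2 ^ 2)) / (2 * sinh r ^ 2) := by
      rw [le_div_iff₀ (by positivity), hc2]
      have := mul_le_mul_of_nonneg_left h1 (sq_nonneg (1 + 2 * sinh r ^ 2))
      nlinarith [sq_nonneg (1 - 2 * sinh r ^ 2)]
    nlinarith [sq_nonneg (cosh r * θ)]

/-- The constant `2 √6 log 2 = 3.39571…` of the bound. -/
lemma packingBound_le {r a : ℝ} (hr : 0 < r)
    (h : √3 ≤ cosh r * (cosh (2 * r) / (√8 * log 2 * sinh r)) * a) : packingBound r ≤ a := by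
  have hS : 0 < sinh r := sinh_pos_iff.mpr hr
  have hC := cosh_pos r
  have hc := cosh_pos (2 * r)
  have hL : 0 < log 2 := log_pos (by norm_num)
  have h8 : 0 < √8 := sqrt_pos.mpr (by norm_num)
  have h24 : (4.8989794 : ℝ) ≤ √3 * √8 := by
    rw [← sqrt_mul (by norm_num)]
    exact le_sqrt_of_sq_le (by norm_num)
  have hl := log_two_gt_d9
  have key : 3.3957 ≤ √3 * √8 * log 2 := by
    have := mul_le_mul h24 hl.le (by norm_num) (by positivity)
    refine le_trans ?_ this
    norm_num
  have h2 : cosh r * (cosh (2 * r) / (√8 * log 2 * sinh r)) * a =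
    cosh r * cosh (2 * r) * a / (√8 * log 2 * sinh r) := by ring
  rw [h2, le_div_iff₀ (by positivity)] at h
  rw [packingBound, tanh_eq_sinh_div_cosh, div_div, mul_div_assoc', div_le_iff₀ (by positivity)]
  nlinarith

end TubularHyp

namespace TubularManifold

open TubularHyp

variable {M : Type*} [TopologicalSpace M] {ι : Type*} {X : TubularManifold M ι}
variable {p₀ : X.Filling} {i : ι} {r : ℝ}

/-- The point with coordinates `(r, w)` of the tube about the end `i` is a touching point: it also
belongs to the tube of radius `r` about some end in another way. -/
def IsTouching (X : TubularManifold M ι) (p₀ : X.Filling) (r : ℝ) (i : ι) (w : ℝ × ℝ) : Prop :=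
  ∃ j w', X.tube p₀ i (r, w) = X.tube p₀ j (r, w') ∧
    ¬ (i = j ∧ vis (X.radius i) (w - w') ∈ X.lattice i)

/-- The coefficients of the form, in flat coordinates of a boundary torus of tube radius `R`,
that is at least `1` on the differences of touching points. -/
def coeffA (r R : ℝ) : ℝ := (cosh r / sinh R) ^ 2

/-- See `coeffA`. -/
def coeffB (r R : ℝ) : ℝ := (cosh (2 * r) / (√8 * log 2 * sinh r) / cosh R) ^ 2

lemma coeffA_pos (r : ℝ) {R : ℝ} (hR : 0 < R) : 0 < coeffA r R := by
  have := sinh_pos_iff.mpr hR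
  have := cosh_pos r
  unfold coeffA; positivity

lemma coeffB_pos (hr : 0 < r) (R : ℝ) : 0 < coeffB r R := by
  have := sinh_pos_iff.mpr hr
  have := cosh_pos (2 * r)
  have := cosh_pos R
  have : 0 < log 2 := log_pos (by norm_num)
  unfold coeffB; positivity

lemma sqrt_coeff_mul (hr : 0 < r) :
    √(coeffA r (X.radius i) * coeffB r (X.radius i)) * ZLattice.covolume (X.lattice i) =
      cosh r * (cosh (2 * r) / (√8 * log 2 * sinh r)) * X.visualArea i := by
  have hR := X.radius_pos i
  have h1 := sinh_pos_iff.mpr hr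
  have h2 := sinh_pos_iff.mpr hR
  have h3 := cosh_pos r
  have h4 := cosh_pos (2 * r)
  have h5 := cosh_pos (X.radius i)
  have h6 : 0 < log 2 := log_pos (by norm_num)
  rw [coeffA, coeffB, ← mul_pow, sqrt_sq (by positivity), visualArea, torusArea]
  field_simp

lemma visualArea_nonneg : 0 ≤ X.visualArea i := by
  have := (sinh_pos_iff.mpr (X.radius_pos i)).le
  have := (cosh_pos (X.radius i)).le
  have := (ZLattice.covolume_pos (X.lattice i) MeasureTheory.volume).le
  unfold visualArea torusArea
  positivity

variable [T2Space M] [CompactSpace M]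

lemma IsTouching.unvis_add [Finite ι] (hE : X.EmbTo p₀ r) (hr : 0 < r)
    {w : ℝ × ℝ} (h : X.IsTouching p₀ r i w) {γ : Plane} (hγ : γ ∈ X.lattice i) :
    X.IsTouching p₀ r i (unvis (X.radius i) γ + w) := by
  obtain ⟨j, w', heq, hne⟩ := h
  have hvis := vis_unvis (X.radius_pos i) γ
  refine ⟨j, w', ?_, ?_⟩
  · rw [(tube_lattice (by rwa [hvis]) (hE.mem_tubeDom hr ⟨hr, by linarith⟩)).2, heq]
  · rintro ⟨hij, hm⟩
    refine hne ⟨hij, ?_⟩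
    have := (X.lattice i).sub_mem hm hγ
    rwa [add_sub_assoc, vis_add, hvis, add_sub_cancel_left] at this

lemma IsTouching.one_le_axisForm [Finite ι] (hE : X.EmbTo p₀ r) (hr : 0 < r)
    {w w' : ℝ × ℝ} (h : X.IsTouching p₀ r i w) (h' : X.IsTouching p₀ r i w') {u : Plane}
    (hu : vis (X.radius i) (w' - w) = u) (hu0 : u ≠ 0) :
    1 ≤ axisForm (coeffA r (X.radius i)) (coeffB r (X.radius i)) u := by
  obtain ⟨j, v, heq, hne⟩ := h
  obtain ⟨j', v', heq', hne'⟩ := h'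
  have hΔ : w' - w = unvis (X.radius i) u := by rw [← hu, unvis_vis (X.radius_pos i)]
  have hne0 : w' - w ≠ 0 := by
    intro h0
    refine hu0 ?_
    rw [← hu, h0]
    ext k
    fin_cases k <;> simp [vis]
  refine (one_le_form_of_separated hr fun hθ =>
    hE.touching_separated hr heq hne heq' hne' hne0 hθ).trans_eq ?_
  rw [hΔ]
  simp only [axisForm, coeffA, coeffB, unvis]
  ring

lemma IsTouching.one_le_lattice [Finite ι] (hE : X.EmbTo p₀ r) (hr : 0 < r)
    {w : ℝ × ℝ} (h : X.IsTouching p₀ r i w) :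
    ∀ γ ∈ X.lattice i, γ ≠ 0 → 1 ≤ axisForm (coeffA r (X.radius i)) (coeffB r (X.radius i)) γ :=
  fun γ hγ h0 => h.one_le_axisForm hE hr (h.unvis_add hE hr hγ)
    (by rw [add_sub_cancel_right, vis_unvis (X.radius_pos i)]) h0

/-- Tubes about the ends that touch at the radius `r` force a lower bound on the visual area: two
inequivalent touching points on one torus, or one touching point on each of two tori. -/
lemma EmbTo.packingBound_le [Fintype ι] (hE : X.EmbTo p₀ r) (hr : 0 < r) {j : ι}
    {v v' : ℝ × ℝ} (heq : X.tube p₀ i (r, v) = X.tube p₀ j (r, v'))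
    (hne : ¬ (i = j ∧ vis (X.radius i) (v - v') ∈ X.lattice i)) :
    packingBound r ≤ X.totalVisualArea := by
  have hneg : vis (X.radius j) (v' - v) = -vis (X.radius j) (v - v') := by
    rw [vis_sub, vis_sub, neg_sub]
  have ht : X.IsTouching p₀ r i v := ⟨j, v', heq, hne⟩
  have ht' : X.IsTouching p₀ r j v' := by
    refine ⟨i, v, heq.symm, ?_⟩
    rintro ⟨rfl, hm⟩
    rw [hneg] at hm
    exact hne ⟨rfl, (X.lattice _).neg_mem_iff.mp hm⟩
  have hκ : 0 ≤ cosh r * (cosh (2 * r) / (√8 * log 2 * sinh r)) := by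
    have := sinh_pos_iff.mpr hr
    have := cosh_pos r
    have := cosh_pos (2 * r)
    have : 0 < log 2 := log_pos (by norm_num)
    positivity
  refine TubularHyp.packingBound_le hr ?_
  by_cases hij : i = j
  · subst hij
    refine le_trans ?_ (mul_le_mul_of_nonneg_left
      (Finset.single_le_sum (fun k _ => visualArea_nonneg (X := X) (i := k)) (Finset.mem_univ i))
      hκ)
    rw [← sqrt_coeff_mul hr]
    refine sqrt_three_le_covolume (coeffA_pos r (X.radius_pos i)) (coeffB_pos hr _)
      (ht.one_le_lattice hE hr) (v := vis (X.radius i) (v' - v)) fun γ hγ => ?_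
    refine ht.one_le_axisForm hE hr (ht'.unvis_add hE hr hγ) ?_ fun h0 => hne ⟨rfl, ?_⟩
    · rw [add_sub_assoc, vis_add, vis_unvis (X.radius_pos i), add_comm]
    · rw [hneg] at h0
      rwa [← neg_add_eq_zero.mp h0] at hγ
  · have hle : X.visualArea i + X.visualArea j ≤ X.totalVisualArea := by
      classical
      rw [← Finset.sum_pair hij]
      exact Finset.sum_le_sum_of_subset_of_nonneg (Finset.subset_univ _)
        fun _ _ _ => visualArea_nonneg
    refine le_trans ?_ (mul_le_mul_of_nonneg_left hle hκ)
    rw [mul_add, ← sqrt_coeff_mul hr, ← sqrt_coeff_mul hr]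
    have h1 := sqrt_three_div_two_le_covolume (coeffA_pos r (X.radius_pos i)) (coeffB_pos hr _)
      (ht.one_le_lattice hE hr)
    have h2 := sqrt_three_div_two_le_covolume (coeffA_pos r (X.radius_pos j)) (coeffB_pos hr _)
      (ht'.one_le_lattice hE hr)
    linarith

end TubularManifold

end

theorem mainTheorem9 {M : Type*} [TopologicalSpace M] [T2Space M] [CompactSpace M]
    {ι : Type*} [Fintype ι] [Nonempty ι] (X : TubularManifold M ι) :
    X.tubeRadii.Nonempty ∧ BddAbove X.tubeRadii ∧
      packingBound X.tubeRadius ≤ X.totalVisualArea := by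
  have hbdd := X.bddAbove_tubeRadii
  have hnon := X.tubeRadii_nonempty
  refine ⟨hnon, hbdd, ?_⟩
  obtain ⟨k⟩ := ‹Nonempty ι›
  let p₀ : X.Filling := ⟨(X.torus k 0, 0), Or.inl rfl⟩
  have hE : X.EmbTo p₀ X.tubeRadius := TubularManifold.EmbTo.of_forall_lt fun s hs => by
    obtain ⟨t, ht, hst⟩ := exists_lt_of_lt_csSup hnon hs
    exact ⟨t, hst, TubularManifold.embTo_of_mem_tubeRadii ht⟩
  have hr : 0 < X.tubeRadius := by
    obtain ⟨t, ht⟩ := hnon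
    exact ht.1.trans_le (le_csSup hbdd ht)
  obtain ⟨i, j, v, v', heq, hne⟩ := hE.exists_touching hr
    fun r' hr' hm => (le_csSup hbdd hm).not_gt hr'
  exact hE.packingBound_le hr heq hne
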